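/- Let $K$ be a field of characteristic $0$ and let $H$ be a Hopf algebra over $K$ with antipode $S$ and an ad-invariant integral $\lambda\in H^*$, i.e. $\lambda(1)=1$, $h_{(1)}\lambda(h_{(2)})=\lambda(h)1_H=\lambda(h_{(1)})h_{(2)}$, and $\lambda(h_{(1)}xS(h_{(2)}))=\varepsilon_H(h)\lambda(x)=\lambda(S(h_{(1)})xh_{(2)})$ for all $h,x\in H$. In the category ${}^H_H\mathcal{YD}$ of left-left Yetter-Drinfeld modules (coaction $\rho(x)=x_{\langle -1\rangle}\otimes x_{\langle 0\rangle}$) the tensor product of two coalgebras $C,D$ is a coalgebra with $\Delta(x\otimes y)=x^{(1)}\otimes x^{(2)}_{\langle -1\rangle}y^{(1)}\otimes x^{(2)}_{\langle 0\rangle}\otimes y^{(2)}$ and counit $\varepsilon_C\otimes\varepsilon_D$; all convolution products $*$ on $R\otimes R$ and $R\otimes R\otimes R$ below are taken with respect to these coalgebra structures. A pre-bialgebra $(R,m,u,\Delta,\varepsilon)$ in ${}^H_H\mathcal{YD}$ is a coalgebra $(R,\Delta,\varepsilon)$ in ${}^H_H\mathcal{YD}$ with a coaugmentation $u:K\to R$,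 $1_R=u(1)$ (a coalgebra map in ${}^H_H\mathcal{YD}$), and a left $H$-linear coalgebra map $m:R\otimes R\to R$ for which $1_R$ is a two-sided unit ($m$ need be neither associative nor $H$-colinear). It is connected if its coradical is $K1_R$. Write $C=R\otimes R$. A cocycle for $R$ is a $K$-linear map $\xi:C\to H$ such that, for all $z\in C$ and $r,s,t\in R$: (a) $\xi$ is left $H$-linear for the adjoint action $h\rightharpoonup x=h_{(1)}xS(h_{(2)})$ on $H$; (b) $\Delta_H\xi(z)=\xi(z^{(1)})z^{(2)}_{\langle -1\rangle}\otimes\xi(z^{(2)}_{\langle 0\rangle})$ and $\varepsilon_H\xi=\varepsilon\otimes\varepsilon$; (c) $m(z^{(1)})_{\langle -1\rangle}\xi(z^{(2)})\otimes m(z^{(1)})_{\langle 0\rangle}=\xi(z^{(1)})z^{(2)}_{\langle -1\rangle}\otimes m(z^{(2)}_{\langle 0\rangle})$; (d) $m(r\otimes m(s\otimes t))=m\big(m(z^{(1)})\otimes\xi(z^{(2)})t\big)$ with $z=r\otimes s$; (e) $\xi\big(r\otimes m(w^{(1)})\big)\xi(w^{(2)})=\xi\big(m(z^{(1)})\otimes\xi(z^{(2)})_{(1)}t\big)\xi(z^{(2)})_{(2)}$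 with $w=s\otimes t$, $z=r\otimes s$; (f) $\xi(r\otimes 1_R)=\xi(1_R\otimes r)=\varepsilon(r)1_H$. Let $\Xi$ be the set of cocycles for $R$. For a linear form $v$ on a left $H$-comodule put $\Psi(v)=(H\otimes v)\rho$. Let $\mathcal G$ be the set of left $H$-linear maps $v:C\to K$ ($K$ with trivial action) with $v(1_R\otimes 1_R)=1$ and $\lambda\circ\Psi(v)=\varepsilon_C$, and let $\mathcal S$ be the set of linear maps $\xi:C\to H$ satisfying (a), (b) and $\xi(1_R\otimes 1_R)=1_H$. For a convolution invertible $v:C\to K$ put $m^v=v*m*v^{-1}$ and $$\alpha(v)=v(R\otimes m^v)*(\varepsilon\otimes v)*(v^{-1}\otimes\varepsilon)*v^{-1}(m^v\otimes R):R\otimes R\otimes R\to K.$$ **Theorem.** Let $(R,m,u,\Delta,\varepsilon)$ be a connected pre-bialgebra in ${}^H_H\mathcal{YD}$. Then every $v\in\mathcal G$, and $\lambda\xi$ for every $\xi\in\mathcal S$, is convolution invertible, $\Xi\subseteq\mathcal S$, and the map $G(\xi)=(\lambda\xi)^{-1}$ restricts to a bijection from $\Xi$ onto the set $V$ of all $v\in\mathcal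 G$ such that 1. $m^v$ is $H$-colinear: $\rho_R m^v=(H\otimes m^v)\rho_{R\otimes R}$; 2. $m^v(R\otimes m^v)*\alpha(v)=\alpha(v)*m^v(m^v\otimes R)$; 3. $\Psi(\alpha(v))=u_H\alpha(v)$, where $u_H:K\to H$ is the unit of $H$; 4. $v(r\otimes 1_R)=v(1_R\otimes r)=\varepsilon(r)$ for all $r\in R$. The inverse bijection is $F(v)=u_Hv^{-1}*\Psi(v)$. -/

import Mathlib

open scoped TensorProduct

noncomputable section

namespace YD

section Hopf

variable {K H : Type*} [Field K] [Ring H] [HopfAlgebra K H]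

variable (K H) in
/-- The map `a ⊗ b ↦ (x ↦ a x b)`. -/
def biMul : H ⊗[K] H →ₗ[K] Module.End K H :=
  LinearMap.mul' K (Module.End K H) ∘ₗ
    TensorProduct.map (LinearMap.mul K H) (LinearMap.mul K H).flip

/-- The left adjoint action `h ⇀ x = h₍₁₎ x S(h₍₂₎)`. -/
def adLeft : H →ₗ[K] Module.End K H :=
  biMul K H ∘ₗ (HopfAlgebra.antipode K).lTensor H ∘ₗ Coalgebra.comul

/-- The right adjoint action, `adRight h x = S(h₍₁₎) x h₍₂₎`. -/
def adRight : H →ₗ[K] Module.End K H :=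
  biMul K H ∘ₗ (HopfAlgebra.antipode K).rTensor H ∘ₗ Coalgebra.comul

/-- A left and right integral `lam ∈ H*` with `lam 1 = 1` that is invariant under the left and
the right adjoint actions. -/
structure IsAdInvariantIntegral (lam : H →ₗ[K] K) : Prop where
  map_one : lam 1 = 1
  left_integral : ∀ h : H,
    TensorProduct.rid K H (lam.lTensor H (Coalgebra.comul h)) = lam h • (1 : H)
  right_integral : ∀ h : H,
    TensorProduct.lid K H (lam.rTensor H (Coalgebra.comul h)) = lam h • (1 : H)
  ad_left : ∀ h x : H, lam (adLeft (K := K) h x) = Coalgebra.counit (R := K) h * lam x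
  ad_right : ∀ h x : H, lam (adRight (K := K) h x) = Coalgebra.counit (R := K) h * lam x

end Hopf

section Coradical

variable {K C : Type*} [Field K] [AddCommGroup C] [Module K C] [Coalgebra K C]

/-- `D` is a subcoalgebra of `C`: `Δ(D) ⊆ D ⊗ D`. -/
def IsSubcoalgebra (D : Submodule K C) : Prop :=
  ∀ d ∈ D, Coalgebra.comul (R := K) d ∈
    LinearMap.range (TensorProduct.map D.subtype D.subtype)

/-- `D` is a simple subcoalgebra of `C`. -/
def IsSimpleSubcoalgebra (D : Submodule K C) : Prop :=
  IsSubcoalgebra D ∧ D ≠ ⊥ ∧ ∀ E : Submodule K C, IsSubcoalgebra E → E ≤ D → E = ⊥ ∨ E = D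

variable (K C) in
/-- The coradical: the sum of all simple subcoalgebras. -/
def coradical : Submodule K C := sSup {D | IsSimpleSubcoalgebra D}

end Coradical

section Convolution

variable {K C A M : Type*} [Field K] [AddCommGroup C] [Module K C]
  [Ring A] [Algebra K A] [AddCommGroup M] [Module K M]

/-- Convolution product of two maps into an algebra, with respect to a comultiplication `Δ`. -/
def conv (Δ : C →ₗ[K] C ⊗[K] C) (f g : C →ₗ[K] A) : C →ₗ[K] A :=
  LinearMap.mul' K A ∘ₗ TensorProduct.map f g ∘ₗ Δ

/-- `(v * f)(z) = v(z⁽¹⁾) f(z⁽²⁾)` for scalar valued `v`. -/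
def convLeft (Δ : C →ₗ[K] C ⊗[K] C) (v : C →ₗ[K] K) (f : C →ₗ[K] M) : C →ₗ[K] M :=
  (TensorProduct.lid K M).toLinearMap ∘ₗ TensorProduct.map v f ∘ₗ Δ

/-- `(f * v)(z) = f(z⁽¹⁾) v(z⁽²⁾)` for scalar valued `v`. -/
def convRight (Δ : C →ₗ[K] C ⊗[K] C) (f : C →ₗ[K] M) (v : C →ₗ[K] K) : C →ₗ[K] M :=
  (TensorProduct.rid K M).toLinearMap ∘ₗ TensorProduct.map f v ∘ₗ Δ

/-- `v` and `w` are mutually inverse for the convolution product of `Hom(C, K)`, whose unit is the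
counit `ε`. -/
def IsConvInverse (Δ : C →ₗ[K] C ⊗[K] C) (ε v w : C →ₗ[K] K) : Prop :=
  conv Δ v w = ε ∧ conv Δ w v = ε

/-- `v` is convolution invertible. -/
def ConvInvertible (Δ : C →ₗ[K] C ⊗[K] C) (ε v : C →ₗ[K] K) : Prop :=
  ∃ w, IsConvInverse Δ ε v w

open Classical in
/-- The convolution inverse of `v` (meaningful only if `v` is convolution invertible). -/
def convInv (Δ : C →ₗ[K] C ⊗[K] C) (ε v : C →ₗ[K] K) : C →ₗ[K] K :=
  if h : ConvInvertible Δ ε v then h.choose else 0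

end Convolution

section YetterDrinfeld

variable {K H V W : Type*} [Field K] [Ring H] [HopfAlgebra K H]
  [AddCommGroup V] [Module K V] [AddCommGroup W] [Module K W]

/-- The braiding `v ⊗ w ↦ v₍₋₁₎ w ⊗ v₍₀₎`, for a coaction `ρ` on `V` and an action `a` on `W`. -/
def braid (ρ : V →ₗ[K] H ⊗[K] V) (a : H ⊗[K] W →ₗ[K] W) : V ⊗[K] W →ₗ[K] W ⊗[K] V :=
  a.rTensor V ∘ₗ (TensorProduct.rightComm K H V W).toLinearMap ∘ₗ ρ.rTensor W

variable (K H V) in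
/-- The data of an action and a coaction of `H` on `V`. The laws of a Yetter-Drinfeld module
not built into the data are in `YDStr.IsYD`. -/
structure YDStr where
  /-- the left `H`-action -/
  act : H →ₐ[K] Module.End K V
  /-- the left `H`-coaction -/
  coact : V →ₗ[K] H ⊗[K] V

namespace YDStr

/-- The action as a map `H ⊗ V → V`. -/
def actMap (X : YDStr K H V) : H ⊗[K] V →ₗ[K] V := TensorProduct.lift X.act.toLinearMap

/-- `h` acts on `H ⊗ V` by `g ⊗ v ↦ h₍₁₎ g S(h₍₃₎) ⊗ h₍₂₎ v`. -/
def twist (X : YDStr K H V) : H →ₗ[K] Module.End K (H ⊗[K] V) :=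
  (Module.endTensorEndAlgHom (R := K) (S := K) (A := K) (M := H) (N := V)).toLinearMap ∘ₗ
    TensorProduct.map (biMul K H ∘ₗ (HopfAlgebra.antipode K).lTensor H) X.act.toLinearMap ∘ₗ
    (TensorProduct.rightComm K H H H).toLinearMap ∘ₗ
    (Coalgebra.comul (R := K) (A := H)).rTensor H ∘ₗ Coalgebra.comul

/-- The laws of a left-left Yetter-Drinfeld module (those of the action are built into `act`):
`V` is a left comodule and `ρ(h v) = h₍₁₎ v₍₋₁₎ S(h₍₃₎) ⊗ h₍₂₎ v₍₀₎`. -/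
structure IsYD (X : YDStr K H V) : Prop where
  coassoc : (TensorProduct.assoc K H H V).toLinearMap ∘ₗ
      (Coalgebra.comul (R := K) (A := H)).rTensor V ∘ₗ X.coact = X.coact.lTensor H ∘ₗ X.coact
  counit_coact : ∀ v, TensorProduct.lid K V
      ((Coalgebra.counit (R := K) (A := H)).rTensor V (X.coact v)) = v
  compat : ∀ h v, X.coact (X.act h v) = X.twist h (X.coact v)

/-- The unit object `K`: `h k = ε(h) k`, `ρ(k) = 1 ⊗ k`. -/
def unit : YDStr K H K where
  act := (Algebra.ofId K (Module.End K K)).comp (Bialgebra.counitAlgHom K H)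
  coact := TensorProduct.mk K H K 1

/-- The tensor product: `h (v ⊗ w) = h₍₁₎ v ⊗ h₍₂₎ w` and
`ρ(v ⊗ w) = v₍₋₁₎ w₍₋₁₎ ⊗ (v₍₀₎ ⊗ w₍₀₎)`. -/
def tensor (X : YDStr K H V) (Y : YDStr K H W) : YDStr K H (V ⊗[K] W) where
  act := (Module.endTensorEndAlgHom (R := K) (S := K) (A := K) (M := V) (N := W)).comp
    ((Algebra.TensorProduct.map X.act Y.act).comp (Bialgebra.comulAlgHom K H))
  coact := (LinearMap.mul' K H).rTensor (V ⊗[K] W) ∘ₗ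
    (TensorProduct.tensorTensorTensorComm K H V H W).toLinearMap ∘ₗ
    TensorProduct.map X.coact Y.coact

/-- `f` is left `H`-linear. -/
def IsLinear (X : YDStr K H V) (Y : YDStr K H W) (f : V →ₗ[K] W) : Prop :=
  ∀ h v, f (X.act h v) = Y.act h (f v)

/-- `f` is left `H`-colinear. -/
def IsColinear (X : YDStr K H V) (Y : YDStr K H W) (f : V →ₗ[K] W) : Prop :=
  Y.coact ∘ₗ f = f.lTensor H ∘ₗ X.coact

/-- `f` is left `H`-linear with values in `H` with the left adjoint action. -/
def IsAdLinear (X : YDStr K H V) (f : V →ₗ[K] H) : Prop :=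
  ∀ h v, f (X.act h v) = adLeft (K := K) h (f v)

/-- `Ψ(v) = (H ⊗ v) ρ`. -/
def Psi (X : YDStr K H V) (v : V →ₗ[K] K) : V →ₗ[K] H :=
  (TensorProduct.rid K H).toLinearMap ∘ₗ v.lTensor H ∘ₗ X.coact

/-- The comultiplication `(C ⊗ c_{C,D} ⊗ D)(Δ_C ⊗ Δ_D)` of the tensor product of two coalgebras
of Yetter-Drinfeld modules. -/
def tensorComul (X : YDStr K H V) (Y : YDStr K H W)
    (ΔV : V →ₗ[K] V ⊗[K] V) (ΔW : W →ₗ[K] W ⊗[K] W) :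
    V ⊗[K] W →ₗ[K] (V ⊗[K] W) ⊗[K] (V ⊗[K] W) :=
  (TensorProduct.assoc K V W (V ⊗[K] W)).symm.toLinearMap ∘ₗ
    ((TensorProduct.assoc K W V W).toLinearMap ∘ₗ
      (braid X.coact Y.actMap).rTensor W ∘ₗ
      (TensorProduct.assoc K V W W).symm.toLinearMap).lTensor V ∘ₗ
    (TensorProduct.assoc K V V (W ⊗[K] W)).toLinearMap ∘ₗ
    TensorProduct.map ΔV ΔW

/-- `Φ(α) : C ⊗ M → C ⊗ M`, `z ⊗ t ↦ z⁽¹⁾ ⊗ α(z⁽²⁾) t`, for a coalgebra `(C, Δ)` and an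
`H`-module `M`. -/
def Phi {C : Type*} [AddCommGroup C] [Module K C] (Y : YDStr K H W)
    (Δ : C →ₗ[K] C ⊗[K] C) (α : C →ₗ[K] H) : C ⊗[K] W →ₗ[K] C ⊗[K] W :=
  Y.actMap.lTensor C ∘ₗ (TensorProduct.assoc K C H W).toLinearMap ∘ₗ
    (α.lTensor C ∘ₗ Δ).rTensor W

end YDStr

/-- The counit `ε_V ⊗ ε_W` of a tensor product; more generally `(f ⊗ g)(v ⊗ w) = f(v) g(w)`. -/
def tensorForm (f : V →ₗ[K] K) (g : W →ₗ[K] K) : V ⊗[K] W →ₗ[K] K :=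
  LinearMap.mul' K K ∘ₗ TensorProduct.map f g

end YetterDrinfeld

section PreBialgebra

variable (K H R : Type*) [Field K] [Ring H] [HopfAlgebra K H]
  [AddCommGroup R] [Module K R] [Coalgebra K R]

/-- A pre-bialgebra structure in the category of left-left Yetter-Drinfeld modules over `H` on the
coalgebra `R`. -/
structure PreBialgebra where
  /-- the action and the coaction of `H` on `R` -/
  yd : YDStr K H R
  isYD : yd.IsYD
  comul_linear : yd.IsLinear (yd.tensor yd) Coalgebra.comul
  comul_colinear : yd.IsColinear (yd.tensor yd) Coalgebra.comul
  counit_linear : yd.IsLinear YDStr.unit Coalgebra.counit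
  counit_colinear : yd.IsColinear YDStr.unit Coalgebra.counit
  /-- the element `1_R = u_R(1)` given by the coaugmentation -/
  one : R
  counit_one : Coalgebra.counit (R := K) one = 1
  comul_one : Coalgebra.comul (R := K) one = one ⊗ₜ[K] one
  act_one : ∀ h : H, yd.act h one = Coalgebra.counit (R := K) h • one
  coact_one : yd.coact one = (1 : H) ⊗ₜ[K] one
  /-- the multiplication, in general neither associative nor colinear -/
  mul : R ⊗[K] R →ₗ[K] R
  mul_linear : (yd.tensor yd).IsLinear yd mul
  comul_mul : Coalgebra.comul ∘ₗ mul =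
    TensorProduct.map mul mul ∘ₗ yd.tensorComul yd Coalgebra.comul Coalgebra.comul
  counit_mul : Coalgebra.counit ∘ₗ mul = tensorForm Coalgebra.counit Coalgebra.counit
  mul_one : ∀ r, mul (r ⊗ₜ one) = r
  one_mul : ∀ r, mul (one ⊗ₜ r) = r

variable {K H R}

namespace PreBialgebra

/-- `R` is connected: its coradical is `K 1_R`. -/
def IsConnected (P : PreBialgebra K H R) : Prop := coradical K R = K ∙ P.one

variable (P : PreBialgebra K H R)

/-- The Yetter-Drinfeld structure of `R ⊗ R`. -/
def yd₂ : YDStr K H (R ⊗[K] R) := P.yd.tensor P.yd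

/-- The comultiplication of `R ⊗ R`. -/
def comul₂ : R ⊗[K] R →ₗ[K] (R ⊗[K] R) ⊗[K] (R ⊗[K] R) :=
  P.yd.tensorComul P.yd Coalgebra.comul Coalgebra.comul

variable (K R) in
/-- The counit of `R ⊗ R`. -/
def counit₂ : R ⊗[K] R →ₗ[K] K := tensorForm Coalgebra.counit Coalgebra.counit

/-- The Yetter-Drinfeld structure of `R ⊗ R ⊗ R`, bracketed to the left. -/
def yd₃ : YDStr K H ((R ⊗[K] R) ⊗[K] R) := P.yd₂.tensor P.yd

/-- The comultiplication of `R ⊗ R ⊗ R`, bracketed to the left. -/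
def comul₃ : (R ⊗[K] R) ⊗[K] R →ₗ[K] ((R ⊗[K] R) ⊗[K] R) ⊗[K] ((R ⊗[K] R) ⊗[K] R) :=
  P.yd₂.tensorComul P.yd P.comul₂ Coalgebra.comul

/-- `(f ⊗ ρ_{R ⊗ R}) Δ_{R ⊗ R}` with the tensor factors bracketed as `(H ⊗ H) ⊗ (R ⊗ R)`:
`z ↦ f(z⁽¹⁾) ⊗ z⁽²⁾₍₋₁₎ ⊗ z⁽²⁾₍₀₎`. -/
def splitCoact (f : R ⊗[K] R →ₗ[K] H) :
    R ⊗[K] R →ₗ[K] (H ⊗[K] H) ⊗[K] (R ⊗[K] R) :=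
  (TensorProduct.assoc K H H (R ⊗[K] R)).symm.toLinearMap ∘ₗ
    TensorProduct.map f P.yd₂.coact ∘ₗ P.comul₂

/-- A normalized dual Sweedler 1-cocycle `R ⊗ R → H`. -/
structure IsSweedlerCocycle (ξ : R ⊗[K] R →ₗ[K] H) : Prop where
  comul_comp : Coalgebra.comul ∘ₗ ξ =
    TensorProduct.map (LinearMap.mul' K H) ξ ∘ₗ P.splitCoact ξ
  counit_comp : Coalgebra.counit ∘ₗ ξ = counit₂ K R

/-- A cocycle for the pre-bialgebra. In `braided`, the braiding `R ⊗ H → H ⊗ R` is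
`r ⊗ h ↦ r₍₋₁₎ h ⊗ r₍₀₎`, with `H` acting on itself by left multiplication. In `cocycle`, the
braiding `H ⊗ R → R ⊗ H` is `h ⊗ r ↦ h₍₁₎ r ⊗ h₍₂₎`. -/
structure IsCocycle (ξ : R ⊗[K] R →ₗ[K] H) : Prop where
  linear : P.yd₂.IsAdLinear ξ
  sweedler : P.IsSweedlerCocycle ξ
  braided : braid P.yd.coact (LinearMap.mul' K H) ∘ₗ TensorProduct.map P.mul ξ ∘ₗ P.comul₂ =
    TensorProduct.map (LinearMap.mul' K H) P.mul ∘ₗ P.splitCoact ξ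
  assoc : P.mul ∘ₗ P.mul.lTensor R ∘ₗ (TensorProduct.assoc K R R R).toLinearMap =
    P.mul ∘ₗ P.mul.rTensor R ∘ₗ P.yd.Phi P.comul₂ ξ
  cocycle :
    LinearMap.mul' K H ∘ₗ ξ.rTensor H ∘ₗ (TensorProduct.assoc K R R H).symm.toLinearMap ∘ₗ
        (TensorProduct.map P.mul ξ ∘ₗ P.comul₂).lTensor R ∘ₗ
        (TensorProduct.assoc K R R R).toLinearMap =
      LinearMap.mul' K H ∘ₗ ξ.rTensor H ∘ₗ (TensorProduct.assoc K R R H).symm.toLinearMap ∘ₗ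
        (braid (Coalgebra.comul (R := K) (A := H)) P.yd.actMap).lTensor R ∘ₗ
        (TensorProduct.assoc K R H R).toLinearMap ∘ₗ
        (TensorProduct.map P.mul ξ ∘ₗ P.comul₂).rTensor R
  map_one_right : ∀ r, ξ (r ⊗ₜ P.one) = Coalgebra.counit (R := K) r • (1 : H)
  map_one_left : ∀ r, ξ (P.one ⊗ₜ r) = Coalgebra.counit (R := K) r • (1 : H)

/-- The set `Ξ` of cocycles for the pre-bialgebra. -/
def cocycles : Set (R ⊗[K] R →ₗ[K] H) := {ξ | P.IsCocycle ξ}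

/-- The set `𝒮` of left `H`-linear normalized dual Sweedler 1-cocycles `ξ : R ⊗ R → H` with
`ξ(1 ⊗ 1) = 1`. -/
def setS : Set (R ⊗[K] R →ₗ[K] H) :=
  {ξ | P.yd₂.IsAdLinear ξ ∧ P.IsSweedlerCocycle ξ ∧ ξ (P.one ⊗ₜ P.one) = 1}

/-- The set `𝒢` of left `H`-linear `v : R ⊗ R → K` with `v(1 ⊗ 1) = 1` and
`λ ∘ Ψ(v) = ε`. -/
def setG (lam : H →ₗ[K] K) : Set (R ⊗[K] R →ₗ[K] K) :=
  {v | P.yd₂.IsLinear YDStr.unit v ∧ v (P.one ⊗ₜ P.one) = 1 ∧ lam ∘ₗ P.yd₂.Psi v = counit₂ K R}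

/-- Convolution invertibility in `Hom(R ⊗ R, K)`. -/
def Invertible₂ (v : R ⊗[K] R →ₗ[K] K) : Prop := ConvInvertible P.comul₂ (counit₂ K R) v

/-- The convolution inverse in `Hom(R ⊗ R, K)`. -/
def inv₂ (v : R ⊗[K] R →ₗ[K] K) : R ⊗[K] R →ₗ[K] K := convInv P.comul₂ (counit₂ K R) v

/-- `G(ξ) = (λ ξ)⁻¹`. -/
def mapG (lam : H →ₗ[K] K) (ξ : R ⊗[K] R →ₗ[K] H) : R ⊗[K] R →ₗ[K] K := P.inv₂ (lam ∘ₗ ξ)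

/-- `F(v) = u_H v⁻¹ * Ψ(v)`. -/
def mapF (v : R ⊗[K] R →ₗ[K] K) : R ⊗[K] R →ₗ[K] H :=
  conv P.comul₂ (Algebra.linearMap K H ∘ₗ P.inv₂ v) (P.yd₂.Psi v)

/-- `m^v = v * m * v⁻¹`. -/
def mulTwist (v : R ⊗[K] R →ₗ[K] K) : R ⊗[K] R →ₗ[K] R :=
  convRight P.comul₂ (convLeft P.comul₂ v P.mul) (P.inv₂ v)

/-- `R ⊗ m^v : R ⊗ R ⊗ R → R ⊗ R`. -/
def idMul (v : R ⊗[K] R →ₗ[K] K) : (R ⊗[K] R) ⊗[K] R →ₗ[K] R ⊗[K] R :=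
  (P.mulTwist v).lTensor R ∘ₗ (TensorProduct.assoc K R R R).toLinearMap

/-- `m^v ⊗ R : R ⊗ R ⊗ R → R ⊗ R`. -/
def mulId (v : R ⊗[K] R →ₗ[K] K) : (R ⊗[K] R) ⊗[K] R →ₗ[K] R ⊗[K] R :=
  (P.mulTwist v).rTensor R

/-- `α₊(v) = v(R ⊗ m^v) * (ε ⊗ v)`. -/
def alphaPos (v : R ⊗[K] R →ₗ[K] K) : (R ⊗[K] R) ⊗[K] R →ₗ[K] K :=
  conv P.comul₃ (v ∘ₗ P.idMul v)
    (tensorForm Coalgebra.counit v ∘ₗ (TensorProduct.assoc K R R R).toLinearMap)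

/-- `α₋(v⁻¹) = (v⁻¹ ⊗ ε) * v⁻¹(m^v ⊗ R)`, as a function of `v`. -/
def alphaNeg (v : R ⊗[K] R →ₗ[K] K) : (R ⊗[K] R) ⊗[K] R →ₗ[K] K :=
  conv P.comul₃ (tensorForm (P.inv₂ v) Coalgebra.counit) (P.inv₂ v ∘ₗ P.mulId v)

/-- `α(v) = α₊(v) * α₋(v⁻¹)`. -/
def alpha (v : R ⊗[K] R →ₗ[K] K) : (R ⊗[K] R) ⊗[K] R →ₗ[K] K :=
  conv P.comul₃ (P.alphaPos v) (P.alphaNeg v)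

/-- The conditions defining `V`: `v ∈ 𝒢`, `m^v` is colinear, `m^v` is associative up to conjugation
by `α(v)`, `Ψ(α(v)) = u_H α(v)`, and `v` is unital. -/
structure InV (lam : H →ₗ[K] K) (v : R ⊗[K] R →ₗ[K] K) : Prop where
  mem : v ∈ P.setG lam
  colinear : P.yd₂.IsColinear P.yd (P.mulTwist v)
  assoc : convRight P.comul₃ (P.mulTwist v ∘ₗ P.idMul v) (P.alpha v) =
    convLeft P.comul₃ (P.alpha v) (P.mulTwist v ∘ₗ P.mulId v)
  alpha_colinear : P.yd₃.Psi (P.alpha v) = Algebra.linearMap K H ∘ₗ P.alpha v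
  map_one_right : ∀ r, v (r ⊗ₜ P.one) = Coalgebra.counit (R := K) r
  map_one_left : ∀ r, v (P.one ⊗ₜ r) = Coalgebra.counit (R := K) r

/-- The set `V`. -/
def setV (lam : H →ₗ[K] K) : Set (R ⊗[K] R →ₗ[K] K) := {v | P.InV lam v}

end PreBialgebra

end PreBialgebra

end YD

end

open scoped TensorProduct

noncomputable section

/-! Write w = v⁻¹ and ξ = w * Ψ(v). After slicing with linear forms, every condition becomes an
identity in a convolution monoid of maps from R ⊗ R or R ⊗ R ⊗ R to H or K. There Ψ is
multiplicative (`Psi_conv`), because the comultiplication is colinear.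

Slicing the Sweedler condition (b) with λ and using h₍₁₎λ(h₍₂₎) = λ(h)1 gives ξ * Ψ(λξ) = u_H λξ.
Hence an element ξ of 𝒮 is forced to be v⁻¹ * Ψ(v) with v = (λξ)⁻¹ (`eq_conv_Psi_of_mem_setS`), and
ad-invariance of λ makes v linear. Conversely w * Ψ(v) lies in 𝒮 for every v in 𝒢
(`mem_setS_of_mem_setG`), and λ of it is w. So F and G are mutually inverse between 𝒮 and 𝒢, and
only the image of Ξ has to be identified (`isCocycle_iff_inV`).

Put μ = m^v. Condition (c), sliced by f, says that Ψ(f)m * ξ = ξ * Ψ(fm). Moving the v's to one side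
turns this into Ψ(f)μ = Ψ(fμ), the colinearity of μ (`braided_iff_isColinear`). Once μ is linear and
colinear, both R ⊗ μ and μ ⊗ R are coalgebra maps, so composing with them preserves convolution
products and inverses. Let a = v(R ⊗ μ) * (ε ⊗ v) and b = (w ⊗ ε) * w(μ ⊗ R), so that α(v) = a * b.
For a linear form f on R, the two sides of (d) become a⁻¹ * fμ(R ⊗ μ) * a and b * fμ(μ ⊗ R) * b⁻¹;
the two sides of (e) become a⁻¹ * Ψ(a) and b * Ψ(b)⁻¹. Cancelling yields the twisted associativity
and Ψ(α) = u_H α (`assoc_iff`, `cocycle_iff`). Unitality passes between v, w and ξ directly.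

Invertibility comes from connectedness. A connected coalgebra is conilpotent
(`exists_mem_conilFiltration`), by way of finite-dimensional subcoalgebras and their Artinian dual
algebras. A form on R ⊗ R vanishing at 1 ⊗ 1 is then locally nilpotent for convolution
(`eventually_convPow`), and the geometric series inverts v. -/

namespace YD

/-! ### Sweedler sums over a chosen expression of a tensor -/

section SweedlerSum

variable {K A B C D M N : Type*} [Field K]
  [AddCommMonoid A] [Module K A] [AddCommMonoid B] [Module K B]
  [AddCommMonoid C] [Module K C] [AddCommMonoid D] [Module K D]
  [AddCommMonoid M] [AddCommMonoid N]

/-- The Sweedler sum `∑ f aᵢ bᵢ` for a chosen expression `t = ∑ aᵢ ⊗ bᵢ`. -/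
def sw (t : A ⊗[K] B) (f : A → B → M) : M :=
  ∑ p ∈ (TensorProduct.exists_finset t).choose, f p.1 p.2

theorem sw_map {F : Type*} [FunLike F M N] [AddMonoidHomClass F M N] (L : F) (t : A ⊗[K] B)
    (f : A → B → M) : L (sw t f) = sw t (fun a b => L (f a b)) := map_sum L _ _

theorem sw_congr {t : A ⊗[K] B} {f g : A → B → M} (h : ∀ a b, f a b = g a b) :
    sw t f = sw t g := by rw [funext₂ h]

theorem sw_comm (t : A ⊗[K] B) (t' : C ⊗[K] D) (f : A → B → C → D → M) :
    sw t (fun a b => sw t' (fun c d => f a b c d)) =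
      sw t' (fun c d => sw t (fun a b => f a b c d)) := Finset.sum_comm

end SweedlerSum

/-! ### Linearity of Sweedler sums and independence of the chosen expression -/

section Sweedler

variable {K A B C D M N : Type*} [Field K]
  [AddCommMonoid A] [Module K A] [AddCommMonoid B] [Module K B]
  [AddCommMonoid C] [Module K C] [AddCommMonoid D] [Module K D]
  [AddCommMonoid M] [Module K M] [AddCommMonoid N] [Module K N]

attribute [fun_prop] IsLinearMap

@[fun_prop]
theorem isLinearMap_id : IsLinearMap K (fun x : M => x) := ⟨fun _ _ => rfl, fun _ _ => rfl⟩

@[fun_prop]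
theorem isLinearMap_comp {f : N → M} {g : A → N} (hf : IsLinearMap K f) (hg : IsLinearMap K g) :
    IsLinearMap K (fun x => f (g x)) :=
  ⟨fun x y => by simp only [hg.map_add, hf.map_add], fun c x => by
    simp only [hg.map_smul, hf.map_smul]⟩

@[fun_prop]
theorem isLinearMap_coe (F : M →ₗ[K] N) : IsLinearMap K (fun x => F x) := F.isLinear

@[fun_prop]
theorem isLinearMap_equiv (F : M ≃ₗ[K] N) : IsLinearMap K (fun x => F x) := F.toLinearMap.isLinear

@[fun_prop]
theorem isLinearMap_add {f g : M → N} (hf : IsLinearMap K f) (hg : IsLinearMap K g) :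
    IsLinearMap K (fun x => f x + g x) :=
  ⟨fun x y => by simp only [hf.map_add, hg.map_add]; abel, fun c x => by
    simp only [hf.map_smul, hg.map_smul, smul_add]⟩

@[fun_prop]
theorem isLinearMap_tmul_left {f : M → A} (hf : IsLinearMap K f) (b : B) :
    IsLinearMap K (fun x => f x ⊗ₜ[K] b) :=
  isLinearMap_comp (f := fun a => a ⊗ₜ[K] b) ((TensorProduct.mk K A B).flip b).isLinear hf

@[fun_prop]
theorem isLinearMap_tmul_right {f : M → B} (hf : IsLinearMap K f) (a : A) :
    IsLinearMap K (fun x => a ⊗ₜ[K] f x) :=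
  isLinearMap_comp (TensorProduct.mk K A B a).isLinear hf

@[fun_prop]
theorem isLinearMap_smul_left {f : M → K} (hf : IsLinearMap K f) (b : B) :
    IsLinearMap K (fun x => f x • b) :=
  isLinearMap_comp (LinearMap.toSpanSingleton K B b).isLinear hf

@[fun_prop]
theorem isLinearMap_smul_right {f : M → B} (hf : IsLinearMap K f) (a : K) :
    IsLinearMap K (fun x => a • f x) :=
  isLinearMap_comp (LinearMap.lsmul K B a).isLinear hf

@[fun_prop]
theorem isLinearMap_mul_left {H : Type*} [Ring H] [Algebra K H] {f : M → H}
    (hf : IsLinearMap K f) (b : H) : IsLinearMap K (fun x => f x * b) :=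
  isLinearMap_comp ((LinearMap.mul K H).flip b).isLinear hf

@[fun_prop]
theorem isLinearMap_mul_right {H : Type*} [Ring H] [Algebra K H] {f : M → H}
    (hf : IsLinearMap K f) (b : H) : IsLinearMap K (fun x => b * f x) :=
  isLinearMap_comp (LinearMap.mul K H b).isLinear hf

theorem sw_tmul_self (t : A ⊗[K] B) : sw t (fun a b => a ⊗ₜ[K] b) = t :=
  (TensorProduct.exists_finset t).choose_spec.symm

theorem sw_lin (L : A ⊗[K] B →ₗ[K] M) (t : A ⊗[K] B) : sw t (fun a b => L (a ⊗ₜ b)) = L t := by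
  rw [← sw_map, sw_tmul_self]

theorem lin_eq_sw {L : A ⊗[K] B → M} (hL : IsLinearMap K L) (t : A ⊗[K] B) :
    L t = sw t (fun a b => L (a ⊗ₜ b)) := (sw_lin hL.mk' t).symm

theorem exists_lin (f : A → B → M) (h₁ : ∀ b, IsLinearMap K fun a => f a b)
    (h₂ : ∀ a, IsLinearMap K fun b => f a b) :
    ∃ L : A ⊗[K] B →ₗ[K] M, ∀ a b, L (a ⊗ₜ b) = f a b :=
  ⟨TensorProduct.lift (LinearMap.mk₂ K f (fun a a' b => (h₁ b).map_add a a')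
    (fun c a b => (h₁ b).map_smul c a) (fun a => (h₂ a).map_add) fun c a => (h₂ a).map_smul c),
    fun _ _ => rfl⟩

@[fun_prop]
theorem isLinearMap_sw_fun {f : N → A → B → M} (t : A ⊗[K] B)
    (h : ∀ a b, IsLinearMap K fun x => f x a b) : IsLinearMap K fun x => sw t (fun a b => f x a b) :=
  ⟨fun x y => by simp only [sw, (h _ _).map_add, Finset.sum_add_distrib],
    fun c x => by simp only [sw, (h _ _).map_smul, Finset.smul_sum]⟩

@[fun_prop]
theorem isLinearMap_sw {f : A → B → M} {t : N → A ⊗[K] B} (ht : IsLinearMap K t)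
    (h₁ : ∀ b, IsLinearMap K fun a => f a b)
    (h₂ : ∀ a, IsLinearMap K fun b => f a b) : IsLinearMap K fun x => sw (t x) f := by
  obtain ⟨L, hL⟩ := exists_lin f h₁ h₂
  obtain rfl : f = fun a b => L (a ⊗ₜ b) := by simp only [hL]
  simp only [sw_lin]
  fun_prop

/-- Bilinearity is what makes the expression chosen in `sw` irrelevant. Congruence and interchange
of Sweedler sums hold for arbitrary `f`; only here and in `sw_sw` must `f` factor through the tensor
product, a side condition that `fun_prop` discharges. -/
theorem sw_tmul (a : A) (b : B) (f : A → B → M) (h₁ : ∀ b, IsLinearMap K fun a => f a b)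
    (h₂ : ∀ a, IsLinearMap K fun b => f a b) : sw (a ⊗ₜ[K] b) f = f a b := by
  obtain ⟨L, hL⟩ := exists_lin f h₁ h₂
  obtain rfl : f = fun a b => L (a ⊗ₜ b) := by simp only [hL]
  rw [sw_lin]

theorem sw_sw (t : A ⊗[K] B) (g : A → B → C ⊗[K] D) (f : C → D → M)
    (h₁ : ∀ b, IsLinearMap K fun a => f a b) (h₂ : ∀ a, IsLinearMap K fun b => f a b) :
    sw (sw t g) f = sw t (fun a b => sw (g a b) f) := by
  obtain ⟨L, hL⟩ := exists_lin f h₁ h₂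
  obtain rfl : f = fun a b => L (a ⊗ₜ b) := by simp only [hL]
  simp only [sw_lin, sw_map]

theorem sw_smul (t : A ⊗[K] B) (f : A → B → K) (x : M) :
    sw t f • x = sw t (fun a b => f a b • x) := Finset.sum_smul

theorem smul_sw (t : A ⊗[K] B) (f : A → B → M) (c : K) :
    c • sw t f = sw t (fun a b => c • f a b) := Finset.smul_sum

theorem mul_sw {H : Type*} [Ring H] (t : A ⊗[K] B) (f : A → B → H) (c : H) :
    c * sw t f = sw t (fun a b => c * f a b) := Finset.mul_sum ..

theorem sw_mul {H : Type*} [Ring H] (t : A ⊗[K] B) (f : A → B → H) (c : H) :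
    sw t f * c = sw t (fun a b => f a b * c) := Finset.sum_mul ..

theorem sw_tmul_right (t : A ⊗[K] B) (f : A → B → M) (x : N) :
    sw t f ⊗ₜ[K] x = sw t (fun a b => f a b ⊗ₜ[K] x) := TensorProduct.sum_tmul ..

theorem tmul_sw (t : A ⊗[K] B) (f : A → B → M) (x : N) :
    x ⊗ₜ[K] sw t f = sw t (fun a b => x ⊗ₜ[K] f a b) := TensorProduct.tmul_sum ..

theorem sw_apply (t : A ⊗[K] B) (f : A → B → M →ₗ[K] N) (x : M) :
    sw t f x = sw t (fun a b => f a b x) := LinearMap.sum_apply ..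

theorem lin_ext {f g : A ⊗[K] B → M} (hf : IsLinearMap K f) (hg : IsLinearMap K g)
    (h : ∀ a b, f (a ⊗ₜ b) = g (a ⊗ₜ b)) : ∀ t, f t = g t := by
  have : hf.mk' = hg.mk' := TensorProduct.ext' h
  exact fun t => LinearMap.congr_fun this t

end Sweedler

/-! ### Coalgebras of Yetter-Drinfeld modules and their tensor products -/

section YDCoalgebra

variable {K H V W M N : Type*} [Field K] [Ring H] [HopfAlgebra K H]
  [AddCommGroup V] [Module K V] [AddCommGroup W] [Module K W]
  [AddCommMonoid M] [Module K M] [AddCommMonoid N] [Module K N]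

local notation "δ" => Coalgebra.comul (R := K) (A := H)

local notation "η" => Coalgebra.counit (R := K) (A := H)

@[fun_prop]
theorem isLinearMap_act_left (X : YDStr K H V) {f : M → H} (hf : IsLinearMap K f) (v : V) :
    IsLinearMap K (fun x => X.act (f x) v) :=
  isLinearMap_comp (f := fun h => X.act h v) (X.act.toLinearMap.flip v).isLinear hf

@[fun_prop]
theorem isLinearMap_act_right (X : YDStr K H V) {f : M → V} (hf : IsLinearMap K f) (h : H) :
    IsLinearMap K (fun x => X.act h (f x)) :=
  isLinearMap_comp (X.act h).isLinear hf

/-- A coalgebra `(V, Δ, ε)` in the category of Yetter-Drinfeld modules, in Sweedler notation. -/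
structure IsYDCoalgebra (X : YDStr K H V) (Δ : V →ₗ[K] V ⊗[K] V) (ε : V →ₗ[K] K) : Prop where
  coact_comul' : ∀ v, sw (X.coact v) (fun h w => sw (δ h) fun h₁ h₂ => h₁ ⊗ₜ[K] (h₂ ⊗ₜ[K] w)) =
    sw (X.coact v) (fun h w => sw (X.coact w) fun g w' => h ⊗ₜ[K] (g ⊗ₜ[K] w'))
  coact_counit : ∀ v, sw (X.coact v) (fun h w => η h • w) = v
  -- The Yetter-Drinfeld compatibility in its antipode-free form, so that closure under tensor
  -- products needs only coassociativity of H.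
  coact_act' : ∀ h v,
    sw (δ h) (fun h₁ h₂ => sw (X.coact (X.act h₁ v)) fun g w => (g * h₂) ⊗ₜ[K] w) =
      sw (δ h) (fun h₁ h₂ => sw (X.coact v) fun g w => (h₁ * g) ⊗ₜ[K] X.act h₂ w)
  coassoc' : ∀ v, sw (Δ v) (fun a b => sw (Δ a) fun a₁ a₂ => a₁ ⊗ₜ[K] (a₂ ⊗ₜ[K] b)) =
    sw (Δ v) (fun a b => sw (Δ b) fun b₁ b₂ => a ⊗ₜ[K] (b₁ ⊗ₜ[K] b₂))
  counit_left : ∀ v, sw (Δ v) (fun a b => ε a • b) = v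
  counit_right : ∀ v, sw (Δ v) (fun a b => ε b • a) = v
  comul_act : ∀ h v, Δ (X.act h v) =
    sw (δ h) fun h₁ h₂ => sw (Δ v) fun a b => X.act h₁ a ⊗ₜ[K] X.act h₂ b
  comul_coact' : ∀ v, sw (X.coact v) (fun h w => sw (Δ w) fun a b => h ⊗ₜ[K] (a ⊗ₜ[K] b)) =
    sw (Δ v) fun a b => sw (X.coact a) fun h a₀ => sw (X.coact b) fun g b₀ =>
      (h * g) ⊗ₜ[K] (a₀ ⊗ₜ[K] b₀)
  counit_act : ∀ h v, ε (X.act h v) = η h * ε v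
  counit_coact : ∀ v, sw (X.coact v) (fun h w => ε w • h) = ε v • (1 : H)

theorem exists_lin₃ {A B C : Type*} [AddCommMonoid A] [Module K A] [AddCommMonoid B] [Module K B]
    [AddCommMonoid C] [Module K C] (f : A → B → C → M) (h₁ : ∀ b c, IsLinearMap K fun a => f a b c)
    (h₂ : ∀ a c, IsLinearMap K fun b => f a b c) (h₃ : ∀ a b, IsLinearMap K fun c => f a b c) :
    ∃ L : A ⊗[K] (B ⊗[K] C) →ₗ[K] M, ∀ a b c, L (a ⊗ₜ (b ⊗ₜ c)) = f a b c := by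
  choose L₁ hL₁ using fun a => exists_lin (f a) (h₂ a) (h₃ a)
  have h : ∀ t, IsLinearMap K fun a => L₁ a t := by
    refine fun t => ⟨fun a a' => ?_, fun k a => ?_⟩ <;> revert t <;>
    refine lin_ext ?_ ?_ (fun b c => ?_) <;>
    first | fun_prop | simp only [hL₁, (h₁ b c).map_add, (h₁ b c).map_smul]
  obtain ⟨L, hL⟩ := exists_lin (fun a t => L₁ a t) h (by fun_prop)
  exact ⟨L, fun a b c => by rw [hL, hL₁]⟩

namespace IsYDCoalgebra

variable {X : YDStr K H V} {Δ : V →ₗ[K] V ⊗[K] V} {ε : V →ₗ[K] K} (hX : IsYDCoalgebra X Δ ε)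

include hX

theorem coact_comul (φ : H → H → V → M) (h₁ : ∀ b c, IsLinearMap K fun a => φ a b c)
    (h₂ : ∀ a c, IsLinearMap K fun b => φ a b c) (h₃ : ∀ a b, IsLinearMap K fun c => φ a b c)
    (v : V) : sw (X.coact v) (fun h w => sw (δ h) fun h₁ h₂ => φ h₁ h₂ w) =
    sw (X.coact v) (fun h w => sw (X.coact w) fun g w' => φ h g w') := by
  obtain ⟨L, hL⟩ := exists_lin₃ φ h₁ h₂ h₃
  simpa only [sw_map, hL] using congrArg L (hX.coact_comul' v)

theorem coact_act (φ : H → V → M) (h₁ : ∀ b, IsLinearMap K fun a => φ a b)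
    (h₂ : ∀ a, IsLinearMap K fun b => φ a b) (h : H) (v : V) :
    sw (δ h) (fun h₁ h₂ => sw (X.coact (X.act h₁ v)) fun g w => φ (g * h₂) w) =
      sw (δ h) (fun h₁ h₂ => sw (X.coact v) fun g w => φ (h₁ * g) (X.act h₂ w)) := by
  obtain ⟨L, hL⟩ := exists_lin φ h₁ h₂
  simpa only [sw_map, hL] using congrArg L (hX.coact_act' h v)

theorem coassoc (φ : V → V → V → M) (h₁ : ∀ b c, IsLinearMap K fun a => φ a b c)
    (h₂ : ∀ a c, IsLinearMap K fun b => φ a b c) (h₃ : ∀ a b, IsLinearMap K fun c => φ a b c)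
    (v : V) : sw (Δ v) (fun a b => sw (Δ a) fun a₁ a₂ => φ a₁ a₂ b) =
    sw (Δ v) (fun a b => sw (Δ b) fun b₁ b₂ => φ a b₁ b₂) := by
  obtain ⟨L, hL⟩ := exists_lin₃ φ h₁ h₂ h₃
  simpa only [sw_map, hL] using congrArg L (hX.coassoc' v)

theorem comul_coact (φ : H → V → V → M) (h₁ : ∀ b c, IsLinearMap K fun a => φ a b c)
    (h₂ : ∀ a c, IsLinearMap K fun b => φ a b c) (h₃ : ∀ a b, IsLinearMap K fun c => φ a b c)
    (v : V) : sw (X.coact v) (fun h w => sw (Δ w) fun a b => φ h a b) =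
    sw (Δ v) fun a b => sw (X.coact a) fun h a₀ => sw (X.coact b) fun g b₀ => φ (h * g) a₀ b₀ := by
  obtain ⟨L, hL⟩ := exists_lin₃ φ h₁ h₂ h₃
  simpa only [sw_map, hL] using congrArg L (hX.comul_coact' v)

theorem coact_counit_smul (f : V → M) (hf : IsLinearMap K f) (v : V) :
    sw (X.coact v) (fun h w => η h • f w) = f v := by
  simpa only [sw_map, IsLinearMap.mk'_apply, map_smul] using congrArg hf.mk' (hX.coact_counit v)

theorem counit_left_smul (f : V → M) (hf : IsLinearMap K f) (v : V) :
    sw (Δ v) (fun a b => ε a • f b) = f v := by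
  simpa only [sw_map, IsLinearMap.mk'_apply, map_smul] using congrArg hf.mk' (hX.counit_left v)

theorem counit_right_smul (f : V → M) (hf : IsLinearMap K f) (v : V) :
    sw (Δ v) (fun a b => ε b • f a) = f v := by
  simpa only [sw_map, IsLinearMap.mk'_apply, map_smul] using congrArg hf.mk' (hX.counit_right v)

theorem counit_coact_smul (f : H → M) (hf : IsLinearMap K f) (v : V) :
    sw (X.coact v) (fun h w => ε w • f h) = ε v • f 1 := by
  simpa only [sw_map, IsLinearMap.mk'_apply, map_smul] using congrArg hf.mk' (hX.counit_coact v)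

end IsYDCoalgebra

theorem hopf_counit_left_smul (f : H → M) (hf : IsLinearMap K f) (h : H) :
    sw (δ h) (fun a b => η a • f b) = f h := by
  have e := congrArg (fun t => IsLinearMap.mk' (R := K) f hf (TensorProduct.lid K H t))
    (Coalgebra.rTensor_counit_comul (R := K) h)
  rw [← sw_tmul_self (δ h)] at e
  simpa [sw_map] using e

theorem hopf_counit_right_smul (f : H → M) (hf : IsLinearMap K f) (h : H) :
    sw (δ h) (fun a b => η b • f a) = f h := by
  have e := congrArg (fun t => IsLinearMap.mk' (R := K) f hf (TensorProduct.rid K H t))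
    (Coalgebra.lTensor_counit_comul (R := K) h)
  rw [← sw_tmul_self (δ h)] at e
  simpa [sw_map] using e

theorem hopf_coassoc (φ : H → H → H → M) (h₁ : ∀ b c, IsLinearMap K fun a => φ a b c)
    (h₂ : ∀ a c, IsLinearMap K fun b => φ a b c) (h₃ : ∀ a b, IsLinearMap K fun c => φ a b c)
    (v : H) : sw (δ v) (fun a b => sw (δ a) fun a₁ a₂ => φ a₁ a₂ b) =
    sw (δ v) (fun a b => sw (δ b) fun b₁ b₂ => φ a b₁ b₂) := by
  obtain ⟨L, hL⟩ := exists_lin₃ φ h₁ h₂ h₃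
  have h := congrArg L (Coalgebra.coassoc_apply (R := K) v)
  rw [← sw_tmul_self (δ v)] at h
  simp only [sw_map, LinearMap.rTensor_tmul, LinearMap.lTensor_tmul] at h
  have e₁ : ∀ a b, L (TensorProduct.assoc K H H H (δ a ⊗ₜ[K] b)) =
      sw (δ a) fun a₁ a₂ => φ a₁ a₂ b := fun a b => by
    rw [lin_eq_sw (L := fun t => L (TensorProduct.assoc K H H H (t ⊗ₜ[K] b))) (by fun_prop)]
    simp only [TensorProduct.assoc_tmul, hL]
  have e₂ : ∀ a b, L (a ⊗ₜ[K] δ b) = sw (δ b) fun b₁ b₂ => φ a b₁ b₂ := fun a b => by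
    rw [lin_eq_sw (L := fun t => L (a ⊗ₜ[K] t)) (by fun_prop)]
    simp only [hL]
  simpa only [e₁, e₂] using h

/-- Regroups the fourfold coproduct so that legs two and three form one coproduct. This is the shape
in which the Yetter-Drinfeld compatibility can act on the middle of a tensor product. -/
theorem hopf_coassoc₄ (φ : H → H → H → H → M) (h₁ : ∀ b c d, IsLinearMap K fun a => φ a b c d)
    (h₂ : ∀ a c d, IsLinearMap K fun b => φ a b c d)
    (h₃ : ∀ a b d, IsLinearMap K fun c => φ a b c d)
    (h₄ : ∀ a b c, IsLinearMap K fun d => φ a b c d) (h : H) :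
    sw (δ h) (fun a b => sw (δ a) fun a₁ a₂ => sw (δ b) fun b₁ b₂ => φ a₁ a₂ b₁ b₂) =
      sw (δ h) fun a b => sw (δ b) fun c d => sw (δ c) fun x y => φ a x y d := by
  rw [hopf_coassoc _ (by fun_prop) (by fun_prop) (by fun_prop)]
  refine sw_congr fun a b => ?_
  rw [hopf_coassoc _ (by fun_prop) (by fun_prop) (by fun_prop)]

theorem comul_mul' (a b : H) : δ (a * b) = sw (δ a) fun a₁ a₂ => sw (δ b) fun b₁ b₂ =>
    (a₁ * b₁) ⊗ₜ[K] (a₂ * b₂) := by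
  rw [Bialgebra.comul_mul]
  conv_lhs => rw [← sw_tmul_self (δ a), ← sw_tmul_self (δ b)]
  simp only [sw_mul, mul_sw, Algebra.TensorProduct.tmul_mul_tmul]
  exact sw_comm ..

theorem tensorForm_tmul (f : V →ₗ[K] K) (g : W →ₗ[K] K) (v : V) (w : W) :
    tensorForm f g (v ⊗ₜ w) = f v * g w := rfl

variable (X : YDStr K H V) (Y : YDStr K H W)

theorem tensor_act (h : H) (v : V) (w : W) : (X.tensor Y).act h (v ⊗ₜ w) =
    sw (δ h) fun h₁ h₂ => X.act h₁ v ⊗ₜ[K] Y.act h₂ w := by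
  change Module.endTensorEndAlgHom (Algebra.TensorProduct.map X.act Y.act (δ h)) (v ⊗ₜ w) = _
  rw [lin_eq_sw (L := fun t => Module.endTensorEndAlgHom (R := K) (S := K) (A := K)
    (Algebra.TensorProduct.map X.act Y.act t) (v ⊗ₜ[K] w))]
  · rfl
  · exact ⟨fun _ _ => by simp, fun _ _ => by simp⟩

theorem tensor_coact (v : V) (w : W) : (X.tensor Y).coact (v ⊗ₜ w) =
    sw (X.coact v) fun h v₀ => sw (Y.coact w) fun g w₀ => (h * g) ⊗ₜ[K] (v₀ ⊗ₜ[K] w₀) := by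
  change (LinearMap.mul' K H).rTensor (V ⊗[K] W)
    (TensorProduct.tensorTensorTensorComm K H V H W (X.coact v ⊗ₜ[K] Y.coact w)) = _
  conv_lhs => rw [← sw_tmul_self (X.coact v), ← sw_tmul_self (Y.coact w)]
  simp only [sw_tmul_right, tmul_sw, sw_map, TensorProduct.tensorTensorTensorComm_tmul,
    LinearMap.rTensor_tmul, LinearMap.mul'_apply]
  exact sw_comm ..

theorem braid_tmul (v : V) (w : W) : braid X.coact Y.actMap (v ⊗ₜ w) =
    sw (X.coact v) fun h v₀ => Y.act h w ⊗ₜ[K] v₀ := by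
  change Y.actMap.rTensor V (TensorProduct.rightComm K H V W (X.coact v ⊗ₜ[K] w)) = _
  conv_lhs => rw [← sw_tmul_self (X.coact v)]
  simp only [sw_tmul_right, sw_map, TensorProduct.rightComm_tmul, LinearMap.rTensor_tmul]
  rfl

theorem tensorComul_tmul (Δ : V →ₗ[K] V ⊗[K] V) (Δ' : W →ₗ[K] W ⊗[K] W) (v : V) (w : W) :
    X.tensorComul Y Δ Δ' (v ⊗ₜ w) = sw (Δ v) fun v₁ v₂ => sw (X.coact v₂) fun h v₀ =>
      sw (Δ' w) fun w₁ w₂ => (v₁ ⊗ₜ[K] Y.act h w₁) ⊗ₜ[K] (v₀ ⊗ₜ[K] w₂) := by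
  rw [YDStr.tensorComul]
  simp only [LinearMap.comp_apply, TensorProduct.map_tmul]
  conv_lhs => rw [← sw_tmul_self (Δ v), ← sw_tmul_self (Δ' w)]
  simp only [sw_tmul_right, tmul_sw, sw_map, LinearEquiv.coe_coe, TensorProduct.assoc_tmul,
    LinearMap.lTensor_tmul, LinearMap.comp_apply, TensorProduct.assoc_symm_tmul,
    LinearMap.rTensor_tmul, braid_tmul]
  simp only [sw_comm (Δ' w)]

section Tensor

variable {X Y} {Δ : V →ₗ[K] V ⊗[K] V} {ε : V →ₗ[K] K} {Δ' : W →ₗ[K] W ⊗[K] W} {ε' : W →ₗ[K] K}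
  (hX : IsYDCoalgebra X Δ ε) (hY : IsYDCoalgebra Y Δ' ε')

include hX hY

theorem tensor_coact_comul (t : V ⊗[K] W) :
    sw ((X.tensor Y).coact t) (fun h w => sw (δ h) fun h₁ h₂ => h₁ ⊗ₜ[K] (h₂ ⊗ₜ[K] w)) =
    sw ((X.tensor Y).coact t) (fun h w => sw ((X.tensor Y).coact w) fun g w' =>
      h ⊗ₜ[K] (g ⊗ₜ[K] w')) := by
  revert t
  refine lin_ext (by fun_prop) (by fun_prop) fun v w => ?_
  simp (disch := fun_prop) only [tensor_coact, sw_sw, sw_tmul, comul_mul']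
  simp only [sw_comm (Y.coact w) (δ _)]
  simp (disch := fun_prop) only [hX.coact_comul, hY.coact_comul]
  simp only [sw_comm (X.coact _) (Y.coact w)]

/-- Every compatibility of the braiding with the structure maps enters: colinearity of Δ and
linearity of Δ' carry the braiding past the comultiplications. The elements of H that result agree
by coassociativity of the coaction and multiplicativity of the action. -/
theorem tensor_coassoc (t : V ⊗[K] W) : sw (X.tensorComul Y Δ Δ' t) (fun a b =>
    sw (X.tensorComul Y Δ Δ' a) fun a₁ a₂ => a₁ ⊗ₜ[K] (a₂ ⊗ₜ[K] b)) =
    sw (X.tensorComul Y Δ Δ' t) (fun a b => sw (X.tensorComul Y Δ Δ' b) fun b₁ b₂ =>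
      a ⊗ₜ[K] (b₁ ⊗ₜ[K] b₂)) := by
  revert t
  refine lin_ext (by fun_prop) (by fun_prop) fun v w => ?_
  simp (disch := fun_prop) only [tensorComul_tmul, sw_sw, sw_tmul]
  simp (disch := fun_prop) only [sw_comm (Δ' w) (Δ _), sw_comm (X.coact _) (Δ _), hX.coassoc,
    hY.comul_act, sw_sw, sw_tmul, hX.comul_coact]
  simp only [sw_comm (X.coact _) (Δ' w), sw_comm (Δ _) (Δ' w)]
  simp (disch := fun_prop) only [sw_comm (X.coact _) (Δ' _), sw_comm (Δ _) (Δ' _), sw_comm (δ _) (Δ' _), hY.coassoc]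
  simp (disch := fun_prop) only [← hX.coact_comul]
  simp only [map_mul, Module.End.mul_apply]
  refine sw_congr fun _ _ => sw_congr fun _ _ => sw_congr fun _ _ => sw_congr fun _ _ => ?_
  exact sw_comm ..

theorem tensor_comul_act (h : H) (t : V ⊗[K] W) :
    X.tensorComul Y Δ Δ' ((X.tensor Y).act h t) = sw (δ h) fun h₁ h₂ =>
      sw (X.tensorComul Y Δ Δ' t) fun a b => (X.tensor Y).act h₁ a ⊗ₜ[K] (X.tensor Y).act h₂ b := by
  revert t
  refine lin_ext (by fun_prop) (by fun_prop) fun v w => ?_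
  simp (disch := fun_prop) only [tensorComul_tmul, tensor_act, sw_sw, sw_tmul, sw_map, tmul_sw,
    sw_tmul_right]
  simp (disch := fun_prop) only [hX.comul_act, hY.comul_act, sw_sw, sw_tmul]
  simp only [sw_comm (X.coact _) (δ _), sw_comm (Δ v) (δ _), sw_comm (Δ' w) (δ _)]
  -- On both sides the two inner legs of h surround the braiding. Isolating them as one coproduct
  -- leaves exactly the Yetter-Drinfeld compatibility at `v₂`.
  rw [hopf_coassoc₄ _ (by fun_prop) (by fun_prop) (by fun_prop) (by fun_prop)]
  conv_rhs =>
    enter [2, h₁, h₂]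
    rw [sw_comm]
  rw [hopf_coassoc₄ _ (by fun_prop) (by fun_prop) (by fun_prop) (by fun_prop)]
  simp only [← Module.End.mul_apply, ← map_mul]
  simp only [sw_comm (X.coact _) (Δ' w), sw_comm (Δ v) (Δ' w), sw_comm (δ _) (Δ' w)]
  simp only [sw_comm (δ _) (Δ v)]
  refine sw_congr fun w₁ w₂ => sw_congr fun v₁ v₂ => sw_congr fun a _ => sw_congr fun c d => ?_
  exact hX.coact_act (fun g v₀ => (X.act a v₁ ⊗ₜ[K] Y.act g w₁) ⊗ₜ[K] (v₀ ⊗ₜ[K] Y.act d w₂))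
    (by fun_prop) (by fun_prop) c v₂

theorem tensor_comul_coact (t : V ⊗[K] W) : sw ((X.tensor Y).coact t) (fun h w =>
      sw (X.tensorComul Y Δ Δ' w) fun a b => h ⊗ₜ[K] (a ⊗ₜ[K] b)) =
    sw (X.tensorComul Y Δ Δ' t) fun a b => sw ((X.tensor Y).coact a) fun h a₀ =>
      sw ((X.tensor Y).coact b) fun g b₀ => (h * g) ⊗ₜ[K] (a₀ ⊗ₜ[K] b₀) := by
  revert t
  refine lin_ext (by fun_prop) (by fun_prop) fun v w => ?_
  simp (disch := fun_prop) only [tensorComul_tmul, tensor_coact, sw_sw, sw_tmul]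
  simp (disch := fun_prop) only [sw_comm (Y.coact w) (Δ _), hX.comul_coact,
    sw_comm (Y.coact w) (X.coact _)]
  simp (disch := fun_prop) only [sw_comm (X.coact _) (Δ' _), hY.comul_coact]
  have e : ∀ a b c d : H, a * b * (c * d) = a * (b * c) * d := fun a b c d => by
    simp only [mul_assoc]
  simp only [sw_comm (Y.coact _) (X.coact _), e]
  simp only [sw_comm (Δ v) (Δ' w)]
  refine sw_congr fun w₁ w₂ => sw_congr fun v₁ v₂ => ?_
  simp only [sw_comm (X.coact v₂) (X.coact v₁)]
  simp (disch := fun_prop) only [← hX.coact_comul]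
  refine sw_congr fun a b => sw_congr fun h v₀ => (hY.coact_act
    (fun g u => sw (Y.coact w₂) fun k w₀ => (a * g * k) ⊗ₜ[K] ((b ⊗ₜ[K] u) ⊗ₜ[K] (v₀ ⊗ₜ[K] w₀)))
    (by fun_prop) (by fun_prop) h w₁).symm

theorem tensor_coact_act (h : H) (t : V ⊗[K] W) :
    sw (δ h) (fun h₁ h₂ => sw ((X.tensor Y).coact ((X.tensor Y).act h₁ t)) fun g w =>
      (g * h₂) ⊗ₜ[K] w) =
    sw (δ h) (fun h₁ h₂ => sw ((X.tensor Y).coact t) fun g w =>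
      (h₁ * g) ⊗ₜ[K] (X.tensor Y).act h₂ w) := by
  revert t
  refine lin_ext (by fun_prop) (by fun_prop) fun v w => ?_
  simp (disch := fun_prop) only [tensor_coact, tensor_act, sw_sw, sw_tmul, sw_map, tmul_sw]
  calc
    _ = sw (δ h) fun a x => sw (δ x) fun b c => sw (Y.coact (Y.act b w)) fun k w₀ =>
        sw (X.coact (X.act a v)) fun g v₀ => (g * (k * c)) ⊗ₜ[K] (v₀ ⊗ₜ[K] w₀) := by
      simp (disch := fun_prop) only [hopf_coassoc, mul_assoc]
      exact sw_congr fun _ _ => sw_congr fun _ _ => sw_comm ..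
    _ = sw (δ h) fun a x => sw (δ x) fun b c => sw (Y.coact w) fun k w₀ =>
        sw (X.coact (X.act a v)) fun g v₀ => (g * (b * k)) ⊗ₜ[K] (v₀ ⊗ₜ[K] Y.act c w₀) :=
      sw_congr fun a x => hY.coact_act (fun y u => sw (X.coact (X.act a v)) fun g v₀ =>
        (g * y) ⊗ₜ[K] (v₀ ⊗ₜ[K] u)) (by fun_prop) (by fun_prop) x w
    _ = sw (δ h) fun x c => sw (Y.coact w) fun k w₀ => sw (δ x) fun a b =>
        sw (X.coact (X.act a v)) fun g v₀ => (g * b * k) ⊗ₜ[K] (v₀ ⊗ₜ[K] Y.act c w₀) := by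
      simp only [sw_comm (Y.coact w) (δ _)]
      simp (disch := fun_prop) only [hopf_coassoc, mul_assoc]
    _ = sw (δ h) fun x c => sw (Y.coact w) fun k w₀ => sw (δ x) fun a b =>
        sw (X.coact v) fun g v₀ => (a * g * k) ⊗ₜ[K] (X.act b v₀ ⊗ₜ[K] Y.act c w₀) :=
      sw_congr fun x c => sw_congr fun k w₀ => hX.coact_act (fun y u =>
        (y * k) ⊗ₜ[K] (u ⊗ₜ[K] Y.act c w₀)) (by fun_prop) (by fun_prop) x v
    _ = _ := by
      simp only [sw_comm (Y.coact w) (δ _), sw_comm (X.coact v) (δ _)]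
      simp (disch := fun_prop) only [hopf_coassoc, mul_assoc, sw_comm (X.coact v) (Y.coact w)]

theorem IsYDCoalgebra.tensor :
    IsYDCoalgebra (X.tensor Y) (X.tensorComul Y Δ Δ') (tensorForm ε ε') where
  coact_comul' := tensor_coact_comul hX hY
  coact_counit := by
    refine lin_ext (by fun_prop) (by fun_prop) fun v w => ?_
    simp (disch := fun_prop) only [tensor_coact, sw_sw, sw_tmul, Bialgebra.counit_mul, mul_smul,
      ← smul_sw, hX.coact_counit_smul, hY.coact_counit_smul]
  coact_act' := tensor_coact_act hX hY
  coassoc' := tensor_coassoc hX hY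
  counit_left := by
    refine lin_ext (by fun_prop) (by fun_prop) fun v w => ?_
    simp (disch := fun_prop) only [tensorComul_tmul, sw_sw, sw_tmul, tensorForm_tmul,
      hY.counit_act, mul_smul, ← smul_sw, hX.coact_counit_smul, hX.counit_left_smul,
      hY.counit_left_smul]
  counit_right := by
    refine lin_ext (by fun_prop) (by fun_prop) fun v w => ?_
    simp (disch := fun_prop) only [tensorComul_tmul, sw_sw, sw_tmul, tensorForm_tmul, mul_smul,
      ← smul_sw, hY.counit_right_smul, hX.counit_coact_smul, hX.counit_right_smul, map_one,
      Module.End.one_apply]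
  comul_act := tensor_comul_act hX hY
  comul_coact' := tensor_comul_coact hX hY
  counit_act h := by
    refine lin_ext (by fun_prop) (by fun_prop) fun v w => ?_
    simp (disch := fun_prop) only [tensor_act, sw_map, tensorForm_tmul, hX.counit_act,
      hY.counit_act]
    rw [← hopf_counit_left_smul (K := K) (fun x => η x * (ε v * ε' w)) (by fun_prop) h]
    exact sw_congr fun a b => by rw [smul_eq_mul]; ring
  counit_coact := by
    refine lin_ext (by fun_prop) (by fun_prop) fun v w => ?_
    simp (disch := fun_prop) only [tensor_coact, sw_sw, sw_tmul, tensorForm_tmul, mul_smul,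
      ← smul_sw, hY.counit_coact_smul, mul_one, hX.counit_coact_smul]

end Tensor

end YDCoalgebra

/-! ### Convolution monoids, multiplicativity of Ψ and convolution inverses -/

section Convolution

variable {K H V W A M N : Type*} [Field K] [Ring H] [HopfAlgebra K H]
  [AddCommGroup V] [Module K V] [AddCommGroup W] [Module K W] [Ring A] [Algebra K A]
  [AddCommGroup M] [Module K M] [AddCommGroup N] [Module K N]

theorem conv_apply (Δ : V →ₗ[K] V ⊗[K] V) (f g : V →ₗ[K] A) (z : V) :
    conv Δ f g z = sw (Δ z) fun a b => f a * g b :=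
  lin_eq_sw (L := fun t => LinearMap.mul' K A (TensorProduct.map f g t)) (by fun_prop) (Δ z)

theorem convLeft_apply (Δ : V →ₗ[K] V ⊗[K] V) (v : V →ₗ[K] K) (f : V →ₗ[K] M) (z : V) :
    convLeft Δ v f z = sw (Δ z) fun a b => v a • f b :=
  lin_eq_sw (L := fun t => TensorProduct.lid K M (TensorProduct.map v f t)) (by fun_prop) (Δ z)

theorem convRight_apply (Δ : V →ₗ[K] V ⊗[K] V) (f : V →ₗ[K] M) (v : V →ₗ[K] K) (z : V) :
    convRight Δ f v z = sw (Δ z) fun a b => v b • f a :=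
  lin_eq_sw (L := fun t => TensorProduct.rid K M (TensorProduct.map f v t)) (by fun_prop) (Δ z)

theorem map_comul_apply (Δ : V →ₗ[K] V ⊗[K] V) (f : V →ₗ[K] M) (g : V →ₗ[K] N) (z : V) :
    TensorProduct.map f g (Δ z) = sw (Δ z) fun a b => f a ⊗ₜ[K] g b :=
  lin_eq_sw (L := fun t => TensorProduct.map f g t) (by fun_prop) (Δ z)

theorem Psi_apply (X : YDStr K H V) (v : V →ₗ[K] K) (z : V) :
    X.Psi v z = sw (X.coact z) fun h z₀ => v z₀ • h :=
  lin_eq_sw (L := fun t => TensorProduct.rid K H (v.lTensor H t)) (by fun_prop) (X.coact z)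

variable {X : YDStr K H V} {Δ : V →ₗ[K] V ⊗[K] V} {ε : V →ₗ[K] K}

theorem comp_convLeft (L : M →ₗ[K] N) (v : V →ₗ[K] K) (f : V →ₗ[K] M) :
    L ∘ₗ convLeft Δ v f = convLeft Δ v (L ∘ₗ f) := by
  ext z; simp only [convLeft_apply, LinearMap.comp_apply, sw_map, map_smul]

theorem comp_convRight (L : M →ₗ[K] N) (f : V →ₗ[K] M) (v : V →ₗ[K] K) :
    L ∘ₗ convRight Δ f v = convRight Δ (L ∘ₗ f) v := by
  ext z; simp only [convRight_apply, LinearMap.comp_apply, sw_map, map_smul]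

theorem convLeft_eq_conv (v : V →ₗ[K] K) (f : V →ₗ[K] A) :
    convLeft Δ v f = conv Δ (Algebra.linearMap K A ∘ₗ v) f := by
  ext z; simp only [convLeft_apply, conv_apply, LinearMap.comp_apply, Algebra.linearMap_apply,
    Algebra.smul_def]

theorem convRight_eq_conv (f : V →ₗ[K] A) (v : V →ₗ[K] K) :
    convRight Δ f v = conv Δ f (Algebra.linearMap K A ∘ₗ v) := by
  ext z; simp only [convRight_apply, conv_apply, LinearMap.comp_apply, Algebra.linearMap_apply,
    Algebra.smul_def, Algebra.commutes]

theorem linearMap_comp_conv (v w : V →ₗ[K] K) : Algebra.linearMap K A ∘ₗ conv Δ v w =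
    conv Δ (Algebra.linearMap K A ∘ₗ v) (Algebra.linearMap K A ∘ₗ w) := by
  ext z; simp only [conv_apply, LinearMap.comp_apply, Algebra.linearMap_apply, sw_map, map_mul]

theorem linearMap_self_comp (v : V →ₗ[K] K) : Algebra.linearMap K K ∘ₗ v = v := rfl

namespace IsYDCoalgebra

variable (hX : IsYDCoalgebra X Δ ε)

include hX

theorem conv_assoc (f g k : V →ₗ[K] A) : conv Δ (conv Δ f g) k = conv Δ f (conv Δ g k) := by
  ext z
  simp (disch := fun_prop) only [conv_apply, sw_mul, mul_sw, hX.coassoc, mul_assoc]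

theorem unit_conv (f : V →ₗ[K] A) : conv Δ (Algebra.linearMap K A ∘ₗ ε) f = f := by
  ext z
  rw [← convLeft_eq_conv, convLeft_apply, hX.counit_left_smul _ (by fun_prop)]

theorem conv_unit (f : V →ₗ[K] A) : conv Δ f (Algebra.linearMap K A ∘ₗ ε) = f := by
  ext z
  rw [← convRight_eq_conv, convRight_apply, hX.counit_right_smul _ (by fun_prop)]

/-- The convolution monoid `Hom(V, A)`. -/
abbrev convMonoid (A : Type*) [Ring A] [Algebra K A] : Monoid (V →ₗ[K] A) where
  mul := conv Δ
  one := Algebra.linearMap K A ∘ₗ ε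
  mul_assoc := hX.conv_assoc
  one_mul := hX.unit_conv
  mul_one := hX.conv_unit

theorem convLeft_convLeft (v w : V →ₗ[K] K) (f : V →ₗ[K] M) :
    convLeft Δ v (convLeft Δ w f) = convLeft Δ (conv Δ v w) f := by
  ext z
  simp (disch := fun_prop) only [convLeft_apply, conv_apply, sw_smul, smul_sw, hX.coassoc,
    mul_smul]

theorem convRight_convRight (f : V →ₗ[K] M) (v w : V →ₗ[K] K) :
    convRight Δ (convRight Δ f v) w = convRight Δ f (conv Δ v w) := by
  ext z
  simp (disch := fun_prop) only [convRight_apply, conv_apply, sw_smul, smul_sw, hX.coassoc,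
    mul_smul]
  exact sw_congr fun _ _ => sw_congr fun _ _ => smul_comm ..

theorem convLeft_convRight (v : V →ₗ[K] K) (f : V →ₗ[K] M) (w : V →ₗ[K] K) :
    convRight Δ (convLeft Δ v f) w = convLeft Δ v (convRight Δ f w) := by
  ext z
  simp (disch := fun_prop) only [convRight_apply, convLeft_apply, smul_sw, hX.coassoc]
  exact sw_congr fun _ _ => sw_congr fun _ _ => smul_comm ..

theorem counit_convLeft (f : V →ₗ[K] M) : convLeft Δ ε f = f := by
  ext z; rw [convLeft_apply, hX.counit_left_smul _ (by fun_prop)]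

theorem convRight_counit (f : V →ₗ[K] M) : convRight Δ f ε = f := by
  ext z; rw [convRight_apply, hX.counit_right_smul _ (by fun_prop)]

theorem conv_counit (f : V →ₗ[K] K) : conv Δ f ε = f := hX.conv_unit f

theorem counit_conv (f : V →ₗ[K] K) : conv Δ ε f = f := hX.unit_conv f

/-- By coassociativity a scalar factor standing between two legs may be attached to either of them.
This is how v⁻¹ meets v inside Δ(m^v). -/
theorem map_convRight_comul (f : V →ₗ[K] M) (v : V →ₗ[K] K) (g : V →ₗ[K] N) :
    TensorProduct.map (convRight Δ f v) g ∘ₗ Δ = TensorProduct.map f (convLeft Δ v g) ∘ₗ Δ := by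
  ext z
  simp (disch := fun_prop) only [LinearMap.comp_apply, map_comul_apply, convRight_apply,
    convLeft_apply, sw_tmul_right, tmul_sw, TensorProduct.smul_tmul, hX.coassoc]

theorem map_convLeft_comul (v : V →ₗ[K] K) (f : V →ₗ[K] M) (g : V →ₗ[K] N) :
    TensorProduct.map (convLeft Δ v f) g ∘ₗ Δ = convLeft Δ v (TensorProduct.map f g ∘ₗ Δ) := by
  ext z
  simp (disch := fun_prop) only [LinearMap.comp_apply, map_comul_apply,
    convLeft_apply, sw_tmul_right, smul_sw, ← TensorProduct.smul_tmul', hX.coassoc]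

theorem map_comul_convRight (f : V →ₗ[K] M) (g : V →ₗ[K] N) (v : V →ₗ[K] K) :
    TensorProduct.map f (convRight Δ g v) ∘ₗ Δ = convRight Δ (TensorProduct.map f g ∘ₗ Δ) v := by
  ext z
  simp (disch := fun_prop) only [LinearMap.comp_apply, map_comul_apply,
    convRight_apply, tmul_sw, smul_sw, TensorProduct.tmul_smul, hX.coassoc]

/-- Colinearity of Δ: the coaction of z is the product of the coactions of z⁽¹⁾ and z⁽²⁾. In
particular Ψ carries convolution inverses to convolution inverses. -/
theorem Psi_conv (v w : V →ₗ[K] K) : X.Psi (conv Δ v w) = conv Δ (X.Psi v) (X.Psi w) := by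
  ext z
  simp (disch := fun_prop) only [Psi_apply, conv_apply, sw_smul, sw_mul, mul_sw, hX.comul_coact,
    smul_mul_smul_comm]
  exact sw_congr fun _ _ => sw_comm ..

theorem Psi_counit : X.Psi ε = Algebra.linearMap K H ∘ₗ ε := by
  ext z
  rw [Psi_apply, hX.counit_coact, LinearMap.comp_apply, Algebra.linearMap_apply,
    Algebra.algebraMap_eq_smul_one]

/-- The convolution inverse of an `H`-linear form is `H`-linear. -/
theorem inverse_linear {v w : V →ₗ[K] K} (h : IsConvInverse Δ ε v w)
    (hv : ∀ h z, v (X.act h z) = Coalgebra.counit (R := K) h * v z) (g : H) (z : V) :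
    w (X.act g z) = Coalgebra.counit (R := K) g * w z := by
  have e₁ : ∀ b, ε b = sw (Δ b) fun b₁ b₂ => v b₁ * w b₂ := fun b => by rw [← h.1, conv_apply]
  have e₂ : ∀ g a, sw (Coalgebra.comul (R := K) g) (fun h₁ h₂ => sw (Δ a) fun a₁ a₂ =>
      w (X.act h₁ a₁) * v (X.act h₂ a₂)) = Coalgebra.counit (R := K) g * ε a := fun g a => by
    rw [← hX.counit_act, ← h.2, conv_apply, hX.comul_act]
    simp (disch := fun_prop) only [sw_sw, sw_tmul]
  -- Insert ε(z⁽²⁾) = v(z⁽²⁾)w(z⁽³⁾) and let the second leg of g act inside v, where it costs only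
  -- its counit. Then w(g₍₁₎z⁽¹⁾)v(g₍₂₎z⁽²⁾) = ε(g)ε(z⁽¹⁾)ε(z⁽²⁾) by linearity of Δ and ε.
  calc
    _ = sw (Coalgebra.comul (R := K) g) fun h₁ h₂ => sw (Δ z) fun a b => sw (Δ b) fun b₁ b₂ =>
        w (X.act h₁ a) * v (X.act h₂ b₁) * w b₂ := by
      rw [← hopf_counit_right_smul (K := K) (fun x => w (X.act x z)) (by fun_prop) g]
      refine sw_congr fun h₁ h₂ => ?_
      rw [← hX.counit_right_smul (fun x => w (X.act h₁ x)) (by fun_prop) z, smul_sw]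
      refine sw_congr fun a b => ?_
      rw [e₁, sw_smul, smul_sw]
      refine sw_congr fun b₁ b₂ => ?_
      rw [hv, smul_eq_mul, smul_eq_mul]
      ring
    _ = sw (Δ z) fun a b => (sw (Coalgebra.comul (R := K) g) fun h₁ h₂ => sw (Δ a) fun a₁ a₂ =>
        w (X.act h₁ a₁) * v (X.act h₂ a₂)) * w b := by
      simp (disch := fun_prop) only [sw_mul, ← hX.coassoc]
      exact sw_comm ..
    _ = _ := by
      simp only [e₂]
      rw [← hX.counit_left_smul (fun x => w x) (by fun_prop) z, mul_sw]
      exact sw_congr fun a b => by rw [smul_eq_mul, mul_assoc]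

end IsYDCoalgebra

theorem IsConvInverse.symm {v w : V →ₗ[K] K} (h : IsConvInverse Δ ε v w) :
    IsConvInverse Δ ε w v := ⟨h.2, h.1⟩

theorem IsConvInverse.unique (hX : IsYDCoalgebra X Δ ε) {v w w' : V →ₗ[K] K}
    (h : IsConvInverse Δ ε v w) (h' : IsConvInverse Δ ε v w') : w = w' := by
  rw [← hX.conv_counit w, ← h'.1, ← hX.conv_assoc, h.2, hX.counit_conv]

theorem ConvInvertible.isConvInverse {v : V →ₗ[K] K} (h : ConvInvertible Δ ε v) :
    IsConvInverse Δ ε v (convInv Δ ε v) := by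
  rw [convInv, dif_pos h]; exact h.choose_spec

theorem IsConvInverse.convInv_eq (hX : IsYDCoalgebra X Δ ε) {v w : V →ₗ[K] K}
    (h : IsConvInverse Δ ε v w) : convInv Δ ε v = w :=
  IsConvInverse.unique hX (ConvInvertible.isConvInverse ⟨w, h⟩) h

end Convolution

/-! ### The coalgebra underlying a pre-bialgebra, in Sweedler form -/

section PreBialgebra

variable {K H R A M N : Type*} [Field K] [Ring H] [HopfAlgebra K H]
  [AddCommGroup R] [Module K R] [Coalgebra K R] [Ring A] [Algebra K A]
  [AddCommMonoid M] [Module K M] [AddCommMonoid N] [Module K N]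

local notation "δ" => Coalgebra.comul (R := K) (A := H)

local notation "η" => Coalgebra.counit (R := K) (A := H)

theorem assoc_tmul_eq_sw {B C D : Type*} [AddCommMonoid B] [Module K B] [AddCommMonoid C]
    [Module K C] [AddCommMonoid D] [Module K D] (t : B ⊗[K] C) (d : D) :
    TensorProduct.assoc K B C D (t ⊗ₜ[K] d) = sw t fun a b => a ⊗ₜ[K] (b ⊗ₜ[K] d) :=
  lin_eq_sw (L := fun t => TensorProduct.assoc K B C D (t ⊗ₜ[K] d)) (by fun_prop) t

theorem tmul_eq_sw {B C D : Type*} [AddCommMonoid B] [Module K B] [AddCommMonoid C]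
    [Module K C] [AddCommMonoid D] [Module K D] (d : D) (t : B ⊗[K] C) :
    d ⊗ₜ[K] t = sw t fun a b => d ⊗ₜ[K] (a ⊗ₜ[K] b) :=
  lin_eq_sw (L := fun t => d ⊗ₜ[K] t) (by fun_prop) t

theorem twist_apply {V : Type*} [AddCommGroup V] [Module K V] (X : YDStr K H V) (h : H)
    (t : H ⊗[K] V) : X.twist h t = sw (δ h) fun x h₃ => sw (δ x) fun h₁ h₂ => sw t fun g w =>
      (h₁ * (g * HopfAlgebra.antipode K h₃)) ⊗ₜ[K] X.act h₂ w := by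
  let F : (H ⊗[K] H) ⊗[K] H →ₗ[K] Module.End K (H ⊗[K] V) :=
    (Module.endTensorEndAlgHom (R := K) (S := K) (A := K) (M := H) (N := V)).toLinearMap ∘ₗ
    TensorProduct.map (biMul K H ∘ₗ (HopfAlgebra.antipode K).lTensor H) X.act.toLinearMap ∘ₗ
    (TensorProduct.rightComm K H H H).toLinearMap
  have hF : ∀ u, IsLinearMap K fun y => F y u := fun u => (F.flip u).isLinear
  calc
    _ = sw (δ h) fun x h₃ => F (δ x ⊗ₜ h₃) t :=
      lin_eq_sw (L := fun s => F ((δ).rTensor H s) t)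
        (isLinearMap_comp (hF t) (LinearMap.isLinear _)) (δ h)
    _ = sw (δ h) fun x h₃ => sw (δ x) fun h₁ h₂ => F ((h₁ ⊗ₜ h₂) ⊗ₜ h₃) t :=
      sw_congr fun x h₃ => lin_eq_sw (L := fun s => F (s ⊗ₜ h₃) t)
        (isLinearMap_comp (hF t) (by fun_prop)) (δ x)
    _ = _ := sw_congr fun x h₃ => sw_congr fun h₁ h₂ =>
      lin_eq_sw (L := fun s => F ((h₁ ⊗ₜ h₂) ⊗ₜ h₃) s) (by fun_prop) t

theorem antipode_mul_comul (f : H → M) (hf : IsLinearMap K f) (h : H) :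
    sw (δ h) (fun a b => f (HopfAlgebra.antipode K a * b)) = η h • f 1 := by
  rw [← hf.map_smul, ← Algebra.algebraMap_eq_smul_one,
    ← HopfAlgebra.mul_antipode_rTensor_comul_apply]
  exact (lin_eq_sw (L := fun t => f (LinearMap.mul' K H
    ((HopfAlgebra.antipode K).rTensor H t))) (by fun_prop) (δ h)).symm

theorem mul_antipode_comul (f : H → M) (hf : IsLinearMap K f) (h : H) :
    sw (δ h) (fun a b => f (a * HopfAlgebra.antipode K b)) = η h • f 1 := by
  rw [← hf.map_smul, ← Algebra.algebraMap_eq_smul_one,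
    ← HopfAlgebra.mul_antipode_lTensor_comul_apply]
  exact (lin_eq_sw (L := fun t => f (LinearMap.mul' K H
    ((HopfAlgebra.antipode K).lTensor H t))) (by fun_prop) (δ h)).symm

theorem PreBialgebra.isYDCoalgebra (P : PreBialgebra K H R) :
    IsYDCoalgebra P.yd Coalgebra.comul Coalgebra.counit where
  coact_comul' v := by
    have e := LinearMap.congr_fun P.isYD.coassoc v
    simp only [LinearMap.comp_apply] at e
    rw [← sw_tmul_self (P.yd.coact v)] at e
    simp only [sw_map, LinearMap.rTensor_tmul, LinearMap.lTensor_tmul, LinearEquiv.coe_coe,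
      assoc_tmul_eq_sw] at e
    refine e.trans (sw_congr fun h w => tmul_eq_sw ..)
  coact_counit v := by
    have e := P.isYD.counit_coact v
    rw [← sw_tmul_self (P.yd.coact v)] at e
    simpa only [sw_map, LinearMap.rTensor_tmul, TensorProduct.lid_tmul] using e
  coact_act' h v := by
    simp (disch := fun_prop) only [P.isYD.compat, twist_apply, sw_sw, sw_tmul]
    rw [hopf_coassoc _ (by fun_prop) (by fun_prop) (by fun_prop)]
    conv_rhs => rw [← hopf_counit_right_smul (K := K) (fun x => sw (δ x) fun h₁ h₂ =>
      sw (P.yd.coact v) fun g w => (h₁ * g) ⊗ₜ[K] P.yd.act h₂ w) (by fun_prop) h]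
    refine sw_congr fun x y => ?_
    simp only [sw_comm (δ y), smul_sw]
    refine sw_congr fun p q => ?_
    refine sw_congr fun g w => ?_
    simp only [mul_assoc]
    -- `y` carries the last two legs of h; they appear as S(y₍₁₎)y₍₂₎ and collapse to the counit.
    rw [antipode_mul_comul (fun s => (p * (g * s)) ⊗ₜ[K] P.yd.act q w) (by fun_prop) y, _root_.mul_one]
  coassoc' v := by
    have e := Coalgebra.coassoc_apply (R := K) v
    rw [← sw_tmul_self (Coalgebra.comul (R := K) v)] at e
    simp only [sw_map, LinearMap.rTensor_tmul, LinearMap.lTensor_tmul, 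
      assoc_tmul_eq_sw] at e
    refine e.trans (sw_congr fun h w => tmul_eq_sw ..)
  counit_left v := by
    have e := congrArg (TensorProduct.lid K R) (Coalgebra.rTensor_counit_comul (R := K) v)
    rw [← sw_tmul_self (Coalgebra.comul (R := K) v)] at e
    simpa [sw_map] using e
  counit_right v := by
    have e := congrArg (TensorProduct.rid K R) (Coalgebra.lTensor_counit_comul (R := K) v)
    rw [← sw_tmul_self (Coalgebra.comul (R := K) v)] at e
    simpa [sw_map] using e
  comul_act h v := by
    rw [P.comul_linear h v]
    conv_lhs => rw [← sw_tmul_self (Coalgebra.comul (R := K) v)]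
    simp only [sw_map, tensor_act]
    exact sw_comm ..
  comul_coact' v := by
    have e := LinearMap.congr_fun P.comul_colinear v
    simp only [LinearMap.comp_apply] at e
    rw [← sw_tmul_self (P.yd.coact v)] at e
    rw [← sw_tmul_self (Coalgebra.comul (R := K) v)] at e
    simp only [sw_map, LinearMap.lTensor_tmul, tensor_coact] at e
    rw [e]
    exact sw_congr fun h w => (tmul_eq_sw ..).symm
  counit_act h v := P.counit_linear h v
  counit_coact v := by
    have e := congrArg (TensorProduct.rid K H) (LinearMap.congr_fun P.counit_colinear v)
    simp only [LinearMap.comp_apply] at e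
    rw [← sw_tmul_self (P.yd.coact v)] at e
    simpa [sw_map, YDStr.unit] using e.symm

end PreBialgebra

/-! ### Pulling back convolution and Ψ along coalgebra maps and colinear maps -/

section Maps

variable {K H V W A : Type*} [Field K] [Ring H] [HopfAlgebra K H]
  [AddCommGroup V] [Module K V] [AddCommGroup W] [Module K W] [Ring A] [Algebra K A]

theorem conv_comp {Δ : V →ₗ[K] V ⊗[K] V} {Δ' : W →ₗ[K] W ⊗[K] W} {n : V →ₗ[K] W}
    (hn : Δ' ∘ₗ n = TensorProduct.map n n ∘ₗ Δ) (f g : W →ₗ[K] A) :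
    conv Δ' f g ∘ₗ n = conv Δ (f ∘ₗ n) (g ∘ₗ n) := by
  rw [conv, conv, LinearMap.comp_assoc, LinearMap.comp_assoc, hn, TensorProduct.map_comp,
    LinearMap.comp_assoc]

theorem Psi_comp {X : YDStr K H V} {Y : YDStr K H W} {n : V →ₗ[K] W} (hn : X.IsColinear Y n)
    (f : W →ₗ[K] K) : Y.Psi f ∘ₗ n = X.Psi (f ∘ₗ n) := by
  rw [YDStr.IsColinear] at hn
  rw [YDStr.Psi, YDStr.Psi, LinearMap.comp_assoc, LinearMap.comp_assoc, hn, LinearMap.lTensor_comp,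
    LinearMap.comp_assoc]

end Maps

/-! ### The coalgebras R ⊗ R and R ⊗ R ⊗ R -/

namespace PreBialgebra

variable {K H R A M N : Type*} [Field K] [Ring H] [HopfAlgebra K H]
  [AddCommGroup R] [Module K R] [Coalgebra K R] [Ring A] [Algebra K A]
  [AddCommMonoid M] [Module K M] [AddCommMonoid N] [Module K N] (P : PreBialgebra K H R)

local notation "δ" => Coalgebra.comul (R := K) (A := H)

local notation "Δ" => Coalgebra.comul (R := K) (A := R)

theorem isYDCoalgebra₂ : IsYDCoalgebra P.yd₂ P.comul₂ (counit₂ K R) :=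
  P.isYDCoalgebra.tensor P.isYDCoalgebra

variable (K R) in
/-- The counit of `R ⊗ R ⊗ R`. -/
def counit₃ : (R ⊗[K] R) ⊗[K] R →ₗ[K] K := tensorForm (counit₂ K R) Coalgebra.counit

theorem isYDCoalgebra₃ : IsYDCoalgebra P.yd₃ P.comul₃ (counit₃ K R) :=
  P.isYDCoalgebra₂.tensor P.isYDCoalgebra

theorem comul₂_tmul (r s : R) : P.comul₂ (r ⊗ₜ s) = sw (Δ r) fun r₁ r₂ =>
    sw (P.yd.coact r₂) fun h r₀ => sw (Δ s) fun s₁ s₂ =>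
      (r₁ ⊗ₜ[K] P.yd.act h s₁) ⊗ₜ[K] (r₀ ⊗ₜ[K] s₂) := tensorComul_tmul ..

theorem comul₃_tmul (z : R ⊗[K] R) (t : R) : P.comul₃ (z ⊗ₜ t) = sw (P.comul₂ z) fun z₁ z₂ =>
    sw (P.yd₂.coact z₂) fun h z₀ => sw (Δ t) fun t₁ t₂ =>
      (z₁ ⊗ₜ[K] P.yd.act h t₁) ⊗ₜ[K] (z₀ ⊗ₜ[K] t₂) := tensorComul_tmul ..

theorem coact₂_tmul (r s : R) : P.yd₂.coact (r ⊗ₜ s) = sw (P.yd.coact r) fun h r₀ =>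
    sw (P.yd.coact s) fun g s₀ => (h * g) ⊗ₜ[K] (r₀ ⊗ₜ[K] s₀) := tensor_coact ..

theorem coact₃_tmul (z : R ⊗[K] R) (t : R) : P.yd₃.coact (z ⊗ₜ t) = sw (P.yd₂.coact z) fun h z₀ =>
    sw (P.yd.coact t) fun g t₀ => (h * g) ⊗ₜ[K] (z₀ ⊗ₜ[K] t₀) := tensor_coact ..

theorem act₂_tmul (h : H) (r s : R) : P.yd₂.act h (r ⊗ₜ s) = sw (δ h) fun h₁ h₂ =>
    P.yd.act h₁ r ⊗ₜ[K] P.yd.act h₂ s := tensor_act ..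

local notation "τ" => LinearEquiv.symm (TensorProduct.assoc K R R R)

/-- Coherence of the two bracketings. The coalgebra R ⊗ R ⊗ R is defined through (R ⊗ R) ⊗ R, while
R ⊗ f and ε ⊗ f are transparent on R ⊗ (R ⊗ R). The braiding of r past a pair splits by
coassociativity of the coaction. -/
theorem comul₃_assoc_symm (r : R) (w : R ⊗[K] R) : P.comul₃ (τ (r ⊗ₜ w)) =
    sw (Δ r) fun r₁ r₂ => sw (P.yd.coact r₂) fun h r₀ => sw (P.comul₂ w) fun w₁ w₂ =>
      τ (r₁ ⊗ₜ[K] P.yd₂.act h w₁) ⊗ₜ[K] τ (r₀ ⊗ₜ[K] w₂) := by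
  revert w
  refine lin_ext (by fun_prop) (by fun_prop) fun s t => ?_
  simp (disch := fun_prop) only [TensorProduct.assoc_symm_tmul, comul₃_tmul, comul₂_tmul,
    coact₂_tmul, act₂_tmul, sw_sw, sw_tmul, sw_map, sw_tmul_right, tmul_sw]
  refine sw_congr fun r₁ r₂ => ?_
  simp only [sw_comm (P.yd.coact r₂) (Δ s)]
  simp only [sw_comm (P.yd.coact _) (δ _), sw_comm (Δ t) (δ _)]
  simp (disch := fun_prop) only [P.isYDCoalgebra.coact_comul, map_mul, Module.End.mul_apply]

theorem coact₃_assoc_symm (r : R) (w : R ⊗[K] R) : P.yd₃.coact (τ (r ⊗ₜ w)) =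
    sw (P.yd.coact r) fun h r₀ => sw (P.yd₂.coact w) fun g w₀ =>
      (h * g) ⊗ₜ[K] τ (r₀ ⊗ₜ[K] w₀) := by
  revert w
  refine lin_ext (by fun_prop) (by fun_prop) fun s t => ?_
  simp (disch := fun_prop) only [TensorProduct.assoc_symm_tmul, coact₃_tmul,
    coact₂_tmul, sw_sw, sw_tmul, mul_assoc]

end PreBialgebra

/-! ### Calculus of ε ⊗ f, f ⊗ ε, R ⊗ f and f ⊗ R under convolution -/

namespace PreBialgebra

section Assoc

variable {K R M : Type*} [Field K] [AddCommGroup R] [Module K R] [AddCommGroup M] [Module K M]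

local notation "τ" => LinearEquiv.symm (TensorProduct.assoc K R R R)

/-- `R ⊗ f : R ⊗ R ⊗ R → R ⊗ R`. -/
def idTensor (f : R ⊗[K] R →ₗ[K] R) : (R ⊗[K] R) ⊗[K] R →ₗ[K] R ⊗[K] R :=
  f.lTensor R ∘ₗ (TensorProduct.assoc K R R R).toLinearMap

theorem idTensor_apply (f : R ⊗[K] R →ₗ[K] R) (r : R) (w : R ⊗[K] R) :
    idTensor f (τ (r ⊗ₜ w)) = r ⊗ₜ[K] f w := by
  simp [idTensor]

theorem ext_assoc_symm {f g : (R ⊗[K] R) ⊗[K] R →ₗ[K] M}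
    (h : ∀ r w, f (τ (r ⊗ₜ w)) = g (τ (r ⊗ₜ w))) : f = g := by
  have : f ∘ₗ (τ).toLinearMap = g ∘ₗ (τ).toLinearMap := TensorProduct.ext' h
  ext r s t
  simpa using LinearMap.congr_fun this (r ⊗ₜ (s ⊗ₜ t))

end Assoc

variable {K H R A M N : Type*} [Field K] [Ring H] [HopfAlgebra K H]
  [AddCommGroup R] [Module K R] [Coalgebra K R] [Ring A] [Algebra K A]
  [AddCommGroup M] [Module K M] (P : PreBialgebra K H R)

local notation "η" => Coalgebra.counit (R := K) (A := H)

local notation "ε" => Coalgebra.counit (R := K) (A := R)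

local notation "τ" => LinearEquiv.symm (TensorProduct.assoc K R R R)

/-- `ε ⊗ f : R ⊗ R ⊗ R → M`. -/
def epsTensor (f : R ⊗[K] R →ₗ[K] M) : (R ⊗[K] R) ⊗[K] R →ₗ[K] M :=
  (TensorProduct.lid K M).toLinearMap ∘ₗ TensorProduct.map Coalgebra.counit f ∘ₗ
    (TensorProduct.assoc K R R R).toLinearMap

/-- `f ⊗ ε : R ⊗ R ⊗ R → M`. -/
def tensorEps (f : R ⊗[K] R →ₗ[K] M) : (R ⊗[K] R) ⊗[K] R →ₗ[K] M :=
  (TensorProduct.rid K M).toLinearMap ∘ₗ TensorProduct.map f Coalgebra.counit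

theorem epsTensor_apply (f : R ⊗[K] R →ₗ[K] M) (r : R) (w : R ⊗[K] R) :
    epsTensor f (τ (r ⊗ₜ w)) = ε r • f w := by
  simp [epsTensor]

theorem tensorEps_tmul (f : R ⊗[K] R →ₗ[K] M) (z : R ⊗[K] R) (t : R) :
    tensorEps f (z ⊗ₜ t) = ε t • f z := by
  simp [tensorEps]

local notation "𝒰" => Algebra.linearMap K

/-- `w` is left `H`-linear with values in the trivial module. -/
def IsInvariant (w : R ⊗[K] R →ₗ[K] K) : Prop := ∀ h z, w (P.yd₂.act h z) = η h * w z

variable {P}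

/-- In the coproduct of r ⊗ z the coaction of r acts on z⁽¹⁾, which is the argument of w. Invariance
of w reduces this action to the counit, so the convolution takes place inside the second tensor
factor. -/
theorem conv_epsTensor {w : R ⊗[K] R →ₗ[K] K} (hw : P.IsInvariant w)
    (f : R ⊗[K] R →ₗ[K] R) (φ : R ⊗[K] R →ₗ[K] A) :
    conv P.comul₃ (𝒰 A ∘ₗ epsTensor w) (φ ∘ₗ idTensor f) =
      φ ∘ₗ idTensor (convLeft P.comul₂ w f) := by
  refine ext_assoc_symm fun r z => ?_
  rw [← convLeft_eq_conv, convLeft_apply, comul₃_assoc_symm]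
  simp (disch := fun_prop) only [sw_sw, sw_tmul, LinearMap.comp_apply, epsTensor_apply,
    idTensor_apply, convLeft_apply, tmul_sw, sw_map, hw _ _, smul_eq_mul, mul_smul, ← smul_sw,
    TensorProduct.tmul_smul, map_smul]
  simp (disch := fun_prop) only [P.isYDCoalgebra.coact_counit_smul,
    P.isYDCoalgebra.counit_left_smul]

/-- With ε ⊗ g on the right no invariance is needed: ε is applied to r₍₀₎ and, being colinear, turns
r₍₋₁₎ into 1. -/
theorem conv_idTensor_epsTensor (f : R ⊗[K] R →ₗ[K] R) (φ : R ⊗[K] R →ₗ[K] A)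
    (g : R ⊗[K] R →ₗ[K] A) (r : R) (z : R ⊗[K] R) :
    conv P.comul₃ (φ ∘ₗ idTensor f) (epsTensor g) (τ (r ⊗ₜ z)) =
      sw (P.comul₂ z) fun a b => φ (r ⊗ₜ f a) * g b := by
  rw [conv_apply, comul₃_assoc_symm]
  simp (disch := fun_prop) only [sw_sw, sw_tmul, LinearMap.comp_apply, epsTensor_apply,
    idTensor_apply, mul_smul_comm]
  simp (disch := fun_prop) only [← smul_sw, P.isYDCoalgebra.counit_coact_smul,
    P.isYDCoalgebra.counit_right_smul, map_one, Module.End.one_apply]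

theorem conv_idTensor (f : R ⊗[K] R →ₗ[K] R) (φ : R ⊗[K] R →ₗ[K] A) (w : R ⊗[K] R →ₗ[K] K) :
    conv P.comul₃ (φ ∘ₗ idTensor f) (𝒰 A ∘ₗ epsTensor w) =
      φ ∘ₗ idTensor (convRight P.comul₂ f w) := by
  refine ext_assoc_symm fun r z => ?_
  have : 𝒰 A ∘ₗ epsTensor w = epsTensor (𝒰 A ∘ₗ w) := by
    refine ext_assoc_symm fun r z => ?_
    simp only [LinearMap.comp_apply, epsTensor_apply, map_smul]
  rw [this, conv_idTensor_epsTensor]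
  simp only [LinearMap.comp_apply, idTensor_apply, convRight_apply, tmul_sw, sw_map,
    TensorProduct.tmul_smul, map_smul, Algebra.linearMap_apply, Algebra.smul_def,
    Algebra.commutes]

theorem conv_epsTensor_epsTensor {w : R ⊗[K] R →ₗ[K] K} (hw : P.IsInvariant w)
    (f : R ⊗[K] R →ₗ[K] A) :
    conv P.comul₃ (𝒰 A ∘ₗ epsTensor w) (epsTensor f) =
      epsTensor (conv P.comul₂ (𝒰 A ∘ₗ w) f) := by
  refine ext_assoc_symm fun r z => ?_
  rw [← convLeft_eq_conv, ← convLeft_eq_conv, convLeft_apply, comul₃_assoc_symm]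
  simp (disch := fun_prop) only [sw_sw, sw_tmul, epsTensor_apply,
    convLeft_apply, hw _ _, smul_eq_mul, mul_smul, ← smul_sw]
  simp (disch := fun_prop) only [P.isYDCoalgebra.coact_counit_smul,
    P.isYDCoalgebra.counit_left_smul]
  rw [smul_sw]
  exact sw_congr fun _ _ => smul_comm (M := K) (N := K) ..

theorem conv_tensorEps (w : R ⊗[K] R →ₗ[K] K) 
    (f : R ⊗[K] R →ₗ[K] R) (φ : R ⊗[K] R →ₗ[K] A) :
    conv P.comul₃ (𝒰 A ∘ₗ tensorEps w) (φ ∘ₗ f.rTensor R) =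
      φ ∘ₗ (convLeft P.comul₂ w f).rTensor R := by
  refine TensorProduct.ext' fun z t => ?_
  rw [← convLeft_eq_conv, convLeft_apply, comul₃_tmul]
  simp (disch := fun_prop) only [sw_sw, sw_tmul, LinearMap.comp_apply, tensorEps_tmul,
    LinearMap.rTensor_tmul, convLeft_apply, sw_tmul_right, sw_map, smul_eq_mul, mul_smul,
    P.isYDCoalgebra.counit_act, ← smul_sw, ← TensorProduct.smul_tmul', map_smul]
  simp (disch := fun_prop) only [smul_comm _ (w _), ← smul_sw, P.isYDCoalgebra.counit_left_smul,
    P.isYDCoalgebra₂.coact_counit_smul]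

/-- Here the braiding survives: the coaction of z⁽²⁾ acts on t inside g. This residual action is
what produces `Phi` later. -/
theorem conv_tensorEps_right (g : (R ⊗[K] R) ⊗[K] R →ₗ[K] A)
    (f : R ⊗[K] R →ₗ[K] A) (z : R ⊗[K] R) (t : R) :
    conv P.comul₃ g (tensorEps f) (z ⊗ₜ t) = sw (P.comul₂ z) fun z₁ z₂ =>
      sw (P.yd₂.coact z₂) fun h z₀ => g (z₁ ⊗ₜ P.yd.act h t) * f z₀ := by
  rw [conv_apply, comul₃_tmul]
  simp (disch := fun_prop) only [sw_sw, sw_tmul, tensorEps_tmul, mul_smul_comm,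
    P.isYDCoalgebra.counit_right_smul]

theorem conv_tensorEps_tensorEps (f g : R ⊗[K] R →ₗ[K] A) :
    conv P.comul₃ (tensorEps f) (tensorEps g) = tensorEps (conv P.comul₂ f g) := by
  refine TensorProduct.ext' fun z t => ?_
  rw [conv_tensorEps_right]
  simp (disch := fun_prop) only [tensorEps_tmul, P.isYDCoalgebra.counit_act, mul_smul,
    smul_mul_assoc, P.isYDCoalgebra₂.coact_counit_smul, conv_apply, smul_sw]

theorem Psi_epsTensor (v : R ⊗[K] R →ₗ[K] K) :
    P.yd₃.Psi (epsTensor v) = epsTensor (P.yd₂.Psi v) := by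
  refine ext_assoc_symm fun r z => ?_
  rw [Psi_apply, coact₃_assoc_symm, epsTensor_apply, Psi_apply]
  simp (disch := fun_prop) only [sw_sw, sw_tmul, epsTensor_apply, smul_eq_mul, mul_smul,
    ← smul_sw]
  simp (disch := fun_prop) only [P.isYDCoalgebra.counit_coact_smul, _root_.one_mul]

theorem Psi_tensorEps (v : R ⊗[K] R →ₗ[K] K) :
    P.yd₃.Psi (tensorEps v) = tensorEps (P.yd₂.Psi v) := by
  refine TensorProduct.ext' fun z t => ?_
  rw [Psi_apply, coact₃_tmul, tensorEps_tmul, Psi_apply]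
  simp (disch := fun_prop) only [sw_sw, sw_tmul, tensorEps_tmul, smul_eq_mul, mul_smul,
    P.isYDCoalgebra.counit_coact_smul, smul_sw, _root_.mul_one]

variable (P) in
/-- `μ : R ⊗ R → R` is a coalgebra map. -/
def IsCoalgebraMap (μ : R ⊗[K] R →ₗ[K] R) : Prop :=
  Coalgebra.comul ∘ₗ μ = TensorProduct.map μ μ ∘ₗ P.comul₂

/-- The braiding acts on the second factor through the H-action, so R ⊗ μ needs μ linear. For μ ⊗ R
it is the coaction on the first factor that must commute with μ, hence the colinearity in
`IsCoalgebraMap.rTensor`. -/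
theorem IsCoalgebraMap.idTensor {μ : R ⊗[K] R →ₗ[K] R} (hμ : P.IsCoalgebraMap μ)
    (hl : P.yd₂.IsLinear P.yd μ) :
    P.comul₂ ∘ₗ idTensor μ = TensorProduct.map (idTensor μ) (idTensor μ) ∘ₗ P.comul₃ := by
  refine ext_assoc_symm fun r z => ?_
  have h := LinearMap.congr_fun hμ z
  rw [LinearMap.comp_apply, LinearMap.comp_apply, map_comul_apply] at h
  simp (disch := fun_prop) only [LinearMap.comp_apply, comul₃_assoc_symm, sw_sw, sw_map, TensorProduct.map_tmul,
    sw_tmul, idTensor_apply, comul₂_tmul, h, hl _ _]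

theorem IsCoalgebraMap.rTensor {μ : R ⊗[K] R →ₗ[K] R} (hμ : P.IsCoalgebraMap μ)
    (hl : P.yd₂.IsColinear P.yd μ) :
    P.comul₂ ∘ₗ μ.rTensor R = TensorProduct.map (μ.rTensor R) (μ.rTensor R) ∘ₗ P.comul₃ := by
  refine TensorProduct.ext' fun z t => ?_
  have h := LinearMap.congr_fun hμ z
  rw [LinearMap.comp_apply, LinearMap.comp_apply, map_comul_apply] at h
  have h' : ∀ z, P.yd.coact (μ z) = sw (P.yd₂.coact z) fun h z₀ => h ⊗ₜ[K] μ z₀ := fun z =>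
    (LinearMap.congr_fun hl z).trans (lin_eq_sw (L := fun t => μ.lTensor H t) (by fun_prop) _)
  simp (disch := fun_prop) only [LinearMap.comp_apply, comul₃_tmul, sw_sw, sw_map, TensorProduct.map_tmul,
    sw_tmul, LinearMap.rTensor_tmul, comul₂_tmul, h, h']

theorem idTensor_colinear {μ : R ⊗[K] R →ₗ[K] R} (hl : P.yd₂.IsColinear P.yd μ) :
    P.yd₃.IsColinear P.yd₂ (idTensor μ) := by
  have h' : ∀ z, P.yd.coact (μ z) = sw (P.yd₂.coact z) fun h z₀ => h ⊗ₜ[K] μ z₀ := fun z =>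
    (LinearMap.congr_fun hl z).trans (lin_eq_sw (L := fun t => μ.lTensor H t) (by fun_prop) _)
  refine ext_assoc_symm fun r z => ?_
  simp (disch := fun_prop) only [LinearMap.comp_apply, coact₃_assoc_symm, sw_map,
    idTensor_apply, coact₂_tmul, h', sw_sw, sw_tmul, LinearMap.lTensor_tmul]

theorem rTensor_colinear {μ : R ⊗[K] R →ₗ[K] R} (hl : P.yd₂.IsColinear P.yd μ) :
    P.yd₃.IsColinear P.yd₂ (μ.rTensor R) := by
  have h' : ∀ z, P.yd.coact (μ z) = sw (P.yd₂.coact z) fun h z₀ => h ⊗ₜ[K] μ z₀ := fun z =>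
    (LinearMap.congr_fun hl z).trans (lin_eq_sw (L := fun t => μ.lTensor H t) (by fun_prop) _)
  refine TensorProduct.ext' fun z t => ?_
  simp (disch := fun_prop) only [LinearMap.comp_apply, coact₃_tmul, sw_map,
    LinearMap.rTensor_tmul, coact₂_tmul, h', sw_sw, sw_tmul, LinearMap.lTensor_tmul]

end PreBialgebra

/-! ### Conjugation by v, and membership of v⁻¹ * Ψ(v) in 𝒮 -/

namespace PreBialgebra

variable {K H R A M N : Type*} [Field K] [Ring H] [HopfAlgebra K H]
  [AddCommGroup R] [Module K R] [Coalgebra K R] [Ring A] [Algebra K A]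
  [AddCommGroup M] [Module K M] {P : PreBialgebra K H R}

local notation "δ" => Coalgebra.comul (R := K) (A := H)

local notation "η" => Coalgebra.counit (R := K) (A := H)

local notation "𝒰" => Algebra.linearMap K

theorem IsInvariant.inverse {v w : R ⊗[K] R →ₗ[K] K} (hv : P.IsInvariant v)
    (h : IsConvInverse P.comul₂ (counit₂ K R) v w) : P.IsInvariant w :=
  P.isYDCoalgebra₂.inverse_linear h hv

theorem IsInvariant.convLeft_linear {v : R ⊗[K] R →ₗ[K] K} (hv : P.IsInvariant v)
    {f : R ⊗[K] R →ₗ[K] R} (hf : P.yd₂.IsLinear P.yd f) :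
    P.yd₂.IsLinear P.yd (convLeft P.comul₂ v f) := fun h z => by
  simp (disch := fun_prop) only [convLeft_apply, P.isYDCoalgebra₂.comul_act, sw_sw, sw_tmul,
    hv _ _, hf _ _, sw_map, map_smul, mul_smul]
  rw [sw_comm]
  refine sw_congr fun a b => ?_
  rw [hopf_counit_left_smul (fun x => v a • P.yd.act x (f b)) (by fun_prop) h]

theorem IsInvariant.convRight_linear {v : R ⊗[K] R →ₗ[K] K} (hv : P.IsInvariant v)
    {f : R ⊗[K] R →ₗ[K] R} (hf : P.yd₂.IsLinear P.yd f) :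
    P.yd₂.IsLinear P.yd (convRight P.comul₂ f v) := fun h z => by
  simp (disch := fun_prop) only [convRight_apply, P.isYDCoalgebra₂.comul_act, sw_sw, sw_tmul,
    hv _ _, hf _ _, sw_map, map_smul, mul_smul]
  rw [sw_comm]
  refine sw_congr fun a b => ?_
  rw [hopf_counit_right_smul (fun x => v b • P.yd.act x (f a)) (by fun_prop) h]

/-- In (v * m * w ⊗ v * m * w)Δ the inner factor w * v cancels, leaving v * (m ⊗ m)Δ * w, which is
Δ(v * m * w). -/
theorem isCoalgebraMap_conj {v w : R ⊗[K] R →ₗ[K] K}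
    (h : IsConvInverse P.comul₂ (counit₂ K R) v w) {m : R ⊗[K] R →ₗ[K] R}
    (hm : P.IsCoalgebraMap m) :
    P.IsCoalgebraMap (convRight P.comul₂ (convLeft P.comul₂ v m) w) := by
  have hX := P.isYDCoalgebra₂
  rw [IsCoalgebraMap] at hm ⊢
  rw [hX.map_convRight_comul, hX.convLeft_convRight, hX.convLeft_convLeft, h.2,
    hX.counit_convLeft, hX.map_comul_convRight, hX.map_convLeft_comul, ← hm,
    ← hX.convLeft_convRight, comp_convRight, comp_convLeft]

theorem adLeft_apply (h x : H) :
    adLeft (K := K) h x = sw (δ h) fun h₁ h₂ => h₁ * (x * HopfAlgebra.antipode K h₂) :=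
  lin_eq_sw (L := fun t => biMul K H ((HopfAlgebra.antipode K).lTensor H t) x)
    (isLinearMap_comp (f := fun t => biMul K H t x) ((biMul K H).flip x).isLinear (by fun_prop))
    (δ h)

/-- Multiplying ξ(h₍₁₎z)h₍₂₎ = hξ(z) on the right by the antipode of a further leg cancels h₍₂₎. The
hypothesis is the antipode-free form of ad-linearity, which combines directly with `coact_act`. -/
theorem isAdLinear_of_sw {V : Type*} [AddCommGroup V] [Module K V] {X : YDStr K H V}
    {ξ : V →ₗ[K] H} (hξ : ∀ h z, sw (δ h) (fun h₁ h₂ => ξ (X.act h₁ z) * h₂) = h * ξ z) :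
    X.IsAdLinear ξ := fun h z => by
  rw [adLeft_apply]
  simp only [← mul_assoc, ← hξ, sw_mul]
  rw [hopf_coassoc (fun a b c => ξ (X.act a z) * b * HopfAlgebra.antipode K c)
    (by fun_prop) (by fun_prop) (by fun_prop)]
  simp only [mul_assoc]
  rw [← hopf_counit_right_smul (K := K) (fun x => ξ (X.act x z)) (by fun_prop) h]
  refine sw_congr fun a b => ?_
  rw [mul_antipode_comul (fun x => ξ (X.act a z) * x) (by fun_prop) b, _root_.mul_one]

theorem isAdLinear_conv_Psi {V : Type*} [AddCommGroup V] [Module K V] {X : YDStr K H V}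
    {D : V →ₗ[K] V ⊗[K] V} {e : V →ₗ[K] K} (hX : IsYDCoalgebra X D e) {v w : V →ₗ[K] K}
    (hv : ∀ h z, v (X.act h z) = η h * v z) (hw : ∀ h z, w (X.act h z) = η h * w z) :
    X.IsAdLinear (conv D (𝒰 H ∘ₗ w) (X.Psi v)) := by
  refine isAdLinear_of_sw fun h z => ?_
  have hΨ : ∀ h z, sw (δ h) (fun h₁ h₂ => X.Psi v (X.act h₁ z) * h₂) =
      h * X.Psi v z := fun h z => by
    simp only [Psi_apply, sw_mul, mul_sw, smul_mul_assoc, mul_smul_comm]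
    rw [hX.coact_act (fun g z₀ => v z₀ • g) (by fun_prop) (by fun_prop) h z, sw_comm]
    refine sw_congr fun g z₀ => ?_
    simp only [hv _ _, mul_smul]
    rw [hopf_counit_right_smul (fun x => v z₀ • (x * g)) (by fun_prop) h]
  rw [← convLeft_eq_conv]
  simp (disch := fun_prop) only [convLeft_apply, hX.comul_act, sw_sw, sw_tmul, hw _ _,
    sw_mul, mul_sw, mul_smul_comm, ← hΨ, smul_sw, smul_mul_assoc, mul_smul]
  simp only [sw_comm (δ _) (D _)]
  refine sw_congr fun a b => ?_
  rw [hopf_coassoc (fun x y t => η x • w a • (X.Psi v (X.act y b) * t))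
    (by fun_prop) (by fun_prop) (by fun_prop)]
  simp (disch := fun_prop) only [← smul_sw, hopf_counit_left_smul]

/-- The map `z ↦ F(z⁽¹⁾) z⁽²⁾₍₋₁₎ ⊗ G(z⁽²⁾₍₀₎)`. -/
theorem map_splitCoact_apply (F : R ⊗[K] R →ₗ[K] H) (G : R ⊗[K] R →ₗ[K] M) (z : R ⊗[K] R) :
    TensorProduct.map (LinearMap.mul' K H) G (P.splitCoact F z) =
      sw (P.comul₂ z) fun a b => sw (P.yd₂.coact b) fun h b₀ => (F a * h) ⊗ₜ[K] G b₀ := by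
  change TensorProduct.map (LinearMap.mul' K H) G ((TensorProduct.assoc K H H (R ⊗[K] R)).symm
    (TensorProduct.map F P.yd₂.coact (P.comul₂ z))) = _
  rw [map_comul_apply]
  simp only [sw_map]
  refine sw_congr fun a b => ?_
  exact lin_eq_sw (L := fun t => TensorProduct.map (LinearMap.mul' K H) G
    ((TensorProduct.assoc K H H (R ⊗[K] R)).symm (F a ⊗ₜ[K] t))) (by fun_prop) _

/-- By colinearity of Δ, a scalar factor x moves out of the right leg and into the left one, where
it becomes Ψ(x). -/
theorem map_splitCoact_convLeft (F : R ⊗[K] R →ₗ[K] H) (x : R ⊗[K] R →ₗ[K] K)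
    (G : R ⊗[K] R →ₗ[K] M) :
    TensorProduct.map (LinearMap.mul' K H) (convLeft P.comul₂ x G) ∘ₗ P.splitCoact F =
      TensorProduct.map (LinearMap.mul' K H) G ∘ₗ
        P.splitCoact (conv P.comul₂ F (P.yd₂.Psi x)) := by
  refine LinearMap.ext fun z => ?_
  simp (disch := fun_prop) only [LinearMap.comp_apply, map_splitCoact_apply, convLeft_apply,
    tmul_sw, TensorProduct.tmul_smul, P.isYDCoalgebra₂.comul_coact, conv_apply, sw_mul, mul_sw,
    sw_tmul_right, Psi_apply, mul_smul_comm, smul_mul_assoc, ← TensorProduct.smul_tmul']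
  simp only [sw_comm (P.yd₂.coact _) (P.comul₂ _)]
  simp (disch := fun_prop) only [P.isYDCoalgebra₂.coassoc, mul_assoc]
  exact sw_congr fun _ _ => sw_congr fun _ _ => sw_comm ..

/-- Converts the right sides of (b) and (c) into ordinary convolution products, at the price of
testing against all f. -/
theorem slice_splitCoact (f : M →ₗ[K] K) (F : R ⊗[K] R →ₗ[K] H) (G : R ⊗[K] R →ₗ[K] M)
    (z : R ⊗[K] R) :
    TensorProduct.rid K H (f.lTensor H
      (TensorProduct.map (LinearMap.mul' K H) G (P.splitCoact F z))) =
    conv P.comul₂ F (P.yd₂.Psi (f ∘ₗ G)) z := by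
  simp only [map_splitCoact_apply, conv_apply, Psi_apply, sw_map, mul_sw, LinearMap.lTensor_tmul,
    TensorProduct.rid_tmul, mul_smul_comm, LinearMap.comp_apply]

theorem isSweedlerCocycle_conv {v w : R ⊗[K] R →ₗ[K] K}
    (h : IsConvInverse P.comul₂ (counit₂ K R) v w) :
    P.IsSweedlerCocycle (conv P.comul₂ (𝒰 H ∘ₗ w) (P.yd₂.Psi v)) where
  comul_comp := by
    have hX := P.isYDCoalgebra₂
    conv_rhs => enter [1, 2]; rw [← convLeft_eq_conv]
    -- The w in the right leg becomes Ψ(w) and cancels Ψ(v) in the left leg. What remains is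
    -- w(z⁽¹⁾)z⁽²⁾₍₋₁₎ ⊗ Ψ(v)(z⁽²⁾₍₀₎), the coproduct of ξ(z) by coassociativity of the coaction.
    rw [map_splitCoact_convLeft, hX.conv_assoc, ← hX.Psi_conv, h.1, hX.Psi_counit, hX.conv_unit]
    refine LinearMap.ext fun z => ?_
    rw [← convLeft_eq_conv, LinearMap.comp_apply, LinearMap.comp_apply, map_splitCoact_apply,
      convLeft_apply, sw_map]
    refine sw_congr fun a b => ?_
    simp only [Psi_apply, sw_map, map_smul, tmul_sw, smul_sw, LinearMap.comp_apply,
      Algebra.linearMap_apply, ← Algebra.smul_def, TensorProduct.tmul_smul,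
      ← TensorProduct.smul_tmul']
    rw [← hX.coact_comul (fun x y c => v c • w a • x ⊗ₜ[K] y) (by fun_prop) (by fun_prop)
      (by fun_prop)]
    refine sw_congr fun g c => ?_
    rw [← smul_sw, ← smul_sw, sw_tmul_self, smul_comm]
  counit_comp := by
    have hX := P.isYDCoalgebra₂
    rw [← h.2]
    refine LinearMap.ext fun z => ?_
    simp only [← convLeft_eq_conv, LinearMap.comp_apply, convLeft_apply, sw_map, map_smul,
      Psi_apply, conv_apply]
    refine sw_congr fun a b => ?_
    rw [smul_eq_mul, ← hX.coact_counit_smul v (by fun_prop) b]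
    exact congrArg _ (sw_congr fun _ _ => mul_comm ..)

end PreBialgebra

/-! ### Cancellation in a monoid -/

section Monoid

variable {G : Type*} [Monoid G] {v w p q a a' b b' p' q' x y : G}

theorem mul_conj_comm_iff (hvw : v * w = 1) (hwv : w * v = 1) (hpq : p * q = 1)
    (hqp : q * p = 1) : x * (w * p) = w * p * y ↔ v * x * w = p * y * q := by
  constructor
  · intro h
    have := congrArg (fun t => v * t * q) h
    simpa only [mul_assoc, hpq, mul_one, ← mul_assoc v w, hvw, one_mul] using this
  · intro h
    have := congrArg (fun t => w * t * p) h
    simpa only [mul_assoc, hqp, mul_one, ← mul_assoc w v, hwv, one_mul] using this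

theorem conj_eq_conj_iff (ha : a * a' = 1) (ha' : a' * a = 1) (hb : b * b' = 1)
    (hb' : b' * b = 1) : a' * x * a = b * y * b' ↔ x * (a * b) = a * b * y := by
  constructor
  · intro h
    have := congrArg (fun t => a * t * b) h
    simpa only [mul_assoc, hb', mul_one, ← mul_assoc a a', ha, one_mul] using this
  · intro h
    have := congrArg (fun t => a' * t * b') h
    simpa only [mul_assoc, hb, mul_one, ← mul_assoc a' a, ha', one_mul] using this

theorem inv_mul_eq_mul_inv_iff (ha : a * a' = 1) (ha' : a' * a = 1) (hq : q * q' = 1)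
    (hq' : q' * q = 1) : a' * p = b * q' ↔ p * q = a * b := by
  constructor
  · intro h
    have := congrArg (fun t => a * t * q) h
    simpa only [mul_assoc, hq', mul_one, ← mul_assoc a a', ha, one_mul] using this
  · intro h
    have := congrArg (fun t => a' * t * q') h
    simpa only [mul_assoc, hq, mul_one, ← mul_assoc a' a, ha', one_mul] using this

end Monoid

/-! ### Detecting tensors and maps by linear forms -/

section Slice

variable {K H M : Type*} [Field K] [AddCommGroup H] [Module K H] [AddCommGroup M] [Module K M]

/-- Over a field M has a basis, and slicing with its coordinate forms reads off the coefficients in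
H. -/
theorem ext_of_slice {t t' : H ⊗[K] M} (h : ∀ f : M →ₗ[K] K,
    TensorProduct.rid K H (f.lTensor H t) = TensorProduct.rid K H (f.lTensor H t')) : t = t' := by
  let b := Module.Free.chooseBasis K M
  refine (TensorProduct.equivFinsuppOfBasisRight b).injective (Finsupp.ext fun i => ?_)
  have e : ∀ t : H ⊗[K] M, TensorProduct.equivFinsuppOfBasisRight b t i =
      TensorProduct.rid K H ((b.coord i).lTensor H t) := by
    refine lin_ext ?_ ?_ fun x y => ?_
    · exact ⟨fun _ _ => by simp, fun _ _ => by simp⟩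
    · fun_prop
    · simp
  rw [e, e, h]

theorem linearMap_ext_of_dual {V : Type*} [AddCommGroup V] [Module K V] {f g : V →ₗ[K] M}
    (h : ∀ φ : M →ₗ[K] K, φ ∘ₗ f = φ ∘ₗ g) : f = g := by
  refine LinearMap.ext fun z => ?_
  rw [← sub_eq_zero, ← Module.forall_dual_apply_eq_zero_iff K]
  intro φ
  rw [map_sub, sub_eq_zero]
  exact LinearMap.congr_fun (h φ) z

end Slice

/-! ### Condition (c) and colinearity of m^v -/

namespace PreBialgebra

variable {K H R A M N : Type*} [Field K] [Ring H] [HopfAlgebra K H]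
  [AddCommGroup R] [Module K R] [Coalgebra K R] [Ring A] [Algebra K A]
  [AddCommGroup M] [Module K M] {P : PreBialgebra K H R}

local notation "𝒰" => Algebra.linearMap K

theorem isColinear_iff (μ : R ⊗[K] R →ₗ[K] R) : P.yd₂.IsColinear P.yd μ ↔
    ∀ f : R →ₗ[K] K, P.yd.Psi f ∘ₗ μ = P.yd₂.Psi (f ∘ₗ μ) := by
  refine ⟨fun h f => Psi_comp h f, fun h => LinearMap.ext fun z => ext_of_slice fun f => ?_⟩
  refine (LinearMap.congr_fun (h f) z).trans ?_
  simp only [YDStr.Psi, LinearMap.comp_apply, LinearMap.lTensor_comp, LinearEquiv.coe_coe]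

theorem slice_braid (f : R →ₗ[K] K) (m : R ⊗[K] R →ₗ[K] R) (ξ : R ⊗[K] R →ₗ[K] H)
    (z : R ⊗[K] R) : TensorProduct.rid K H (f.lTensor H
      (braid P.yd.coact (LinearMap.mul' K H) (TensorProduct.map m ξ (P.comul₂ z)))) =
    conv P.comul₂ (P.yd.Psi f ∘ₗ m) ξ z := by
  rw [map_comul_apply, conv_apply]
  simp only [sw_map]
  refine sw_congr fun a b => ?_
  change TensorProduct.rid K H (f.lTensor H ((LinearMap.mul' K H).rTensor R
    (TensorProduct.rightComm K H R H (P.yd.coact (m a) ⊗ₜ[K] ξ b)))) = _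
  rw [LinearMap.comp_apply, Psi_apply, sw_mul]
  refine (lin_eq_sw (L := fun t => TensorProduct.rid K H (f.lTensor H
    ((LinearMap.mul' K H).rTensor R (TensorProduct.rightComm K H R H (t ⊗ₜ[K] ξ b)))))
    (by fun_prop) (P.yd.coact (m a))).trans (sw_congr fun h r => ?_)
  simp

theorem braided_iff_isColinear {v w : R ⊗[K] R →ₗ[K] K}
    (h : IsConvInverse P.comul₂ (counit₂ K R) v w) (m : R ⊗[K] R →ₗ[K] R) :
    braid P.yd.coact (LinearMap.mul' K H) ∘ₗ TensorProduct.map m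
        (conv P.comul₂ (𝒰 H ∘ₗ w) (P.yd₂.Psi v)) ∘ₗ P.comul₂ =
      TensorProduct.map (LinearMap.mul' K H) m ∘ₗ
        P.splitCoact (conv P.comul₂ (𝒰 H ∘ₗ w) (P.yd₂.Psi v)) ↔
    P.yd₂.IsColinear P.yd (convRight P.comul₂ (convLeft P.comul₂ v m) w) := by
  have hX := P.isYDCoalgebra₂
  let := hX.convMonoid H
  have key : ∀ f : R →ₗ[K] K, conv P.comul₂ (P.yd.Psi f ∘ₗ m)
        (conv P.comul₂ (𝒰 H ∘ₗ w) (P.yd₂.Psi v)) =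
      conv P.comul₂ (conv P.comul₂ (𝒰 H ∘ₗ w) (P.yd₂.Psi v)) (P.yd₂.Psi (f ∘ₗ m)) ↔
      P.yd.Psi f ∘ₗ convRight P.comul₂ (convLeft P.comul₂ v m) w =
        P.yd₂.Psi (f ∘ₗ convRight P.comul₂ (convLeft P.comul₂ v m) w) := fun f => by
    rw [comp_convRight, comp_convRight, comp_convLeft, comp_convLeft, convRight_eq_conv,
      convRight_eq_conv, convLeft_eq_conv, convLeft_eq_conv, linearMap_self_comp,
      linearMap_self_comp, hX.Psi_conv, hX.Psi_conv]
    -- The monoid elements are u_H v and u_H w, mutually inverse, and Ψ(v) and Ψ(w), also mutually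
    -- inverse. The twist of Ψ(f)m uses the first pair, that of Ψ(fm) the second.
    refine mul_conj_comm_iff (G := R ⊗[K] R →ₗ[K] H) ?_ ?_ ?_ ?_
    · exact (linearMap_comp_conv v w).symm.trans (by rw [h.1]; rfl)
    · exact (linearMap_comp_conv w v).symm.trans (by rw [h.2]; rfl)
    · exact (hX.Psi_conv v w).symm.trans (by rw [h.1, hX.Psi_counit]; rfl)
    · exact (hX.Psi_conv w v).symm.trans (by rw [h.2, hX.Psi_counit]; rfl)
  rw [isColinear_iff]
  refine Iff.trans ?_ (forall_congr' key)
  refine ⟨fun e f => LinearMap.ext fun z => ?_, fun e => LinearMap.ext fun z =>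
    ext_of_slice fun f => ?_⟩
  · rw [← slice_braid, ← slice_splitCoact]
    exact congrArg (fun t => TensorProduct.rid K H (f.lTensor H t)) (LinearMap.congr_fun e z)
  · simp only [LinearMap.comp_apply]
    rw [slice_braid, slice_splitCoact, e]

end PreBialgebra

/-! ### Inverses on R ⊗ R ⊗ R and expansions of m-composites through μ = m^v -/

namespace PreBialgebra

variable {K H R A M N : Type*} [Field K] [Ring H] [HopfAlgebra K H]
  [AddCommGroup R] [Module K R] [Coalgebra K R] [Ring A] [Algebra K A]
  [AddCommGroup M] [Module K M] {P : PreBialgebra K H R}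

local notation "ε" => Coalgebra.counit (R := K) (A := R)

local notation "𝒰" => Algebra.linearMap K

theorem epsTensor_counit : epsTensor (counit₂ K R) = counit₃ K R := by
  ext r s t
  simp [epsTensor, counit₂, counit₃, tensorForm, mul_assoc]

theorem tensorEps_counit : tensorEps (counit₂ K R) = counit₃ K R := by
  ext r s t
  simp [tensorEps, counit₂, counit₃, tensorForm, mul_comm]

theorem epsTensor_eq (v : R ⊗[K] R →ₗ[K] K) :
    tensorForm Coalgebra.counit v ∘ₗ (TensorProduct.assoc K R R R).toLinearMap = epsTensor v := by
  ext r s t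
  simp [epsTensor, tensorForm]

theorem tensorEps_eq (v : R ⊗[K] R →ₗ[K] K) : tensorForm v Coalgebra.counit = tensorEps v := by
  ext r s t
  simp [tensorEps, tensorForm, mul_comm]

theorem counit₂_comp_idTensor {μ : R ⊗[K] R →ₗ[K] R} (hμ : ε ∘ₗ μ = counit₂ K R) :
    counit₂ K R ∘ₗ idTensor μ = counit₃ K R := by
  rw [← epsTensor_counit]
  refine ext_assoc_symm fun r z => ?_
  rw [LinearMap.comp_apply, idTensor_apply, epsTensor_apply, ← LinearMap.congr_fun hμ z]
  rfl

theorem counit₂_comp_rTensor {μ : R ⊗[K] R →ₗ[K] R} (hμ : ε ∘ₗ μ = counit₂ K R) :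
    counit₂ K R ∘ₗ μ.rTensor R = counit₃ K R := by
  refine TensorProduct.ext' fun z t => ?_
  rw [counit₃, tensorForm_tmul, ← LinearMap.congr_fun hμ z]
  rfl

theorem isConvInverse_comp {n : (R ⊗[K] R) ⊗[K] R →ₗ[K] R ⊗[K] R}
    (hn : P.comul₂ ∘ₗ n = TensorProduct.map n n ∘ₗ P.comul₃)
    (hε : counit₂ K R ∘ₗ n = counit₃ K R) {v w : R ⊗[K] R →ₗ[K] K}
    (h : IsConvInverse P.comul₂ (counit₂ K R) v w) :
    IsConvInverse P.comul₃ (counit₃ K R) (v ∘ₗ n) (w ∘ₗ n) :=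
  ⟨by rw [← conv_comp hn, h.1, hε], by rw [← conv_comp hn, h.2, hε]⟩

theorem isConvInverse_epsTensor {v w : R ⊗[K] R →ₗ[K] K} (hv : P.IsInvariant v)
    (hw : P.IsInvariant w) (h : IsConvInverse P.comul₂ (counit₂ K R) v w) :
    IsConvInverse P.comul₃ (counit₃ K R) (epsTensor v) (epsTensor w) :=
  ⟨(conv_epsTensor_epsTensor hv w).trans ((congrArg epsTensor h.1).trans epsTensor_counit),
    (conv_epsTensor_epsTensor hw v).trans ((congrArg epsTensor h.2).trans epsTensor_counit)⟩

theorem isConvInverse_tensorEps {v w : R ⊗[K] R →ₗ[K] K}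
    (h : IsConvInverse P.comul₂ (counit₂ K R) v w) :
    IsConvInverse P.comul₃ (counit₃ K R) (tensorEps v) (tensorEps w) :=
  ⟨by rw [conv_tensorEps_tensorEps, h.1, tensorEps_counit],
    by rw [conv_tensorEps_tensorEps, h.2, tensorEps_counit]⟩

theorem _root_.YD.IsConvInverse.mul {V : Type*} [AddCommGroup V] [Module K V] {X : YDStr K H V}
    {D : V →ₗ[K] V ⊗[K] V} {e : V →ₗ[K] K} (hX : IsYDCoalgebra X D e) {a a' b b' : V →ₗ[K] K}
    (ha : IsConvInverse D e a a') (hb : IsConvInverse D e b b') :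
    IsConvInverse D e (conv D a b) (conv D b' a') := by
  constructor
  · rw [hX.conv_assoc, ← hX.conv_assoc b, hb.1, hX.counit_conv, ha.1]
  · rw [hX.conv_assoc, ← hX.conv_assoc a', ha.2, hX.counit_conv, hb.2]

/-- Conjugating `m` by `v` and then by `v⁻¹` gives back `m`. -/
theorem conj_conj {v w : R ⊗[K] R →ₗ[K] K}
    (h : IsConvInverse P.comul₂ (counit₂ K R) v w) (m : R ⊗[K] R →ₗ[K] M) :
    convRight P.comul₂ (convLeft P.comul₂ w
      (convRight P.comul₂ (convLeft P.comul₂ v m) w)) v = m := by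
  have hX := P.isYDCoalgebra₂
  rw [← hX.convLeft_convRight, hX.convRight_convRight, h.2, hX.convRight_counit,
    hX.convLeft_convLeft, h.2, hX.counit_convLeft]

theorem Phi_tmul (ξ : R ⊗[K] R →ₗ[K] H) (z : R ⊗[K] R) (t : R) :
    P.yd.Phi P.comul₂ ξ (z ⊗ₜ t) = sw (P.comul₂ z) fun a b => a ⊗ₜ[K] P.yd.act (ξ b) t := by
  change P.yd.actMap.lTensor (R ⊗[K] R) (TensorProduct.assoc K (R ⊗[K] R) H R
    (ξ.lTensor (R ⊗[K] R) (P.comul₂ z) ⊗ₜ[K] t)) = _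
  exact lin_eq_sw (L := fun s => P.yd.actMap.lTensor (R ⊗[K] R)
    (TensorProduct.assoc K (R ⊗[K] R) H R (ξ.lTensor (R ⊗[K] R) s ⊗ₜ[K] t))) (by fun_prop) _

section Twist

variable {v w : R ⊗[K] R →ₗ[K] K} {m μ : R ⊗[K] R →ₗ[K] R}

theorem comp_idTensor_eq (hw : P.IsInvariant w)
    (hm : m = convRight P.comul₂ (convLeft P.comul₂ w μ) v) (φ : R ⊗[K] R →ₗ[K] A) :
    φ ∘ₗ idTensor m = conv P.comul₃ (conv P.comul₃ (𝒰 A ∘ₗ epsTensor w) (φ ∘ₗ idTensor μ))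
      (𝒰 A ∘ₗ epsTensor v) := by
  rw [conv_epsTensor hw, conv_idTensor, ← hm]

/-- The w in ξ = w * Ψ(v) joins m to form m * w = w * μ. The factor Ψ(v) acts on t by z₍₋₁₎v(z₍₀₎),
which is precisely right convolution by v ⊗ ε as in `conv_tensorEps_right`. -/
theorem comp_rTensor_Phi_eq
    (hm : convRight P.comul₂ m w = convLeft P.comul₂ w μ) (φ : R ⊗[K] R →ₗ[K] A) :
    φ ∘ₗ m.rTensor R ∘ₗ P.yd.Phi P.comul₂ (conv P.comul₂ (𝒰 H ∘ₗ w) (P.yd₂.Psi v)) =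
      conv P.comul₃ (conv P.comul₃ (𝒰 A ∘ₗ tensorEps w) (φ ∘ₗ μ.rTensor R))
        (𝒰 A ∘ₗ tensorEps v) := by
  have e : 𝒰 A ∘ₗ tensorEps v = tensorEps (𝒰 A ∘ₗ v) := by
    refine TensorProduct.ext' fun z t => ?_
    simp only [LinearMap.comp_apply, tensorEps_tmul, map_smul]
  rw [conv_tensorEps, ← hm, e, ← convLeft_eq_conv]
  refine TensorProduct.ext' fun z t => ?_
  have hX := P.isYDCoalgebra₂
  rw [conv_tensorEps_right]
  simp (disch := fun_prop) only [LinearMap.comp_apply, Phi_tmul, convLeft_apply, convRight_apply,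
    sw_map, LinearMap.rTensor_tmul, sw_tmul_right, sw_mul]
  simp only [sw_comm (P.yd₂.coact _) (P.comul₂ _)]
  simp (disch := fun_prop) only [hX.coassoc]
  simp only [Psi_apply, sw_apply, sw_map, tmul_sw, smul_sw, map_smul, LinearMap.smul_apply,
    TensorProduct.tmul_smul, ← TensorProduct.smul_tmul', Algebra.linearMap_apply,
    ← Algebra.commutes, ← Algebra.smul_def, smul_comm (w _) (v _)]

end Twist

end PreBialgebra

/-! ### Conditions (d) and (e) as conditions on α(v) -/

namespace PreBialgebra

variable {K H R A M N : Type*} [Field K] [Ring H] [HopfAlgebra K H]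
  [AddCommGroup R] [Module K R] [Coalgebra K R] [Ring A] [Algebra K A]
  [AddCommGroup M] [Module K M] {P : PreBialgebra K H R}

local notation "δ" => Coalgebra.comul (R := K) (A := H)

local notation "ε" => Coalgebra.counit (R := K) (A := R)

local notation "𝒰" => Algebra.linearMap K

theorem cocycle_left_eq (m : R ⊗[K] R →ₗ[K] R) (ξ : R ⊗[K] R →ₗ[K] H) :
    LinearMap.mul' K H ∘ₗ ξ.rTensor H ∘ₗ (TensorProduct.assoc K R R H).symm.toLinearMap ∘ₗ
        (TensorProduct.map m ξ ∘ₗ P.comul₂).lTensor R ∘ₗ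
        (TensorProduct.assoc K R R R).toLinearMap =
      conv P.comul₃ (ξ ∘ₗ idTensor m) (epsTensor ξ) := by
  refine ext_assoc_symm fun r z => ?_
  rw [conv_idTensor_epsTensor]
  simp only [LinearMap.comp_apply, LinearEquiv.coe_coe, LinearEquiv.apply_symm_apply,
    LinearMap.lTensor_tmul, map_comul_apply, tmul_sw, sw_map, TensorProduct.assoc_symm_tmul,
    LinearMap.rTensor_tmul, LinearMap.mul'_apply]

/-- The Sweedler condition rewrites the coproduct of ξ(z⁽²⁾) as ξ(z⁽²⁾)z⁽³⁾₍₋₁₎ ⊗ ξ(z⁽³⁾₍₀₎). The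
inner action of z⁽³⁾₍₋₁₎ on t is then the one created by convolving with ξ ⊗ ε. -/
theorem cocycle_right_eq (m : R ⊗[K] R →ₗ[K] R) {ξ : R ⊗[K] R →ₗ[K] H}
    (hξ : P.IsSweedlerCocycle ξ) :
    LinearMap.mul' K H ∘ₗ ξ.rTensor H ∘ₗ (TensorProduct.assoc K R R H).symm.toLinearMap ∘ₗ
        (braid (Coalgebra.comul (R := K) (A := H)) P.yd.actMap).lTensor R ∘ₗ
        (TensorProduct.assoc K R H R).toLinearMap ∘ₗ
        (TensorProduct.map m ξ ∘ₗ P.comul₂).rTensor R =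
      conv P.comul₃ (ξ ∘ₗ m.rTensor R ∘ₗ P.yd.Phi P.comul₂ ξ) (tensorEps ξ) := by
  have hX := P.isYDCoalgebra₂
  have hb : ∀ (h : H) (t : R), braid (Coalgebra.comul (R := K) (A := H)) P.yd.actMap (h ⊗ₜ t) =
      sw (δ h) fun x y => P.yd.act x t ⊗ₜ[K] y := fun h t =>
    lin_eq_sw (L := fun s => P.yd.actMap.rTensor H (TensorProduct.rightComm K H H R (s ⊗ₜ[K] t)))
      (by fun_prop) (δ h)
  have hd : ∀ z, δ (ξ z) = sw (P.comul₂ z) fun a b => sw (P.yd₂.coact b) fun h b₀ =>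
      (ξ a * h) ⊗ₜ[K] ξ b₀ := fun z =>
    (LinearMap.congr_fun hξ.comul_comp z).trans (map_splitCoact_apply ..)
  refine TensorProduct.ext' fun z t => ?_
  rw [conv_tensorEps_right]
  simp (disch := fun_prop) only [LinearMap.comp_apply, LinearEquiv.coe_coe,
    LinearMap.lTensor_tmul, map_comul_apply, sw_tmul_right, tmul_sw, sw_map,
    TensorProduct.assoc_symm_tmul, TensorProduct.assoc_tmul,
    LinearMap.rTensor_tmul, LinearMap.mul'_apply, hb, hd, sw_sw, sw_tmul, Phi_tmul, sw_mul]
  simp only [sw_comm (P.yd₂.coact _) (P.comul₂ _)]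
  simp (disch := fun_prop) only [hX.coassoc, map_mul, Module.End.mul_apply]

section Twist

variable {v w : R ⊗[K] R →ₗ[K] K} {m μ : R ⊗[K] R →ₗ[K] R}

variable (P) in
/-- The data of a form `v` with inverse `w`, conjugating `m` to `μ`. -/
structure TwistData (v w : R ⊗[K] R →ₗ[K] K) (m μ : R ⊗[K] R →ₗ[K] R) : Prop where
  inv : IsConvInverse P.comul₂ (counit₂ K R) v w
  invariant : P.IsInvariant v
  conj : μ = convRight P.comul₂ (convLeft P.comul₂ v m) w
  linear : P.yd₂.IsLinear P.yd μ
  coalgebraMap : P.IsCoalgebraMap μ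
  counit : ε ∘ₗ μ = counit₂ K R
  colinear : P.yd₂.IsColinear P.yd μ

namespace TwistData

variable (T : P.TwistData v w m μ)

include T

theorem conj' : m = convRight P.comul₂ (convLeft P.comul₂ w μ) v := by
  rw [T.conj, conj_conj T.inv]

theorem convRight_eq : convRight P.comul₂ m w = convLeft P.comul₂ w μ := by
  have hX := P.isYDCoalgebra₂
  conv_lhs => rw [T.conj']
  rw [hX.convRight_convRight, T.inv.1, hX.convRight_counit]

theorem inverse_idTensor : IsConvInverse P.comul₃ (counit₃ K R)
    (conv P.comul₃ (v ∘ₗ idTensor μ) (epsTensor v))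
    (conv P.comul₃ (epsTensor w) (w ∘ₗ idTensor μ)) :=
  (isConvInverse_comp (T.coalgebraMap.idTensor T.linear) (counit₂_comp_idTensor T.counit)
    T.inv).mul P.isYDCoalgebra₃
    (isConvInverse_epsTensor T.invariant (T.invariant.inverse T.inv) T.inv)

theorem inverse_rTensor : IsConvInverse P.comul₃ (counit₃ K R)
    (conv P.comul₃ (tensorEps w) (w ∘ₗ μ.rTensor R))
    (conv P.comul₃ (v ∘ₗ μ.rTensor R) (tensorEps v)) :=
  (isConvInverse_tensorEps T.inv.symm).mul P.isYDCoalgebra₃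
    (isConvInverse_comp (T.coalgebraMap.rTensor T.colinear) (counit₂_comp_rTensor T.counit)
      T.inv.symm)

/-- Tested on f, both sides are conjugates: with a and b the factors of α, they read a⁻¹ * fμ(R ⊗ μ)
* a and b * fμ(μ ⊗ R) * b⁻¹. Equality is therefore intertwining by a * b. -/
theorem assoc_iff : m ∘ₗ idTensor m = m ∘ₗ m.rTensor R ∘ₗ
      P.yd.Phi P.comul₂ (conv P.comul₂ (𝒰 H ∘ₗ w) (P.yd₂.Psi v)) ↔
    convRight P.comul₃ (μ ∘ₗ idTensor μ) (conv P.comul₃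
      (conv P.comul₃ (v ∘ₗ idTensor μ) (epsTensor v))
      (conv P.comul₃ (tensorEps w) (w ∘ₗ μ.rTensor R))) =
    convLeft P.comul₃ (conv P.comul₃
      (conv P.comul₃ (v ∘ₗ idTensor μ) (epsTensor v))
      (conv P.comul₃ (tensorEps w) (w ∘ₗ μ.rTensor R))) (μ ∘ₗ μ.rTensor R) := by
  have hT := P.isYDCoalgebra₃
  let := hT.convMonoid K
  have hi := T.coalgebraMap.idTensor T.linear
  have hr := T.coalgebraMap.rTensor T.colinear
  have key : ∀ f : R →ₗ[K] K, f ∘ₗ m ∘ₗ idTensor m = f ∘ₗ m ∘ₗ m.rTensor R ∘ₗ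
      P.yd.Phi P.comul₂ (conv P.comul₂ (𝒰 H ∘ₗ w) (P.yd₂.Psi v)) ↔
      f ∘ₗ convRight P.comul₃ (μ ∘ₗ idTensor μ) (conv P.comul₃
        (conv P.comul₃ (v ∘ₗ idTensor μ) (epsTensor v))
        (conv P.comul₃ (tensorEps w) (w ∘ₗ μ.rTensor R))) =
      f ∘ₗ convLeft P.comul₃ (conv P.comul₃
        (conv P.comul₃ (v ∘ₗ idTensor μ) (epsTensor v))
        (conv P.comul₃ (tensorEps w) (w ∘ₗ μ.rTensor R))) (μ ∘ₗ μ.rTensor R) := fun f => by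
    have hf : f ∘ₗ m = conv P.comul₂ (conv P.comul₂ w (f ∘ₗ μ)) v := by
      conv_lhs => rw [T.conj']
      rw [comp_convRight, comp_convLeft, convRight_eq_conv, convLeft_eq_conv,
        linearMap_self_comp, linearMap_self_comp]
    rw [← LinearMap.comp_assoc, ← LinearMap.comp_assoc (m.rTensor R ∘ₗ _) m f,
      comp_idTensor_eq (T.invariant.inverse T.inv) T.conj' (f ∘ₗ m),
      comp_rTensor_Phi_eq T.convRight_eq (f ∘ₗ m), hf, conv_comp hi, conv_comp hi,
      conv_comp hr, conv_comp hr, comp_convRight, comp_convLeft, convRight_eq_conv,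
      convLeft_eq_conv]
    simp only [linearMap_self_comp, LinearMap.comp_assoc]
    refine Iff.trans ?_ (conj_eq_conj_iff (G := (R ⊗[K] R) ⊗[K] R →ₗ[K] K) T.inverse_idTensor.1
      T.inverse_idTensor.2 T.inverse_rTensor.1 T.inverse_rTensor.2)
    refine iff_of_eq (congrArg₂ _ ?_ ?_)
    · change _ = conv P.comul₃ (conv P.comul₃ _ _) _
      simp only [hT.conv_assoc]
    · change _ = conv P.comul₃ (conv P.comul₃ _ _) _
      simp only [hT.conv_assoc]
  exact ⟨fun h => linearMap_ext_of_dual fun f => (key f).1 (congrArg (f ∘ₗ ·) h),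
    fun h => linearMap_ext_of_dual fun f => (key f).2 (congrArg (f ∘ₗ ·) h)⟩

/-- Expanding ξ = w * Ψ(v), the adjacent pair (ε ⊗ v) * (ε ⊗ w) cancels on the left side and (v ⊗ ε)
* (w ⊗ ε) on the right. The equation becomes a⁻¹ * Ψ(a) = b * Ψ(b⁻¹), that is Ψ(a * b) = a * b,
where colinearity of μ lets Ψ pass through R ⊗ μ and μ ⊗ R. -/
theorem cocycle_iff :
    conv P.comul₃ (conv P.comul₂ (𝒰 H ∘ₗ w) (P.yd₂.Psi v) ∘ₗ idTensor m)
        (epsTensor (conv P.comul₂ (𝒰 H ∘ₗ w) (P.yd₂.Psi v))) =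
      conv P.comul₃ (conv P.comul₂ (𝒰 H ∘ₗ w) (P.yd₂.Psi v) ∘ₗ m.rTensor R ∘ₗ
        P.yd.Phi P.comul₂ (conv P.comul₂ (𝒰 H ∘ₗ w) (P.yd₂.Psi v)))
        (tensorEps (conv P.comul₂ (𝒰 H ∘ₗ w) (P.yd₂.Psi v))) ↔
    P.yd₃.Psi (conv P.comul₃
        (conv P.comul₃ (v ∘ₗ idTensor μ) (epsTensor v))
        (conv P.comul₃ (tensorEps w) (w ∘ₗ μ.rTensor R))) =
      𝒰 H ∘ₗ conv P.comul₃ (conv P.comul₃ (v ∘ₗ idTensor μ) (epsTensor v))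
        (conv P.comul₃ (tensorEps w) (w ∘ₗ μ.rTensor R)) := by
  have hT := P.isYDCoalgebra₃
  let := hT.convMonoid H
  have hi := T.coalgebraMap.idTensor T.linear
  have hr := T.coalgebraMap.rTensor T.colinear
  have hw := T.invariant.inverse T.inv
  have hU : ∀ {a a' : (R ⊗[K] R) ⊗[K] R →ₗ[K] K}, conv P.comul₃ a a' = counit₃ K R →
      conv P.comul₃ (𝒰 H ∘ₗ a) (𝒰 H ∘ₗ a') = 𝒰 H ∘ₗ counit₃ K R := fun h => by
    rw [← linearMap_comp_conv, h]
  have hΨ : ∀ {a a' : (R ⊗[K] R) ⊗[K] R →ₗ[K] K}, conv P.comul₃ a a' = counit₃ K R →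
      conv P.comul₃ (P.yd₃.Psi a) (P.yd₃.Psi a') = 𝒰 H ∘ₗ counit₃ K R := fun h => by
    rw [← hT.Psi_conv, h, hT.Psi_counit]
  rw [comp_idTensor_eq hw T.conj', comp_rTensor_Phi_eq T.convRight_eq, conv_comp hi, conv_comp hr,
    ← conv_epsTensor_epsTensor hw, ← conv_tensorEps_tensorEps,
    Psi_comp (idTensor_colinear T.colinear), Psi_comp (rTensor_colinear T.colinear),
    ← Psi_epsTensor, ← Psi_tensorEps, LinearMap.comp_assoc, LinearMap.comp_assoc]
  have e : tensorEps (𝒰 H ∘ₗ w) = 𝒰 H ∘ₗ tensorEps w := by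
    refine TensorProduct.ext' fun z t => ?_
    simp only [LinearMap.comp_apply, tensorEps_tmul, map_smul]
  rw [e, hT.Psi_conv, linearMap_comp_conv]
  refine Iff.trans ?_ (inv_mul_eq_mul_inv_iff (G := (R ⊗[K] R) ⊗[K] R →ₗ[K] H)
    (hU T.inverse_idTensor.1) (hU T.inverse_idTensor.2) (hΨ T.inverse_rTensor.1)
    (hΨ T.inverse_rTensor.2))
  have hv₁ := hU (isConvInverse_epsTensor T.invariant hw T.inv).1
  have hv₂ := hU (isConvInverse_tensorEps (P := P) T.inv).1
  refine iff_of_eq (congrArg₂ _ ?_ ?_)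
  · change _ = conv P.comul₃ _ _
    rw [linearMap_comp_conv, hT.Psi_conv]
    simp only [hT.conv_assoc]
    rw [← hT.conv_assoc (𝒰 H ∘ₗ epsTensor v), hv₁, hT.unit_conv]
  · change _ = conv P.comul₃ _ _
    rw [linearMap_comp_conv, hT.Psi_conv]
    simp only [hT.conv_assoc]
    rw [← hT.conv_assoc (𝒰 H ∘ₗ tensorEps v), hv₂, hT.unit_conv]

end TwistData

end Twist

end PreBialgebra

/-! ### Nilpotency of a largest proper two-sided ideal -/

section Artinian

variable {B : Type*} [Ring B]

/-- In a left Artinian ring, a two-sided ideal containing all proper two-sided ideals is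
nilpotent. -/
theorem isNilpotent_of_forall_isTwoSided_le [IsArtinianRing B] {I : Ideal B} [I.IsTwoSided]
    (hI : I ≠ ⊤) (h : ∀ J : Ideal B, J.IsTwoSided → J ≠ ⊤ → J ≤ I) : IsNilpotent I := by
  obtain ⟨n, hn⟩ := IsSemiprimaryRing.isNilpotent (R := B)
  suffices hJ : I ≤ Ring.jacobson B from ⟨n, le_bot_iff.1 ((Ideal.pow_right_mono hJ n).trans hn.le)⟩
  -- The elements b with I b inside the Jacobson radical J. If 𝔟 is proper, then J and 𝔟 both lie in
  -- I. A complement N of I/J in the semisimple ring B/J satisfies (I/J)N = 0, so it comes from 𝔟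
  -- and lies in I/J, which forces I = B.
  let 𝔟 : Ideal B :=
    { carrier := {b | ∀ i ∈ I, i * b ∈ Ring.jacobson B}
      add_mem' := fun ha hb i hi => by rw [mul_add]; exact add_mem (ha i hi) (hb i hi)
      zero_mem' := fun i _ => by rw [mul_zero]; exact zero_mem _
      smul_mem' := fun c b hb i hi => by
        rw [smul_eq_mul, ← mul_assoc]; exact hb _ (I.mul_mem_right c hi) }
  have h𝔟 : 𝔟.IsTwoSided := ⟨fun c hb i hi => by
    rw [← mul_assoc]; exact Ideal.mul_mem_right c _ (hb i hi)⟩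
  by_cases htop : 𝔟 = ⊤
  · intro i hi
    have : (1 : B) ∈ 𝔟 := htop ▸ Submodule.mem_top
    simpa using this i hi
  · exfalso
    have hJI : Ring.jacobson B ≤ I := by
      refine h _ inferInstance fun e => hI ?_
      rw [e, Ideal.top_pow] at hn
      exact top_le_iff.1 (hn.trans_le bot_le)
    let q := Ideal.Quotient.mk (Ring.jacobson B)
    obtain ⟨N, hN⟩ := exists_isCompl (I.map q)
    have hNI : N ≤ I.map q := fun y hy => by
      obtain ⟨n, rfl⟩ := Ideal.Quotient.mk_surjective y
      refine Ideal.mem_map_of_mem q (h 𝔟 h𝔟 htop fun i hi => ?_)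
      have h₀ : q (i * n) ∈ I.map q ⊓ N :=
        ⟨Ideal.mem_map_of_mem q (I.mul_mem_right n hi), by
          rw [map_mul]; exact N.mul_mem_left _ hy⟩
      rw [hN.inf_eq_bot] at h₀
      exact Ideal.Quotient.eq_zero_iff_mem.1 h₀
    have e := hN.sup_eq_top
    rw [sup_eq_left.2 hNI] at e
    exact hI (by rw [← Ideal.comap_map_mk hJI, e, Ideal.comap_top])

end Artinian

/-! ### The dual algebra and conilpotency of connected coalgebras -/

section Subcoalgebra

variable {K C : Type*} [Field K] [AddCommGroup C] [Module K C]

variable (K C) in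
/-- The convolution algebra dual to the coalgebra `C`. -/
abbrev DualAlgebra := WithConv (C →ₗ[K] K)

theorem eq_of_dualAlgebra {x y : C} (h : ∀ g : DualAlgebra K C, g.ofConv x = g.ofConv y) :
    x = y := by
  rw [← sub_eq_zero, ← Module.forall_dual_apply_eq_zero_iff K]
  intro φ
  rw [map_sub, sub_eq_zero]
  exact h (.toConv φ)

/-- A linear retraction onto E, applied to either leg of t, changes nothing, because the slices of t
already lie in E. -/
theorem mem_range_map_subtype {E : Submodule K C} {t : C ⊗[K] C}
    (h₁ : ∀ f : C →ₗ[K] K, TensorProduct.rid K C (f.lTensor C t) ∈ E)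
    (h₂ : ∀ f : C →ₗ[K] K, TensorProduct.lid K C (f.rTensor C t) ∈ E) :
    t ∈ LinearMap.range (TensorProduct.map E.subtype E.subtype) := by
  obtain ⟨g, hg⟩ := E.subtype.exists_leftInverse_of_injective E.ker_subtype
  have hg' : ∀ x ∈ E, E.subtype (g x) = x := fun x hx =>
    congrArg E.subtype (LinearMap.congr_fun hg ⟨x, hx⟩)
  have e₁ : (E.subtype ∘ₗ g).rTensor C t = t := ext_of_slice fun f => by
    rw [← hg' _ (h₁ f)]
    exact lin_ext
      (f := fun t => TensorProduct.rid K C (f.lTensor C ((E.subtype ∘ₗ g).rTensor C t)))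
      (g := fun t => E.subtype (g (TensorProduct.rid K C (f.lTensor C t))))
      (by fun_prop) (by fun_prop) (fun a b => by simp) t
  have e₂ : (E.subtype ∘ₗ g).lTensor C t = t := by
    refine (TensorProduct.comm K C C).injective (ext_of_slice fun f => ?_)
    have e : ∀ t, TensorProduct.rid K C (f.lTensor C (TensorProduct.comm K C C t)) =
        TensorProduct.lid K C (f.rTensor C t) :=
      lin_ext (by fun_prop) (by fun_prop) fun a b => by simp
    rw [e, e, ← hg' _ (h₂ f)]
    exact lin_ext
      (f := fun t => TensorProduct.lid K C (f.rTensor C ((E.subtype ∘ₗ g).lTensor C t)))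
      (g := fun t => E.subtype (g (TensorProduct.lid K C (f.rTensor C t))))
      (by fun_prop) (by fun_prop) (fun a b => by simp) t
  refine ⟨TensorProduct.map g g t, ?_⟩
  rw [← LinearMap.comp_apply, ← TensorProduct.map_comp]
  nth_rw 2 [← e₁, ← e₂]
  exact lin_ext (f := fun t => TensorProduct.map (E.subtype ∘ₗ g) (E.subtype ∘ₗ g) t)
    (g := fun t => (E.subtype ∘ₗ g).rTensor C ((E.subtype ∘ₗ g).lTensor C t))
    (by fun_prop) (by fun_prop) (fun a b => by simp) t

variable [Coalgebra K C]

local notation "Δ" => Coalgebra.comul (R := K) (A := C)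

/-- The left action `f ⇀ x = x⁽¹⁾ f(x⁽²⁾)` of the dual algebra. -/
def hitLeft (f : DualAlgebra K C) : C →ₗ[K] C := convRight Δ LinearMap.id f.ofConv

/-- The right action `x ↼ f = f(x⁽¹⁾) x⁽²⁾` of the dual algebra. -/
def hitRight (f : DualAlgebra K C) : C →ₗ[K] C := convLeft Δ f.ofConv LinearMap.id

theorem apply_hitLeft (g f : DualAlgebra K C) (x : C) :
    g.ofConv (hitLeft f x) = (g * f).ofConv x := by
  rw [hitLeft, ← LinearMap.comp_apply, comp_convRight, convRight_eq_conv, linearMap_self_comp]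
  rfl

theorem apply_hitRight (g f : DualAlgebra K C) (x : C) :
    g.ofConv (hitRight f x) = (f * g).ofConv x := by
  rw [hitRight, ← LinearMap.comp_apply, comp_convLeft, convLeft_eq_conv, linearMap_self_comp]
  rfl

theorem hitLeft_hitLeft (f g : DualAlgebra K C) (x : C) :
    hitLeft f (hitLeft g x) = hitLeft (f * g) x :=
  eq_of_dualAlgebra fun a => by
    rw [apply_hitLeft, apply_hitLeft, apply_hitLeft, mul_assoc]

theorem hitRight_hitRight (f g : DualAlgebra K C) (x : C) :
    hitRight f (hitRight g x) = hitRight (g * f) x :=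
  eq_of_dualAlgebra fun a => by
    rw [apply_hitRight, apply_hitRight, apply_hitRight, mul_assoc]

theorem hitRight_hitLeft (f g : DualAlgebra K C) (x : C) :
    hitRight f (hitLeft g x) = hitLeft g (hitRight f x) :=
  eq_of_dualAlgebra fun a => by
    rw [apply_hitRight, apply_hitLeft, apply_hitLeft, apply_hitRight, mul_assoc]

theorem hitLeft_one (x : C) : hitLeft (1 : DualAlgebra K C) x = x :=
  eq_of_dualAlgebra fun a => by rw [apply_hitLeft, mul_one]

theorem hitRight_one (x : C) : hitRight (1 : DualAlgebra K C) x = x :=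
  eq_of_dualAlgebra fun a => by rw [apply_hitRight, one_mul]

theorem hitLeft_apply (f : DualAlgebra K C) (x : C) :
    hitLeft f x = sw (Δ x) fun a b => f.ofConv b • a := convRight_apply ..

theorem hitRight_apply (f : DualAlgebra K C) (x : C) :
    hitRight f x = sw (Δ x) fun a b => f.ofConv a • b := convLeft_apply ..

/-- Subcoalgebras are the sub-bimodules of C over its dual algebra, which brings ideal theory to
bear on them. -/
theorem isSubcoalgebra_iff {E : Submodule K C} : IsSubcoalgebra E ↔
    ∀ f : DualAlgebra K C, ∀ x ∈ E, hitLeft f x ∈ E ∧ hitRight f x ∈ E := by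
  constructor
  · intro h f x hx
    obtain ⟨s, hs⟩ := h x hx
    constructor
    · change TensorProduct.rid K C (TensorProduct.map LinearMap.id f.ofConv (Δ x)) ∈ E
      rw [← hs]
      have := lin_ext (f := fun s => TensorProduct.rid K C (TensorProduct.map LinearMap.id f.ofConv
          (TensorProduct.map E.subtype E.subtype s)))
        (g := fun s => E.subtype (TensorProduct.rid K E ((f.ofConv ∘ₗ E.subtype).lTensor E s)))
        (by fun_prop) (by fun_prop) (fun a b => by simp) s
      rw [this]
      exact Subtype.prop _
    · change TensorProduct.lid K C (TensorProduct.map f.ofConv LinearMap.id (Δ x)) ∈ E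
      rw [← hs]
      have := lin_ext (f := fun s => TensorProduct.lid K C (TensorProduct.map f.ofConv LinearMap.id
          (TensorProduct.map E.subtype E.subtype s)))
        (g := fun s => E.subtype (TensorProduct.lid K E ((f.ofConv ∘ₗ E.subtype).rTensor E s)))
        (by fun_prop) (by fun_prop) (fun a b => by simp) s
      rw [this]
      exact Subtype.prop _
  · exact fun h x hx => mem_range_map_subtype (fun f => (h (.toConv f) x hx).1)
      fun f => (h (.toConv f) x hx).2

/-- Every element lies in a finite-dimensional subcoalgebra. -/
theorem exists_isSubcoalgebra_mem (x : C) :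
    ∃ E : Submodule K C, IsSubcoalgebra E ∧ FiniteDimensional K E ∧ x ∈ E := by
  classical
  let S : Set C := {y | ∃ f g : DualAlgebra K C, hitLeft f (hitRight g x) = y}
  refine ⟨Submodule.span K S, isSubcoalgebra_iff.2 fun a y hy => ?_, ?_,
    Submodule.subset_span ⟨1, 1, by rw [hitRight_one, hitLeft_one]⟩⟩
  · induction hy using Submodule.span_induction with
    | mem y hy =>
      obtain ⟨f, g, rfl⟩ := hy
      exact ⟨Submodule.subset_span ⟨a * f, g, (hitLeft_hitLeft ..).symm⟩,
        Submodule.subset_span ⟨f, g * a, by rw [hitRight_hitLeft, hitRight_hitRight]⟩⟩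
    | zero => simp
    | add y z _ _ hy hz =>
      simp only [map_add]
      exact ⟨add_mem hy.1 hz.1, add_mem hy.2 hz.2⟩
    | smul c y _ hy =>
      simp only [map_smul]
      exact ⟨Submodule.smul_mem _ c hy.1, Submodule.smul_mem _ c hy.2⟩
  · let s (y : C) : Finset (C × C) := (TensorProduct.exists_finset (Δ y)).choose
    let T : Finset C := (s x).biUnion fun p => (s p.2).image Prod.fst
    refine Submodule.finiteDimensional_of_le (S₂ := Submodule.span K (T : Set C))
      (Submodule.span_le.2 ?_)
    rintro _ ⟨f, g, rfl⟩
    rw [hitRight_apply, sw_map]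
    refine Submodule.sum_mem _ fun p hp => ?_
    beta_reduce
    rw [map_smul, hitLeft_apply]
    refine Submodule.smul_mem _ _ (Submodule.sum_mem _ fun p' hp' => Submodule.smul_mem _ _ ?_)
    exact Submodule.subset_span (Finset.mem_coe.2 (Finset.mem_biUnion.2
      ⟨p, hp, Finset.mem_image_of_mem _ hp'⟩))

/-- A nonzero finite-dimensional subcoalgebra contains a simple one. -/
theorem exists_isSimpleSubcoalgebra_le {E : Submodule K C} (hE : IsSubcoalgebra E) (h₀ : E ≠ ⊥)
    [FiniteDimensional K E] : ∃ D ≤ E, IsSimpleSubcoalgebra D := by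
  induction h : Module.finrank K E using Nat.strong_induction_on generalizing E with
  | _ n ih =>
    by_cases hs : ∀ D : Submodule K C, IsSubcoalgebra D → D ≤ E → D = ⊥ ∨ D = E
    · exact ⟨E, le_rfl, hE, h₀, hs⟩
    · push Not at hs
      obtain ⟨D, hD, hle, hD₀, hne⟩ := hs
      have := Submodule.finiteDimensional_of_le hle
      obtain ⟨D', hD', hs⟩ := ih _ (h ▸ Submodule.finrank_lt_finrank_of_lt (lt_of_le_of_ne hle hne))
        hD hD₀ rfl
      exact ⟨D', hD'.trans hle, hs⟩

theorem IsSubcoalgebra.mem_of_coradical_eq {o : C} (hC : coradical K C = K ∙ o) {E : Submodule K C}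
    (hE : IsSubcoalgebra E) (h₀ : E ≠ ⊥) [FiniteDimensional K E] : o ∈ E := by
  obtain ⟨D, hDE, hD⟩ := exists_isSimpleSubcoalgebra_le hE h₀
  obtain ⟨d, hd, hd₀⟩ := Submodule.exists_mem_ne_zero_of_ne_bot hD.2.1
  have hle : D ≤ K ∙ o := hC ▸ le_sSup hD
  obtain ⟨c, rfl⟩ := Submodule.mem_span_singleton.1 (hle hd)
  have hc : c ≠ 0 := fun e => hd₀ (by rw [e, zero_smul])
  exact hDE ((D.smul_mem_iff hc).1 hd)

/-- The annihilator F of 𝔞 in E is a subcoalgebra. If F = 0, finite-dimensional duality shows that 𝔞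
restricts onto all of E*, hence contains 1 modulo the annihilator of E, contradicting properness. So
F is nonzero and contains o. -/
theorem apply_eq_zero_of_mem_ideal {o : C} (hC : coradical K C = K ∙ o) {E : Submodule K C}
    (hE : IsSubcoalgebra E) [FiniteDimensional K E] {𝔞 : Ideal (DualAlgebra K C)} [𝔞.IsTwoSided]
    (h : ∀ f : DualAlgebra K C, (∀ x ∈ E, f.ofConv x = 0) → f ∈ 𝔞) (h𝔞 : 𝔞 ≠ ⊤)
    {f : DualAlgebra K C} (hf : f ∈ 𝔞) : f.ofConv o = 0 := by
  let F : Submodule K C :=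
    { carrier := {x | x ∈ E ∧ ∀ f ∈ 𝔞, f.ofConv x = 0}
      add_mem' := fun ha hb => ⟨add_mem ha.1 hb.1, fun f hf => by
        rw [map_add, ha.2 f hf, hb.2 f hf, add_zero]⟩
      zero_mem' := ⟨zero_mem _, fun f _ => map_zero _⟩
      smul_mem' := fun c x hx => ⟨E.smul_mem c hx.1, fun f hf => by
        rw [map_smul, hx.2 f hf, smul_zero]⟩ }
  have hFE : F ≤ E := fun x hx => hx.1
  have hF : IsSubcoalgebra F := isSubcoalgebra_iff.2 fun g x hx =>
    ⟨⟨(isSubcoalgebra_iff.1 hE g x hx.1).1, fun f hf => by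
      rw [apply_hitLeft]; exact hx.2 _ (𝔞.mul_mem_right g hf)⟩,
    ⟨(isSubcoalgebra_iff.1 hE g x hx.1).2, fun f hf => by
      rw [apply_hitRight]; exact hx.2 _ (𝔞.mul_mem_left g hf)⟩⟩
  have := Submodule.finiteDimensional_of_le hFE
  suffices h₀ : F ≠ ⊥ from (hF.mem_of_coradical_eq hC h₀).2 f hf
  intro h₀
  let Φ : Submodule K (Module.Dual K E) :=
    { carrier := {φ | ∃ f ∈ 𝔞, f.ofConv ∘ₗ E.subtype = φ}
      add_mem' := by
        rintro _ _ ⟨f, hf, rfl⟩ ⟨g, hg, rfl⟩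
        exact ⟨f + g, add_mem hf hg, rfl⟩
      zero_mem' := ⟨0, zero_mem _, rfl⟩
      smul_mem' := by
        rintro c _ ⟨f, hf, rfl⟩
        exact ⟨c • f, Submodule.smul_of_tower_mem 𝔞 c hf, rfl⟩ }
  have hΦ : Φ.dualCoannihilator = ⊥ := by
    refine (Submodule.eq_bot_iff _).2 fun x hx => ?_
    have hx' : (x : C) ∈ F := ⟨x.2, fun f hf =>
      (Submodule.mem_dualCoannihilator x).1 hx _ ⟨f, hf, rfl⟩⟩
    rw [h₀] at hx'
    exact Subtype.ext hx'
  have hΦ' : Φ = ⊤ := by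
    rw [← Subspace.dualCoannihilator_dualAnnihilator_eq (W := Φ), hΦ,
      Submodule.dualAnnihilator_bot]
  obtain ⟨g, hg, e⟩ : (1 : DualAlgebra K C).ofConv ∘ₗ E.subtype ∈ Φ := hΦ' ▸ Submodule.mem_top
  refine h𝔞 ((Ideal.eq_top_iff_one _).2 ?_)
  rw [← sub_add_cancel 1 g]
  refine add_mem (h _ fun x hx => ?_) hg
  exact sub_eq_zero.2 (LinearMap.congr_fun e ⟨x, hx⟩).symm

theorem mul_apply_of_comul_eq {o : C} (ho : Δ o = o ⊗ₜ[K] o) (f g : DualAlgebra K C) :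
    (f * g).ofConv o = f.ofConv o * g.ofConv o := by
  change conv Δ f.ofConv g.ofConv o = _
  rw [conv_apply, ho, sw_tmul _ _ _ (by fun_prop) (by fun_prop)]

/-- The filtration of `C` by the annihilators of the powers of the ideal `{f | f(o) = 0}` of the
dual algebra. -/
def conilFiltration (o : C) : ℕ → Submodule K C
  | 0 => ⊥
  | n + 1 =>
    { carrier := {x | ∀ f : DualAlgebra K C, f.ofConv o = 0 → hitLeft f x ∈ conilFiltration o n}
      add_mem' := fun ha hb f hf => by rw [map_add]; exact add_mem (ha f hf) (hb f hf)
      zero_mem' := fun f _ => by rw [map_zero]; exact zero_mem _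
      smul_mem' := fun c x hx f hf => by
        rw [map_smul]; exact Submodule.smul_mem _ c (hx f hf) }

theorem finite_quotient {E : Submodule K C} [FiniteDimensional K E]
    {𝔫 : Ideal (DualAlgebra K C)} [𝔫.IsTwoSided]
    (h : ∀ f : DualAlgebra K C, (∀ x ∈ E, f.ofConv x = 0) → f ∈ 𝔫) :
    Module.Finite K (DualAlgebra K C ⧸ 𝔫) := by
  obtain ⟨g, hg⟩ := E.subtype.exists_leftInverse_of_injective E.ker_subtype
  let L : Module.Dual K E →ₗ[K] DualAlgebra K C ⧸ 𝔫 :=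
    { toFun := fun φ => Ideal.Quotient.mk 𝔫 (.toConv (φ ∘ₗ g))
      map_add' := fun _ _ => rfl
      map_smul' := fun _ _ => rfl }
  refine Module.Finite.of_surjective L fun y => ?_
  obtain ⟨f, rfl⟩ := Ideal.Quotient.mk_surjective y
  refine ⟨f.ofConv ∘ₗ E.subtype, Ideal.Quotient.eq.2 (h _ fun x hx => sub_eq_zero.2 ?_)⟩
  exact congrArg f.ofConv (congrArg E.subtype (LinearMap.congr_fun hg ⟨x, hx⟩))

/-- A connected coalgebra is conilpotent. -/
theorem exists_mem_conilFiltration {o : C} (hC : coradical K C = K ∙ o) (ho : Δ o = o ⊗ₜ[K] o)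
    (h₁ : Coalgebra.counit (R := K) o = 1) (x : C) : ∃ n, x ∈ conilFiltration (K := K) o n := by
  obtain ⟨E, hE, hfin, hx⟩ := exists_isSubcoalgebra_mem (K := K) x
  let 𝔫 : Ideal (DualAlgebra K C) :=
    { carrier := {f | ∀ x ∈ E, f.ofConv x = 0}
      add_mem' := fun ha hb x hx => by
        rw [WithConv.ofConv_add, LinearMap.add_apply, ha x hx, hb x hx, add_zero]
      zero_mem' := fun x _ => rfl
      smul_mem' := fun c f hf x hx => by
        rw [smul_eq_mul, ← apply_hitRight]
        exact hf _ (isSubcoalgebra_iff.1 hE c x hx).2 }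
  have h𝔫 : 𝔫.IsTwoSided := ⟨fun c hf x hx => by
    rw [← apply_hitLeft]; exact hf _ (isSubcoalgebra_iff.1 hE c x hx).1⟩
  let I : Ideal (DualAlgebra K C) :=
    { carrier := {f | f.ofConv o = 0}
      add_mem' := fun {a b} (ha : a.ofConv o = 0) (hb : b.ofConv o = 0) => show (a + b).ofConv o = 0 by
        rw [WithConv.ofConv_add, LinearMap.add_apply, ha, hb, add_zero]
      zero_mem' := rfl
      smul_mem' := fun c f (hf : f.ofConv o = 0) => show (c * f).ofConv o = 0 by
        rw [mul_apply_of_comul_eq ho, hf, mul_zero] }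
  have hI : I.IsTwoSided := ⟨fun {f} c (hf : f.ofConv o = 0) => show (f * c).ofConv o = 0 by
    rw [mul_apply_of_comul_eq ho, hf, zero_mul]⟩
  have hI₁ : I ≠ ⊤ := fun e => by
    have : (1 : DualAlgebra K C) ∈ I := e ▸ Submodule.mem_top
    exact one_ne_zero (h₁.symm.trans this)
  let q := Ideal.Quotient.mk 𝔫
  -- Modulo the annihilator 𝔫 of E, the augmentation ideal I contains every proper two-sided ideal.
  -- The quotient is finite-dimensional, hence Artinian, so the image of I there is nilpotent.
  have hle : ∀ J : Ideal (DualAlgebra K C), J.IsTwoSided → J ≠ ⊤ → 𝔫 ≤ J → J ≤ I :=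
    fun J _ hJ hn f hf => apply_eq_zero_of_mem_ideal hC hE (fun g hg => hn hg) hJ hf
  obtain ⟨n, hn⟩ : ∃ n, ∀ a, q a ∈ I.map q ^ n → a ∈ 𝔫 := by
    by_cases htop : 𝔫 = ⊤
    · exact ⟨0, fun a _ => htop ▸ Submodule.mem_top⟩
    have h𝔫I : 𝔫 ≤ I := hle 𝔫 h𝔫 htop le_rfl
    have hfin : Module.Finite K (DualAlgebra K C ⧸ 𝔫) := finite_quotient fun f hf => hf
    have hart : IsArtinianRing (DualAlgebra K C ⧸ 𝔫) := IsArtinianRing.of_finite K _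
    have hI' : (I.map q).IsTwoSided := inferInstance
    obtain ⟨n, hn⟩ := isNilpotent_of_forall_isTwoSided_le (I := I.map q)
      (fun e => hI₁ (by rw [← Ideal.comap_map_mk h𝔫I, e, Ideal.comap_top])) fun J hJ hJ₁ => by
        rw [← Ideal.map_comap_of_surjective q Ideal.Quotient.mk_surjective J]
        refine Ideal.map_mono (hle _ inferInstance (Ideal.comap_ne_top q hJ₁) fun f hf => ?_)
        rw [Ideal.mem_comap, Ideal.Quotient.eq_zero_iff_mem.2 hf]
        exact zero_mem J
    exact ⟨n, fun a ha => Ideal.Quotient.eq_zero_iff_mem.1 (by rwa [hn] at ha)⟩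
  -- Level k of the filtration is reached by whatever the k-th power of I modulo 𝔫 annihilates. At k
  -- = 0 the power is the whole ring, which forces y = 0.
  suffices hk : ∀ k (y : C), (∀ a, q a ∈ I.map q ^ k → a.ofConv y = 0) →
      y ∈ conilFiltration (K := K) o k from ⟨n, hk n x fun a ha => hn a ha x hx⟩
  intro k
  induction k with
  | zero =>
    refine fun y hy => eq_of_dualAlgebra (K := K) fun g => ?_
    rw [hy g (by rw [Submodule.pow_zero, Ideal.one_eq_top]; exact Submodule.mem_top), map_zero]
  | succ k ih =>
    refine fun y hy f hf => ih _ fun a ha => ?_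
    rw [apply_hitLeft]
    refine hy _ ?_
    rw [map_mul, Submodule.pow_succ]
    exact Ideal.mul_mem_mul ha (Ideal.mem_map_of_mem q hf)

end Subcoalgebra

/-! ### Eventual equality of Sweedler sums -/

section Eventually

variable {ι K A B M : Type*} [Field K] [AddCommMonoid A] [Module K A] [AddCommMonoid B]
  [Module K B] [AddCommMonoid M]

theorem eventually_sw_eq {l : Filter ι} {F G : ι → A → B → M}
    (h : ∀ a b, ∀ᶠ i in l, F i a b = G i a b) (t : A ⊗[K] B) :
    ∀ᶠ i in l, sw t (F i) = sw t (G i) := by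
  filter_upwards [(Filter.eventually_all_finset _).2 fun (p : A × B) _ => h p.1 p.2] with i hi
  exact Finset.sum_congr rfl hi

theorem sw_zero (t : A ⊗[K] B) : sw t (fun _ _ => (0 : M)) = 0 := Finset.sum_const_zero

end Eventually

/-! ### Geometric series for convolution -/

section ConvolutionPower

variable {K H V : Type*} [Field K] [Ring H] [HopfAlgebra K H] [AddCommGroup V] [Module K V]

/-- The convolution powers of a linear form. -/
def convPow (Δ : V →ₗ[K] V ⊗[K] V) (ε f : V →ₗ[K] K) : ℕ → V →ₗ[K] K
  | 0 => ε
  | n + 1 => conv Δ (convPow Δ ε f n) f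

theorem conv_add (Δ : V →ₗ[K] V ⊗[K] V) (f g k : V →ₗ[K] K) :
    conv Δ f (g + k) = conv Δ f g + conv Δ f k := by
  rw [conv, TensorProduct.map_add_right, LinearMap.add_comp, LinearMap.comp_add]; rfl

theorem add_conv (Δ : V →ₗ[K] V ⊗[K] V) (f g k : V →ₗ[K] K) :
    conv Δ (f + g) k = conv Δ f k + conv Δ g k := by
  rw [conv, TensorProduct.map_add_left, LinearMap.add_comp, LinearMap.comp_add]; rfl

theorem conv_sub (Δ : V →ₗ[K] V ⊗[K] V) (f g k : V →ₗ[K] K) :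
    conv Δ f (g - k) = conv Δ f g - conv Δ f k := by
  rw [eq_sub_iff_add_eq, ← conv_add, sub_add_cancel]

theorem sub_conv (Δ : V →ₗ[K] V ⊗[K] V) (f g k : V →ₗ[K] K) :
    conv Δ (f - g) k = conv Δ f k - conv Δ g k := by
  rw [eq_sub_iff_add_eq, ← add_conv, sub_add_cancel]

variable {X : YDStr K H V} {Δ : V →ₗ[K] V ⊗[K] V} {ε : V →ₗ[K] K}

namespace IsYDCoalgebra

variable (hX : IsYDCoalgebra X Δ ε)

include hX

theorem convPow_add (f : V →ₗ[K] K) (n m : ℕ) :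
    convPow Δ ε f (n + m) = conv Δ (convPow Δ ε f n) (convPow Δ ε f m) := by
  induction m with
  | zero => exact (hX.conv_counit _).symm
  | succ m ih => rw [← add_assoc, convPow, ih, hX.conv_assoc]; rfl

theorem conv_convPow (f : V →ₗ[K] K) (n : ℕ) :
    conv Δ f (convPow Δ ε f n) = convPow Δ ε f (n + 1) := by
  rw [add_comm, hX.convPow_add]
  exact congrArg (conv Δ · _) (hX.counit_conv f).symm

theorem conv_geomSum (f : V →ₗ[K] K) (N : ℕ) :
    conv Δ (ε - f) (∑ n ∈ Finset.range N, convPow Δ ε f n) = ε - convPow Δ ε f N ∧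
    conv Δ (∑ n ∈ Finset.range N, convPow Δ ε f n) (ε - f) = ε - convPow Δ ε f N := by
  induction N with
  | zero =>
    refine ⟨LinearMap.ext fun z => ?_, LinearMap.ext fun z => ?_⟩ <;>
      simp [conv_apply, convPow, sw_zero]
  | succ N ih =>
    rw [Finset.sum_range_succ, conv_add, add_conv, ih.1, ih.2, sub_conv, conv_sub, hX.conv_convPow,
      hX.conv_counit, hX.counit_conv]
    exact ⟨sub_add_sub_cancel .., sub_add_sub_cancel ..⟩

/-- `ε - f` is convolution invertible if `f` is locally nilpotent. -/
theorem convInvertible_sub {f : V →ₗ[K] K}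
    (hf : ∀ z, ∀ᶠ n in Filter.atTop, convPow Δ ε f n z = 0) : ConvInvertible Δ ε (ε - f) := by
  let S (N : ℕ) : V →ₗ[K] K := ∑ n ∈ Finset.range N, convPow Δ ε f n
  -- The partial sums stabilise at each z. Only finitely many values enter linearity or Δ(z), so
  -- each identity for the limit can be checked at one large N.
  have hS : ∀ z, ∃ c, ∀ᶠ N in Filter.atTop, c = S N z := fun z => by
    obtain ⟨N₀, h⟩ := Filter.eventually_atTop.1 (hf z)
    refine ⟨S N₀ z, Filter.eventually_atTop.2 ⟨N₀, fun N hN => ?_⟩⟩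
    induction N, hN using Nat.le_induction with
    | base => rfl
    | succ N hN ih =>
      rw [ih]
      simp only [S, Finset.sum_range_succ, LinearMap.add_apply, h N hN, add_zero]
  choose c hc using hS
  let w : V →ₗ[K] K :=
    { toFun := c
      map_add' := fun x y => by
        obtain ⟨N, h₁, h₂, h₃⟩ := ((hc x).and ((hc y).and (hc (x + y)))).exists
        rw [h₁, h₂, h₃, map_add]
      map_smul' := fun k x => by
        obtain ⟨N, h₁, h₂⟩ := ((hc x).and (hc (k • x))).exists
        rw [h₁, h₂, map_smul, RingHom.id_apply] }
  refine ⟨w, LinearMap.ext fun z => ?_, LinearMap.ext fun z => ?_⟩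
  · obtain ⟨N, h₁, h₂⟩ := ((eventually_sw_eq (fun a b => (hc b).mono fun N h =>
      congrArg ((ε - f) a * ·) h) (Δ z)).and (hf z)).exists
    rw [conv_apply]
    refine h₁.trans ((conv_apply Δ (ε - f) (S N) z).symm.trans ?_)
    rw [(hX.conv_geomSum f N).1, LinearMap.sub_apply, h₂, sub_zero]
  · obtain ⟨N, h₁, h₂⟩ := ((eventually_sw_eq (fun a b => (hc a).mono fun N h =>
      congrArg (· * (ε - f) b) h) (Δ z)).and (hf z)).exists
    rw [conv_apply]
    refine h₁.trans ((conv_apply Δ (S N) (ε - f) z).symm.trans ?_)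
    rw [(hX.conv_geomSum f N).2, LinearMap.sub_apply, h₂, sub_zero]

end IsYDCoalgebra

end ConvolutionPower

/-! ### Local nilpotency on R ⊗ R -/

namespace PreBialgebra

variable {K H R : Type*} [Field K] [Ring H] [HopfAlgebra K H]
  [AddCommGroup R] [Module K R] [Coalgebra K R] {P : PreBialgebra K H R}

local notation "Δ" => Coalgebra.comul (R := K) (A := R)

theorem comul₂_tmul_one (r : R) : P.comul₂ (r ⊗ₜ P.one) =
    sw (Δ r) fun r₁ r₂ => (r₁ ⊗ₜ[K] P.one) ⊗ₜ[K] (r₂ ⊗ₜ[K] P.one) := by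
  simp (disch := fun_prop) only [comul₂_tmul, P.comul_one, sw_tmul, P.act_one,
    TensorProduct.tmul_smul, ← TensorProduct.smul_tmul', P.isYDCoalgebra.coact_counit_smul]

theorem hitLeft_act (f : DualAlgebra K R) (h : H) (x : R) : hitLeft f (P.yd.act h x) =
    sw (Coalgebra.comul (R := K) h) fun h₁ h₂ =>
      P.yd.act h₁ (hitLeft (.toConv (f.ofConv ∘ₗ P.yd.act h₂)) x) := by
  simp (disch := fun_prop) only [hitLeft_apply, P.isYDCoalgebra.comul_act, sw_sw, sw_tmul, sw_map,
    map_smul, LinearMap.comp_apply]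

/-- H acts on 1_R through its counit, so a form killing 1_R still kills it after precomposition with
the action of an element of H. -/
theorem act_mem_conilFiltration (n : ℕ) (h : H) {x : R}
    (hx : x ∈ conilFiltration (K := K) P.one n) :
    P.yd.act h x ∈ conilFiltration (K := K) P.one n := by
  induction n generalizing h x with
  | zero =>
    obtain rfl : x = 0 := hx
    rw [map_zero]
    exact zero_mem _
  | succ n ih =>
    intro f hf
    rw [hitLeft_act]
    refine Submodule.sum_mem _ fun p _ => ih _ (hx _ ?_)
    change f.ofConv (P.yd.act p.2 P.one) = 0
    rw [P.act_one, map_smul, hf, smul_zero]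

section Nilpotent

variable {f : R ⊗[K] R →ₗ[K] K} (hf : f (P.one ⊗ₜ P.one) = 0)

include hf

theorem convPow_tmul_one {q : ℕ} {x : R} (hx : x ∈ conilFiltration (K := K) P.one q) {n : ℕ}
    (hn : q ≤ n) : convPow P.comul₂ (counit₂ K R) f n (x ⊗ₜ P.one) = 0 := by
  induction q generalizing x n with
  | zero =>
    obtain rfl : x = 0 := hx
    rw [TensorProduct.zero_tmul, map_zero]
  | succ q ih =>
    obtain ⟨n, rfl⟩ : ∃ k, n = k + 1 := ⟨n - 1, by lia⟩
    -- The form f(– ⊗ 1) kills 1_R because f(1 ⊗ 1) = 0. Splitting off the last factor of the power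
    -- applies it to x and lowers the filtration level by one.
    have e := ih (hx (.toConv (f ∘ₗ (TensorProduct.mk K R R).flip P.one)) hf) (n := n) (by lia)
    rw [← e, convPow, conv_apply, comul₂_tmul_one]
    simp (disch := fun_prop) only [hitLeft_apply, sw_sw, sw_tmul, sw_tmul_right, sw_map,
      ← TensorProduct.smul_tmul', map_smul, smul_eq_mul]
    exact sw_congr fun a b => mul_comm ..

theorem eventually_convPow_tmul (hR : ∀ x : R, ∃ n, x ∈ conilFiltration (K := K) P.one n) {q : ℕ}
    (x : R) {y : R} (hy : y ∈ conilFiltration (K := K) P.one q) :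
    ∀ᶠ n in Filter.atTop, convPow P.comul₂ (counit₂ K R) f n (x ⊗ₜ y) = 0 := by
  induction q generalizing x y with
  | zero =>
    obtain rfl : y = 0 := hy
    simp only [TensorProduct.tmul_zero, map_zero, Filter.eventually_true]
  | succ q ih =>
    -- The exponent is split in two. First p.1 is taken so large that the finitely many forms
    -- f^{p.1}(b ⊗ –) kill 1_R; each then lowers the level of y. Only afterwards is p.2 chosen,
    -- depending on p.1, by induction: this order of limits is the curried filter.
    have key : ∀ᶠ p in (Filter.atTop : Filter ℕ).curry (Filter.atTop : Filter ℕ),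
        convPow P.comul₂ (counit₂ K R) f (p.2 + p.1) (x ⊗ₜ y) = 0 := by
      have e : ∀ p : ℕ × ℕ, convPow P.comul₂ (counit₂ K R) f (p.2 + p.1) (x ⊗ₜ y) =
          sw (Δ x) fun a c => sw (P.yd.coact c) fun h b => convPow P.comul₂ (counit₂ K R) f p.2
            (a ⊗ₜ P.yd.act h (hitLeft (.toConv (convPow P.comul₂ (counit₂ K R) f p.1 ∘ₗ
              TensorProduct.mk K R R b)) y)) := fun p => by
        rw [P.isYDCoalgebra₂.convPow_add, conv_apply, comul₂_tmul]
        simp (disch := fun_prop) only [hitLeft_apply, sw_sw, sw_tmul, tmul_sw, sw_map,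
          TensorProduct.tmul_smul, map_smul, smul_eq_mul]
        exact sw_congr fun a b => sw_congr fun _ _ => sw_congr fun _ _ => mul_comm ..
      have h₀ : ∀ a c, ∀ᶠ p in (Filter.atTop : Filter ℕ).curry (Filter.atTop : Filter ℕ),
          (sw (P.yd.coact c) fun h b => convPow P.comul₂ (counit₂ K R) f p.2
            (a ⊗ₜ P.yd.act h (hitLeft (.toConv (convPow P.comul₂ (counit₂ K R) f p.1 ∘ₗ
              TensorProduct.mk K R R b)) y))) = 0 := fun a c => by
        refine (eventually_sw_eq (G := fun _ _ _ => (0 : K)) (fun h b => ?_) (P.yd.coact c)).mono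
          fun p hp => hp.trans (sw_zero _)
        rw [Filter.eventually_curry_iff]
        obtain ⟨n, hn⟩ := hR b
        filter_upwards [Filter.eventually_ge_atTop n] with m hm
        exact ih a (act_mem_conilFiltration q h (hy _ (convPow_tmul_one hf hn hm)))
      refine (eventually_sw_eq (G := fun _ _ _ => (0 : K)) h₀ (Δ x)).mono
        fun p hp => (e p).trans (hp.trans (sw_zero _))
    obtain ⟨m, hm⟩ := (Filter.eventually_curry_iff.1 key).exists
    obtain ⟨N, hN⟩ := Filter.eventually_atTop.1 hm
    refine Filter.eventually_atTop.2 ⟨N + m, fun n hn => ?_⟩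
    have := hN (n - m) (by lia)
    rwa [Nat.sub_add_cancel (by lia)] at this

theorem eventually_convPow (hR : ∀ x : R, ∃ n, x ∈ conilFiltration (K := K) P.one n)
    (z : R ⊗[K] R) : ∀ᶠ n in Filter.atTop, convPow P.comul₂ (counit₂ K R) f n z = 0 := by
  induction z with
  | zero => simp only [map_zero, Filter.eventually_true]
  | tmul x y =>
    obtain ⟨q, hq⟩ := hR y
    exact eventually_convPow_tmul hf hR x hq
  | add x y hx hy =>
    filter_upwards [hx, hy] with n h₁ h₂
    rw [map_add, h₁, h₂, add_zero]

end Nilpotent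

theorem counit₂_one : counit₂ K R (P.one ⊗ₜ P.one) = 1 := by
  rw [counit₂, tensorForm_tmul, P.counit_one, _root_.mul_one]

/-- Over a connected pre-bialgebra, `v` with `v(1 ⊗ 1) = 1` is convolution invertible. -/
theorem invertible_of_map_one (hP : P.IsConnected) {v : R ⊗[K] R →ₗ[K] K}
    (hv : v (P.one ⊗ₜ P.one) = 1) : P.Invertible₂ v := by
  have h := P.isYDCoalgebra₂.convInvertible_sub (eventually_convPow (f := counit₂ K R - v)
    (by rw [LinearMap.sub_apply, hv, counit₂_one, sub_self])
    (exists_mem_conilFiltration hP P.comul_one P.counit_one))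
  rwa [sub_sub_cancel] at h

end PreBialgebra

/-! ### The bijection between 𝒮 and 𝒢 and its restriction to cocycles -/

namespace PreBialgebra

variable {K H R : Type*} [Field K] [Ring H] [HopfAlgebra K H]
  [AddCommGroup R] [Module K R] [Coalgebra K R] {P : PreBialgebra K H R}

local notation "Δ" => Coalgebra.comul (R := K) (A := R)

local notation "ε" => Coalgebra.counit (R := K) (A := R)

local notation "𝒰" => Algebra.linearMap K

theorem comul₂_one_tmul (r : R) : P.comul₂ (P.one ⊗ₜ r) =
    sw (Δ r) fun r₁ r₂ => (P.one ⊗ₜ[K] r₁) ⊗ₜ[K] (P.one ⊗ₜ[K] r₂) := by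
  simp (disch := fun_prop) only [comul₂_tmul, P.comul_one, P.coact_one, sw_tmul, map_one,
    Module.End.one_apply]

theorem comul₂_one : P.comul₂ (P.one ⊗ₜ P.one) =
    (P.one ⊗ₜ[K] P.one) ⊗ₜ[K] (P.one ⊗ₜ[K] P.one) := by
  simp (disch := fun_prop) only [comul₂_one_tmul, P.comul_one, sw_tmul]

theorem counit₂_tmul_one (r : R) : counit₂ K R (r ⊗ₜ P.one) = ε r := by
  rw [counit₂, tensorForm_tmul, P.counit_one, _root_.mul_one]

theorem counit₂_one_tmul (r : R) : counit₂ K R (P.one ⊗ₜ r) = ε r := by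
  rw [counit₂, tensorForm_tmul, P.counit_one, _root_.one_mul]

section Unital

variable {v w : R ⊗[K] R →ₗ[K] K} (h : IsConvInverse P.comul₂ (counit₂ K R) v w)

include h

theorem inverse_one (hv : v (P.one ⊗ₜ P.one) = 1) : w (P.one ⊗ₜ P.one) = 1 := by
  have e := LinearMap.congr_fun h.1 (P.one ⊗ₜ P.one)
  rwa [conv_apply, comul₂_one, sw_tmul _ _ _ (by fun_prop) (by fun_prop), hv, _root_.one_mul,
    counit₂_one] at e

theorem inverse_tmul_one (hv : ∀ r, v (r ⊗ₜ P.one) = ε r) (r : R) : w (r ⊗ₜ P.one) = ε r := by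
  have e := LinearMap.congr_fun h.1 (r ⊗ₜ P.one)
  rw [conv_apply, comul₂_tmul_one] at e
  simp (disch := fun_prop) only [sw_sw, sw_tmul, hv, ← smul_eq_mul,
    P.isYDCoalgebra.counit_left_smul, counit₂_tmul_one] at e
  exact e

theorem inverse_one_tmul (hv : ∀ r, v (P.one ⊗ₜ r) = ε r) (r : R) : w (P.one ⊗ₜ r) = ε r := by
  have e := LinearMap.congr_fun h.1 (P.one ⊗ₜ r)
  rw [conv_apply, comul₂_one_tmul] at e
  simp (disch := fun_prop) only [sw_sw, sw_tmul, hv, ← smul_eq_mul,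
    P.isYDCoalgebra.counit_left_smul, counit₂_one_tmul] at e
  exact e

theorem conv_Psi_one (hv : v (P.one ⊗ₜ P.one) = 1) :
    conv P.comul₂ (𝒰 H ∘ₗ w) (P.yd₂.Psi v) (P.one ⊗ₜ P.one) = 1 := by
  rw [← convLeft_eq_conv, convLeft_apply, comul₂_one, sw_tmul _ _ _ (by fun_prop) (by fun_prop),
    inverse_one h hv, one_smul, Psi_apply, coact₂_tmul, P.coact_one]
  simp (disch := fun_prop) only [sw_tmul, hv, one_smul, _root_.mul_one]

theorem conv_Psi_tmul_one (hv : ∀ r, v (r ⊗ₜ P.one) = ε r) (r : R) :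
    conv P.comul₂ (𝒰 H ∘ₗ w) (P.yd₂.Psi v) (r ⊗ₜ P.one) = ε r • (1 : H) := by
  rw [← convLeft_eq_conv, convLeft_apply, comul₂_tmul_one]
  simp (disch := fun_prop) only [sw_sw, sw_tmul, inverse_tmul_one h hv, Psi_apply, coact₂_tmul,
    P.coact_one, hv, _root_.mul_one, P.isYDCoalgebra.counit_coact_smul,
    P.isYDCoalgebra.counit_left_smul]

theorem conv_Psi_one_tmul (hv : ∀ r, v (P.one ⊗ₜ r) = ε r) (r : R) :
    conv P.comul₂ (𝒰 H ∘ₗ w) (P.yd₂.Psi v) (P.one ⊗ₜ r) = ε r • (1 : H) := by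
  rw [← convLeft_eq_conv, convLeft_apply, comul₂_one_tmul]
  simp (disch := fun_prop) only [sw_sw, sw_tmul, inverse_one_tmul h hv, Psi_apply, coact₂_tmul,
    P.coact_one, hv, _root_.one_mul, P.isYDCoalgebra.counit_coact_smul,
    P.isYDCoalgebra.counit_left_smul]

end Unital

theorem Invertible₂.isConvInverse {v : R ⊗[K] R →ₗ[K] K} (h : P.Invertible₂ v) :
    IsConvInverse P.comul₂ (counit₂ K R) v (P.inv₂ v) := ConvInvertible.isConvInverse h

theorem inv₂_eq {v w : R ⊗[K] R →ₗ[K] K} (h : IsConvInverse P.comul₂ (counit₂ K R) v w) :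
    P.inv₂ v = w := h.convInv_eq P.isYDCoalgebra₂

theorem comp_conv_Psi {v w : R ⊗[K] R →ₗ[K] K} (lam : H →ₗ[K] K) :
    lam ∘ₗ conv P.comul₂ (𝒰 H ∘ₗ w) (P.yd₂.Psi v) = conv P.comul₂ w (lam ∘ₗ P.yd₂.Psi v) := by
  rw [← convLeft_eq_conv, comp_convLeft, convLeft_eq_conv, linearMap_self_comp]

section Integral

variable {lam : H →ₗ[K] K} (hlam : IsAdInvariantIntegral lam)

include hlam

theorem invariant_of_mem_setS {ξ : R ⊗[K] R →ₗ[K] H} (hξ : ξ ∈ P.setS) :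
    P.IsInvariant (lam ∘ₗ ξ) := fun h z => by
  rw [LinearMap.comp_apply, hξ.1 h z, hlam.ad_left]; rfl

theorem map_one_of_mem_setS {ξ : R ⊗[K] R →ₗ[K] H} (hξ : ξ ∈ P.setS) :
    (lam ∘ₗ ξ) (P.one ⊗ₜ P.one) = 1 := by
  rw [LinearMap.comp_apply, hξ.2.2, hlam.map_one]

/-- Applying λ to the second leg of the Sweedler condition, the integral property gives ξ * Ψ(λξ) =
u_H λξ; the factor Ψ(λξ) is inverted by Ψ(v). -/
theorem eq_conv_Psi_of_mem_setS {ξ : R ⊗[K] R →ₗ[K] H} (hξ : ξ ∈ P.setS) {v : R ⊗[K] R →ₗ[K] K}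
    (h : IsConvInverse P.comul₂ (counit₂ K R) (lam ∘ₗ ξ) v) :
    ξ = conv P.comul₂ (𝒰 H ∘ₗ lam ∘ₗ ξ) (P.yd₂.Psi v) := by
  have hX := P.isYDCoalgebra₂
  have e : conv P.comul₂ ξ (P.yd₂.Psi (lam ∘ₗ ξ)) = 𝒰 H ∘ₗ lam ∘ₗ ξ := by
    refine LinearMap.ext fun z => ?_
    rw [← slice_splitCoact]
    refine (congrArg (fun t => TensorProduct.rid K H (lam.lTensor H t))
      (LinearMap.congr_fun hξ.2.1.comul_comp z)).symm.trans ((hlam.left_integral (ξ z)).trans ?_)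
    exact (Algebra.algebraMap_eq_smul_one _).symm
  rw [← e, hX.conv_assoc, ← hX.Psi_conv, h.1, hX.Psi_counit, hX.conv_unit]

theorem mem_setG_of_mem_setS {ξ : R ⊗[K] R →ₗ[K] H} (hξ : ξ ∈ P.setS) {v : R ⊗[K] R →ₗ[K] K}
    (h : IsConvInverse P.comul₂ (counit₂ K R) (lam ∘ₗ ξ) v) : v ∈ P.setG lam := by
  have hX := P.isYDCoalgebra₂
  refine ⟨(invariant_of_mem_setS hlam hξ).inverse h, inverse_one h (map_one_of_mem_setS hlam hξ), ?_⟩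
  -- Applying λ to the formula for ξ gives λξ = λξ * λΨ(v), and cancelling λξ leaves λΨ(v) = ε.
  have e := congrArg (conv P.comul₂ v) (congrArg (lam ∘ₗ ·) (eq_conv_Psi_of_mem_setS hlam hξ h))
  simp only [comp_conv_Psi] at e
  rwa [← hX.conv_assoc, h.2, hX.counit_conv, eq_comm] at e

end Integral

theorem comp_conv_Psi_of_mem_setG {lam : H →ₗ[K] K} {v w : R ⊗[K] R →ₗ[K] K}
    (hv : v ∈ P.setG lam) : lam ∘ₗ conv P.comul₂ (𝒰 H ∘ₗ w) (P.yd₂.Psi v) = w := by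
  rw [comp_conv_Psi, hv.2.2, P.isYDCoalgebra₂.conv_counit]

theorem mem_setS_of_mem_setG {lam : H →ₗ[K] K} {v w : R ⊗[K] R →ₗ[K] K} (hv : v ∈ P.setG lam)
    (h : IsConvInverse P.comul₂ (counit₂ K R) v w) :
    conv P.comul₂ (𝒰 H ∘ₗ w) (P.yd₂.Psi v) ∈ P.setS :=
  ⟨isAdLinear_conv_Psi P.isYDCoalgebra₂ hv.1 (IsInvariant.inverse hv.1 h),
    isSweedlerCocycle_conv h, conv_Psi_one h hv.2.1⟩

theorem cocycles_subset_setS : P.cocycles ⊆ P.setS := fun ξ hξ =>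
  ⟨hξ.linear, hξ.sweedler, by rw [hξ.map_one_right, P.counit_one, one_smul]⟩

theorem alpha_eq {v w : R ⊗[K] R →ₗ[K] K} (h : IsConvInverse P.comul₂ (counit₂ K R) v w) :
    P.alpha v = conv P.comul₃
      (conv P.comul₃ (v ∘ₗ idTensor (P.mulTwist v)) (epsTensor v))
      (conv P.comul₃ (tensorEps w) (w ∘ₗ (P.mulTwist v).rTensor R)) := by
  rw [alpha, alphaPos, alphaNeg, epsTensor_eq, tensorEps_eq, inv₂_eq h]
  rfl

theorem twistData {v w : R ⊗[K] R →ₗ[K] K} (h : IsConvInverse P.comul₂ (counit₂ K R) v w)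
    (hv : P.IsInvariant v) (hc : P.yd₂.IsColinear P.yd (P.mulTwist v)) :
    P.TwistData v w P.mul (P.mulTwist v) where
  inv := h
  invariant := hv
  conj := by rw [mulTwist, inv₂_eq h]
  linear := by
    rw [mulTwist, inv₂_eq h]
    exact (hv.inverse h).convRight_linear (hv.convLeft_linear P.mul_linear)
  coalgebraMap := by
    rw [mulTwist, inv₂_eq h]
    exact isCoalgebraMap_conj h P.comul_mul
  counit := by
    rw [mulTwist, inv₂_eq h, comp_convRight, comp_convLeft, P.counit_mul, convLeft_eq_conv,
      convRight_eq_conv, linearMap_self_comp, linearMap_self_comp]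
    exact (congrArg (fun x => conv P.comul₂ x w) (P.isYDCoalgebra₂.conv_counit v)).trans h.1
  colinear := hc

theorem isCocycle_iff_inV {lam : H →ₗ[K] K} (hlam : lam 1 = 1) {v w : R ⊗[K] R →ₗ[K] K} (hv : v ∈ P.setG lam)
    (h : IsConvInverse P.comul₂ (counit₂ K R) v w) :
    P.IsCocycle (conv P.comul₂ (𝒰 H ∘ₗ w) (P.yd₂.Psi v)) ↔ P.InV lam v := by
  have hS := mem_setS_of_mem_setG hv h
  have hb := braided_iff_isColinear h P.mul
  have hμ : convRight P.comul₂ (convLeft P.comul₂ v P.mul) w = P.mulTwist v := by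
    rw [mulTwist, inv₂_eq h]
  rw [hμ] at hb
  constructor
  · intro hξ
    have hc := hb.1 hξ.braided
    have T := twistData h hv.1 hc
    -- Unitality of ξ descends to w = λξ, and then to v as the inverse of w.
    have hw : ∀ z, w z = lam (conv P.comul₂ (𝒰 H ∘ₗ w) (P.yd₂.Psi v) z) := fun z =>
      (LinearMap.congr_fun (comp_conv_Psi_of_mem_setG (w := w) hv) z).symm
    have hu : ∀ c : K, lam (c • (1 : H)) = c := fun c => by
      rw [map_smul, hlam, smul_eq_mul, _root_.mul_one]
    refine ⟨hv, hc, ?_, ?_, inverse_tmul_one h.symm fun r => by rw [hw, hξ.map_one_right, hu],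
      inverse_one_tmul h.symm fun r => by rw [hw, hξ.map_one_left, hu]⟩
    · rw [alpha_eq h]
      exact T.assoc_iff.1 hξ.assoc
    · rw [alpha_eq h]
      refine T.cocycle_iff.1 ?_
      rw [← cocycle_left_eq, ← cocycle_right_eq _ hS.2.1]
      exact hξ.cocycle
  · intro hV
    have T := twistData h hv.1 hV.colinear
    refine ⟨hS.1, hS.2.1, hb.2 hV.colinear, ?_, ?_, conv_Psi_tmul_one h hV.map_one_right,
      conv_Psi_one_tmul h hV.map_one_left⟩
    · refine T.assoc_iff.2 ?_
      rw [← alpha_eq h]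
      exact hV.assoc
    · rw [cocycle_left_eq, cocycle_right_eq _ hS.2.1]
      refine T.cocycle_iff.2 ?_
      rw [← alpha_eq h]
      exact hV.alpha_colinear

section Bijection

variable {lam : H →ₗ[K] K} (hlam : IsAdInvariantIntegral lam) (hP : P.IsConnected)

include hlam hP

theorem invertible_of_mem_setS {ξ : R ⊗[K] R →ₗ[K] H} (hξ : ξ ∈ P.setS) :
    P.Invertible₂ (lam ∘ₗ ξ) := invertible_of_map_one hP (map_one_of_mem_setS hlam hξ)

theorem mapF_mapG {ξ : R ⊗[K] R →ₗ[K] H} (hξ : ξ ∈ P.setS) : P.mapF (P.mapG lam ξ) = ξ := by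
  have h := (invertible_of_mem_setS hlam hP hξ).isConvInverse
  rw [mapF, mapG, inv₂_eq h.symm]
  exact (eq_conv_Psi_of_mem_setS hlam hξ h).symm

theorem mapG_mem_setG {ξ : R ⊗[K] R →ₗ[K] H} (hξ : ξ ∈ P.setS) : P.mapG lam ξ ∈ P.setG lam :=
  mem_setG_of_mem_setS hlam hξ (invertible_of_mem_setS hlam hP hξ).isConvInverse

omit hlam in
theorem mapG_mapF {v : R ⊗[K] R →ₗ[K] K} (hv : v ∈ P.setG lam) : P.mapG lam (P.mapF v) = v := by
  have h := (invertible_of_map_one hP hv.2.1).isConvInverse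
  rw [mapG, mapF, comp_conv_Psi_of_mem_setG hv, inv₂_eq h.symm]

theorem mapF_mem_cocycles_iff {v : R ⊗[K] R →ₗ[K] K} (hv : v ∈ P.setG lam) :
    P.mapF v ∈ P.cocycles ↔ v ∈ P.setV lam :=
  isCocycle_iff_inV hlam.map_one hv (invertible_of_map_one hP hv.2.1).isConvInverse

theorem invOn_mapF_mapG : Set.InvOn P.mapF (P.mapG lam) P.cocycles (P.setV lam) :=
  ⟨fun _ hξ => mapF_mapG hlam hP (cocycles_subset_setS hξ), fun _ hv => mapG_mapF hP hv.mem⟩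

theorem bijOn_mapG : Set.BijOn (P.mapG lam) P.cocycles (P.setV lam) := by
  refine (invOn_mapF_mapG hlam hP).bijOn (fun ξ hξ => ?_) fun v hv =>
    (mapF_mem_cocycles_iff hlam hP hv.mem).2 hv
  have hS := cocycles_subset_setS hξ
  rw [← mapF_mem_cocycles_iff hlam hP (mapG_mem_setG hlam hP hS), mapF_mapG hlam hP hS]
  exact hξ

end Bijection

end PreBialgebra

end YD

end

theorem mainTheorem4 {K H R : Type*} [Field K] [CharZero K] [Ring H] [HopfAlgebra K H]
    [AddCommGroup R] [Module K R] [Coalgebra K R]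
    (lam : H →ₗ[K] K) (hlam : YD.IsAdInvariantIntegral lam)
    (P : YD.PreBialgebra K H R) (hP : P.IsConnected) :
    (∀ ξ ∈ P.setS, P.Invertible₂ (lam ∘ₗ ξ)) ∧
    (∀ v ∈ P.setG lam, P.Invertible₂ v) ∧
    P.cocycles ⊆ P.setS ∧
    Set.BijOn (P.mapG lam) P.cocycles (P.setV lam) ∧
    Set.InvOn P.mapF (P.mapG lam) P.cocycles (P.setV lam) :=
  ⟨fun _ hξ => YD.PreBialgebra.invertible_of_mem_setS hlam hP hξ,
    fun _ hv => YD.PreBialgebra.invertible_of_map_one hP hv.2.1,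
    YD.PreBialgebra.cocycles_subset_setS, YD.PreBialgebra.bijOn_mapG hlam hP,
    YD.PreBialgebra.invOn_mapF_mapG hlam hP⟩
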